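/- **Setting.** Let $T$ be a binary search tree on a finite set of natural numbers (for instance $[n]$), $s$ an element of $T$, and $P$ the search path of $s$ in $T$ (including the root and $s$), with $|P|$ nodes. A *rearrangement* of $T$ at $s$ replaces $P$ by a search tree $A$ on the nodes of $P$ with root $s$ (the *after-tree*) and reattaches the subtrees hanging off $P$ in the unique way compatible with the order; the result is denoted $T'$. A *minimally self-adjusting algorithm* $\mathcal A$ answers an access to $s$ in $T$ by such a rearrangement (possibly non-deterministically). For a positive weight function $w$ let $W=w(T)$ and $\Phi_T=\sum_{a}\log_2 w(T_a)$, where $a$ runs over the elements of $T$ and $w(T_a)$ is the total weight of the subtree rooted at $a$. $\mathcal A$ *satisfies the access lemma with cost factor $c>0$* if there is a constant $K$ such that for all $T$, $s$, $w$ and every tree $T'$ that $\mathcal A$ can produce when $s$ is accessed in $T$, $$c\,|P|\le \Phi_T-\Phi_{T'}+K\Bigl(1+\log_2\frac{W}{w(s)}\Bigr).$$ **Corollary.** **(i)** *Splay trees.* Let $s=v_0,v_1,\dots,v_k$ be the reversed search path. Sleator and Tarjan's bottom-up splaying (zig, zig-zig, zig-zag) at $s$ is the rearrangement whose after-tree has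 root $s$, the elements of $P$ smaller than $s$ forming a path to the left of $s$ and those larger than $s$ a path to the right, both in their order of depth in $P$, except that whenever $v_{2i+1}$ and $v_{2i+2}$ are on the same side of $s$, then $v_{2i+2}$ is taken off its path and made a child of $v_{2i+1}$. Splaying satisfies the access lemma with cost factor $1$. *Local algorithms.* A *local decomposition* of $P\to A$ with window size $w$ is a sequence of search trees $P=Q_0\to Q_1\to\dots\to Q_k=A$ in which $Q_{i+1}$ arises from $Q_i$ by rearranging a descending path $P_i$ of $Q_i$ into a search tree $T_i$ on the same nodes and relinking the attached subtrees, such that $s\in P_0$ (if $k>0$), $P_{i+1}\setminus P_i\ne\emptyset$, $P_{i+1}\cap P_i\neq\emptyset$, $(P_i\setminus P_{i+1})\cap P_j=\emptyset$ for $j>i+1$, and $|P_i|\le w$. Let $\mathcal A$ be a minimally self-adjusting algorithm and suppose that there are constants such that all its transformations $P\to A$ have a local decomposition with constant window size which satisfies one of the following two sets of conditions (the same set for all transformations): * (Georgakopoulos–McClurkin) the leaf of $P_{i+1}$ is never a leaf of $T_i$, and at least $\delta k-C$ of the $k$ trees $T_i$ are not paths, for constants $\delta>0$ and $C$; * (Subramanian)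 for a constant $D\ge 1$ and all $i$, the leaf of $P_{i+D}$ is not a leaf of the tree into which the $D$ consecutive transformations from the $i$-th on arrange the nodes of $P_i\cup\dots\cup P_{i+D-1}$; and for every $i$ except the last, the leaf $l_i$ of $P_i$ and its predecessor and successor in $P_i$ have in $T_i$ depth smaller than the depth of $l_i$ in $P_i$. Then $\mathcal A$ satisfies the access lemma with some cost factor $c>0$, i.e. $\Omega(|P|)\le\Phi_T-\Phi_{T'}+O(1+\log\frac{W}{w(s)})$. **(ii)** *Greedy BST.* For a height diagram $h:[n]\to\mathbb N$ and $a\in[n]$ let $\mathrm{stair}_h(a)$ be the set of $b$ such that $h(b')<h(b)$ for all $b'\neq b$ between $a$ and $b$ (including $a$), let $N_h(a)$ be the maximal open interval around $a$ containing no $b\ne a$ with $h(b)\ge h(a)$, and let $\Phi_h=\sum_{a\in[n]}\log_2 w(N_h(a)\cap[n])$. On an access to $s$, Greedy BST changes the heights of all elements of $\mathrm{stair}_h(s)$ to one number larger than all heights outside $\mathrm{stair}_h(s)$, giving $h'$. There is a constant $K$ such that for all $n$, $h$, $s$, all resulting $h'$, and all positive weights $w$ with total $W$, $$|\mathrm{stair}_h(s)|\le\Phi_h-\Phi_{h'}+K\Bigl(1+\log_2\frac{W}{w(s)}\Bigr).$$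 **(iii)** *Strict depth-halving.* Let $\varepsilon,c,d>0$ be constants and let $\mathcal A$ be a minimally self-adjusting algorithm such that at every access (a) every node $x$ of $P$ loses at least $(\frac12+\varepsilon)d(x)-c$ ancestors, i.e. at least that many of its $d(x)$ proper ancestors in $P$ are not ancestors of $x$ in $A$; and (b) every node $x\ne s$ of $P$ gains at most $d$ descendants, i.e. at most $d$ nodes of $P$ are proper descendants of $x$ in $A$ but not in $P$. Then $\mathcal A$ satisfies the access lemma with cost factor $1$. -/

import Mathlib

namespace AccessLemma

open BinaryTree

/-! ### Binary search trees -/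

/-- The set of elements stored in a tree. -/
def keys : BinaryTree ℕ → Finset ℕ
  | nil => ∅
  | node x l r => insert x (keys l ∪ keys r)

/-- The binary search tree property. -/
def IsBST : BinaryTree ℕ → Prop
  | nil => True
  | node x l r => (∀ y ∈ keys l, y < x) ∧ (∀ y ∈ keys r, x < y) ∧ IsBST l ∧ IsBST r

/-- The search path of `s`, listed from the root down to `s`. -/
def searchPath : BinaryTree ℕ → ℕ → List ℕ
  | nil, _ => []
  | node x l r, s =>
    if s < x then x :: searchPath l s
    else if x < s then x :: searchPath r s
    else [x]

/-- The before-path: the search path of `s` regarded as a tree (all subtrees hanging off the path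
are removed). -/
def pathTree : BinaryTree ℕ → ℕ → BinaryTree ℕ
  | nil, _ => nil
  | node x l r, s =>
    if s < x then node x (pathTree l s) nil
    else if x < s then node x nil (pathTree r s)
    else node x nil nil

/-- The (possibly empty) subtrees hanging off the search path of `s`, from left to right.
If the path has `m` nodes, there are `m + 1` of them, one for each gap between consecutive
path elements. -/
def pendants : BinaryTree ℕ → ℕ → List (BinaryTree ℕ)
  | nil, _ => [nil]
  | node x l r, s =>
    if s < x then pendants l s ++ [r]
    else if x < s then l :: pendants r s
    else [l, r]

/-- Attach the trees in the list, from left to right, to the empty child positions of a tree.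
For `A` a search tree on the nodes of a search path this is the only way, compatible with the
order of the elements, of attaching the pendant subtrees. -/
def fill : BinaryTree ℕ → List (BinaryTree ℕ) → BinaryTree ℕ
  | nil, L => L.headD nil
  | node x l r, L =>
    node x (fill l (L.take (l.numNodes + 1))) (fill r (L.drop (l.numNodes + 1)))

/-- `A` is a binary search tree on the same elements as `P`. -/
def IsRearrangedTree (P A : BinaryTree ℕ) : Prop :=
  IsBST A ∧ keys A = keys P

/-- `T'` arises from `T` by replacing the search path of `s` by the after-tree `A`, which is
a search tree on the path with root `s`, and reattaching the pendant subtrees. -/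
def IsRearrangement (T : BinaryTree ℕ) (s : ℕ) (A T' : BinaryTree ℕ) : Prop :=
  IsRearrangedTree (pathTree T s) A ∧ (∃ l r, A = node s l r) ∧ T' = fill A (pendants T s)

/-- The proper ancestors of `x` in a search tree `T` containing `x`. -/
def ancestors (T : BinaryTree ℕ) (x : ℕ) : Finset ℕ :=
  (searchPath T x).toFinset.erase x

/-- The depth of `x`: its number of proper ancestors. -/
def depth (T : BinaryTree ℕ) (x : ℕ) : ℕ := (ancestors T x).card

/-- The leaves of a tree (nodes without children). -/
def leaves : BinaryTree ℕ → Finset ℕ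
  | nil => ∅
  | node x nil nil => {x}
  | node _ l r => leaves l ∪ leaves r

/-- A tree in which no node has two children. -/
def IsPath : BinaryTree ℕ → Prop
  | nil => True
  | node _ l r => (l = nil ∧ IsPath r) ∨ (r = nil ∧ IsPath l)

/-! ### Algorithms and the access lemma -/

/-- A (possibly non-deterministic) self-adjusting search tree algorithm: `𝒜 T s T'` means that
`T'` can be the tree after an access to `s` in `T`. -/
abbrev Algorithm := BinaryTree ℕ → ℕ → BinaryTree ℕ → Prop

/-- The total weight of the elements of a tree. -/
def weight (w : ℕ → ℝ) (T : BinaryTree ℕ) : ℝ := ∑ a ∈ keys T, w a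

/-- The sum-of-logs potential: the sum, over all nodes `a`, of the binary logarithm of the
weight of the subtree rooted at `a`. -/
noncomputable def potential (w : ℕ → ℝ) : BinaryTree ℕ → ℝ
  | nil => 0
  | node x l r => Real.logb 2 (weight w (node x l r)) + potential w l + potential w r

/-- The access lemma via the sum-of-logs potential, for the cost measure `c * |P|`, where `P` is
the search path:  `c * |P| ≤ Φ_T - Φ_{T'} + O(1 + log (W / w(s)))`.
The case `c = 1` is the access lemma in its exact form; `∃ c > 0` is its form
`Ω(|P|) ≤ Φ_T - Φ_{T'} + O(1 + log (W / w(s)))`. -/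
def SatisfiesAccessLemma (c : ℝ) (𝒜 : Algorithm) : Prop :=
  ∃ K : ℝ, ∀ (T : BinaryTree ℕ) (s : ℕ) (T' : BinaryTree ℕ) (w : ℕ → ℝ),
    IsBST T → s ∈ keys T → 𝒜 T s T' → (∀ a, 0 < w a) →
      c * ((searchPath T s).length : ℝ) ≤
        potential w T - potential w T' + K * (1 + Real.logb 2 (weight w T / w s))

/-! ### Splay trees -/

/-- One step of the way from a node to the root: `goLeft p r` says that the current node is the
left child of `p`, whose right subtree is `r`; `goRight p l` says that it is the right child
of `p`, whose left subtree is `l`. -/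
inductive Frame
  | goLeft (p : ℕ) (r : BinaryTree ℕ)
  | goRight (p : ℕ) (l : BinaryTree ℕ)

/-- The bottom-up splaying steps of Sleator and Tarjan. The current node is `x` with subtrees
`a` and `b`; the list describes the way from `x` up to the root. -/
def splayUp (x : ℕ) : BinaryTree ℕ → BinaryTree ℕ → List Frame → BinaryTree ℕ
  | a, b, [] => node x a b
  -- zig
  | a, b, [.goLeft p c] => node x a (node p b c)
  | a, b, [.goRight p c] => node x (node p c a) b
  -- zig-zig
  | a, b, .goLeft p c :: .goLeft g d :: rest => splayUp x a (node p b (node g c d)) rest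
  | a, b, .goRight p c :: .goRight g d :: rest => splayUp x (node p (node g d c) a) b rest
  -- zig-zag
  | a, b, .goLeft p c :: .goRight g d :: rest => splayUp x (node g d a) (node p b c) rest
  | a, b, .goRight p c :: .goLeft g d :: rest => splayUp x (node p c a) (node g b d) rest

/-- Search for `s`, recording the way back to the root, then splay at `s`. -/
def splayFrom : BinaryTree ℕ → ℕ → List Frame → BinaryTree ℕ
  | nil, _, _ => nil
  | node x l r, s, way =>
    if s < x then splayFrom l s (.goLeft x r :: way)
    else if x < s then splayFrom r s (.goRight x l :: way)
    else splayUp x l r way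

/-- Splaying at an element `s` of the search tree `T`. -/
def splay (T : BinaryTree ℕ) (s : ℕ) : BinaryTree ℕ := splayFrom T s []

/-- The splay tree algorithm. -/
def splayAlgorithm : Algorithm := fun T s T' => T' = splay T s

/-- Put `u` on top of the path `L` of elements smaller than `s`, or on top of the path `R` of
elements larger than `s`. -/
def pushSide (s u : ℕ) (LR : BinaryTree ℕ × BinaryTree ℕ) : BinaryTree ℕ × BinaryTree ℕ :=
  if u < s then (node u nil LR.1, LR.2) else (LR.1, node u LR.2 nil)

/-- The two sides of the global description of splaying. The list is `v₁, v₂, …`, the reversed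
search path without `s`. It is split into the path of the smaller and the path of the larger
elements, except that whenever `v_{2i+1}` and `v_{2i+2}` are on the same side of `s`, then
`v_{2i+2}` is not on the path but a child of `v_{2i+1}`. -/
def globalSides (s : ℕ) : List ℕ → BinaryTree ℕ × BinaryTree ℕ → BinaryTree ℕ × BinaryTree ℕ
  | [], LR => LR
  | [u], LR => pushSide s u LR
  | u :: v :: rest, LR =>
    if u < s ∧ v < s then globalSides s rest (node u (node v nil nil) LR.1, LR.2)
    else if s < u ∧ s < v then globalSides s rest (LR.1, node u LR.2 (node v nil nil))
    else globalSides s rest (pushSide s v (pushSide s u LR))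

/-- The after-tree of the global description of splaying. -/
def globalSplayTree (T : BinaryTree ℕ) (s : ℕ) : BinaryTree ℕ :=
  let LR := globalSides s (searchPath T s).reverse.tail (nil, nil)
  node s LR.1 LR.2

/-! ### Local algorithms -/

/-- `Q'` arises from `Q` by replacing one occurrence of the subtree `B` by `B'`. -/
inductive ReplacesSubtree (B B' : BinaryTree ℕ) : BinaryTree ℕ → BinaryTree ℕ → Prop
  | here : ReplacesSubtree B B' B B'
  | left {x : ℕ} {l l' r : BinaryTree ℕ} :
      ReplacesSubtree B B' l l' → ReplacesSubtree B B' (node x l r) (node x l' r)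
  | right {x : ℕ} {l r r' : BinaryTree ℕ} :
      ReplacesSubtree B B' r r' → ReplacesSubtree B B' (node x l r) (node x l r')

/-- `p` is a path contained in `Q`, leading from the root of some subtree `B` of `Q` down to the
node `b`, and `Q'` is obtained from `Q` by rearranging `p` into the search tree `t` and linking
the attached subtrees according to the order of the elements. -/
def RearrangesPath (Q p : BinaryTree ℕ) (b : ℕ) (t Q' : BinaryTree ℕ) : Prop :=
  ∃ B : BinaryTree ℕ, b ∈ keys B ∧ p = pathTree B b ∧ IsRearrangedTree p t ∧
    ReplacesSubtree B (fill t (pendants B b)) Q Q'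

/-- A decomposition `P = Q 0 → Q 1 → ⋯ → Q k = A`; in the step from `Q i` to `Q (i + 1)` the path
`path i`, whose leaf is `bottom i`, is rearranged into the tree `tree i`. -/
structure Decomposition (P A : BinaryTree ℕ) where
  k : ℕ
  Q : ℕ → BinaryTree ℕ
  path : ℕ → BinaryTree ℕ
  bottom : ℕ → ℕ
  tree : ℕ → BinaryTree ℕ
  first : Q 0 = P
  last : Q k = A
  step : ∀ i < k, RearrangesPath (Q i) (path i) (bottom i) (tree i) (Q (i + 1))

/-- A decomposition that is local with window size `w`, for an access to `s`. -/
structure Decomposition.IsLocal {P A : BinaryTree ℕ} (D : Decomposition P A) (s w : ℕ) :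
    Prop where
  start : 0 < D.k → s ∈ keys (D.path 0)
  progress : ∀ i, i + 1 < D.k → (keys (D.path (i + 1)) \ keys (D.path i)).Nonempty
  overlap : ∀ i, i + 1 < D.k → (keys (D.path (i + 1)) ∩ keys (D.path i)).Nonempty
  noRevisit : ∀ i j, i + 1 < j → j < D.k →
    Disjoint (keys (D.path i) \ keys (D.path (i + 1))) (keys (D.path j))
  window : ∀ i < D.k, (D.path i).numNodes ≤ w

open Classical in
/-- The conditions of Georgakopoulos and McClurkin on a decomposition: the leaf of `path (i + 1)`
is not a leaf of `tree i`, and `Ω(k)` of the `k` trees are not paths. -/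
def Decomposition.IsGM {P A : BinaryTree ℕ} (D : Decomposition P A) (δ C : ℝ) : Prop :=
  (∀ i, i + 1 < D.k → D.bottom (i + 1) ∉ leaves (D.tree i)) ∧
  δ * D.k - C ≤ (((Finset.range D.k).filter fun i => ¬ IsPath (D.tree i)).card : ℝ)

/-- The set of nodes touched by the `m` steps `i, …, i + m - 1`. -/
def Decomposition.touched {P A : BinaryTree ℕ} (D : Decomposition P A) (i m : ℕ) : Finset ℕ :=
  (Finset.range m).biUnion fun j => keys (D.path (i + j))

/-- The leaves of the tree into which the composition of the `m` steps `i, …, i + m - 1` arranges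
the nodes touched by them. For `m = 1` these are the leaves of `tree i`. -/
def Decomposition.composedLeaves {P A : BinaryTree ℕ} (D : Decomposition P A) (i m : ℕ) :
    Finset ℕ :=
  (D.touched i m).filter fun x => ∀ y ∈ D.touched i m, x ∉ ancestors (D.Q (i + m)) y

/-- The conditions of Subramanian on a decomposition. First, the leaf of `path (i + m)` is not
a leaf of the tree created by the `m` steps from `i` on. Secondly, in every step but the last, the
leaf of the path and its neighbours (predecessor and successor) on the path have in the
rearranged tree a depth smaller than the depth that the leaf had in the path. -/
def Decomposition.IsSubramanian {P A : BinaryTree ℕ} (D : Decomposition P A) (m : ℕ) : Prop :=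
  (∀ i, i + m < D.k → D.bottom (i + m) ∉ D.composedLeaves i m) ∧
  (∀ i, i + 1 < D.k → ∀ y ∈ keys (D.path i),
    (∀ z ∈ keys (D.path i), ¬ (min y (D.bottom i) < z ∧ z < max y (D.bottom i))) →
      depth (D.tree i) y < depth (D.path i) (D.bottom i))

/-- Local algorithms in the sense of Georgakopoulos and McClurkin that bring the accessed element
to the root. -/
def IsGMLocal (𝒜 : Algorithm) : Prop :=
  ∃ (w : ℕ) (δ C : ℝ), 0 < δ ∧ ∀ (T : BinaryTree ℕ) (s : ℕ) (T' : BinaryTree ℕ),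
    IsBST T → s ∈ keys T → 𝒜 T s T' →
      ∃ A, IsRearrangement T s A T' ∧
        ∃ D : Decomposition (pathTree T s) A, D.IsLocal s w ∧ D.IsGM δ C

/-- Local algorithms in the sense of Subramanian that bring the accessed element to the root. -/
def IsSubramanianLocal (𝒜 : Algorithm) : Prop :=
  ∃ w m : ℕ, 0 < m ∧ ∀ (T : BinaryTree ℕ) (s : ℕ) (T' : BinaryTree ℕ),
    IsBST T → s ∈ keys T → 𝒜 T s T' →
      ∃ A, IsRearrangement T s A T' ∧
        ∃ D : Decomposition (pathTree T s) A, D.IsLocal s w ∧ D.IsSubramanian m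

/-! ### Strict depth-halving -/

/-- The ancestors that `x` loses when the path `P` is rearranged into `A`. -/
def lostAncestors (P A : BinaryTree ℕ) (x : ℕ) : Finset ℕ := ancestors P x \ ancestors A x

/-- The descendants that `x` gains when the path `P` is rearranged into `A`. -/
def gainedDescendants (P A : BinaryTree ℕ) (x : ℕ) : Finset ℕ :=
  (keys P).filter fun y => x ∈ ancestors A y ∧ x ∉ ancestors P y

/-- Minimally self-adjusting algorithms based on strict depth-halving, with constants `ε c d`. -/
def IsStrictDepthHalving (ε c d : ℝ) (𝒜 : Algorithm) : Prop :=
  ∀ (T : BinaryTree ℕ) (s : ℕ) (T' : BinaryTree ℕ), IsBST T → s ∈ keys T → 𝒜 T s T' →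
    ∃ A, IsRearrangement T s A T' ∧
      (∀ x ∈ keys (pathTree T s),
        (1 / 2 + ε) * (depth (pathTree T s) x : ℝ) - c
          ≤ ((lostAncestors (pathTree T s) A x).card : ℝ)) ∧
      (∀ x ∈ keys (pathTree T s), x ≠ s →
        ((gainedDescendants (pathTree T s) A x).card : ℝ) ≤ d)

/-! ### Greedy BST in the geometric view -/

/-- The stair of `a` in the height diagram `h`: the rectangle spanned by `(a, ∞)` and `(b, h b)`
contains no point `(b', h b')` other than `(b, h b)`. -/
def stair {n : ℕ} (h : Fin n → ℕ) (a : Fin n) : Finset (Fin n) :=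
  Finset.univ.filter fun b => ∀ b' ∈ Finset.uIcc a b, b' ≠ b → h b' < h b

/-- The elements in the neighborhood of `a`, the maximal open interval around `a` that contains
no other element of height at least `h a`. -/
def neighborhood {n : ℕ} (h : Fin n → ℕ) (a : Fin n) : Finset (Fin n) :=
  Finset.univ.filter fun b => ∀ b' ∈ Finset.uIcc a b, b' ≠ a → h b' < h a

/-- The geometric sum-of-logs potential. -/
noncomputable def geometricPotential {n : ℕ} (w : Fin n → ℝ) (h : Fin n → ℕ) : ℝ :=
  ∑ a, Real.logb 2 (∑ b ∈ neighborhood h a, w b)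

/-- A geometric algorithm: `𝒢 n h s h'` means that `h'` can be the height diagram after an
access to `s` in `h`. -/
abbrev GeometricAlgorithm := (n : ℕ) → (Fin n → ℕ) → Fin n → (Fin n → ℕ) → Prop

/-- Greedy BST: the elements of the stair of the accessed element all get the same new height,
which is any number greater than the heights of the elements outside the stair. -/
def greedyBST : GeometricAlgorithm := fun _ h s h' =>
  ∃ H : ℕ, (∀ a ∉ stair h s, h a < H) ∧ ∀ a, h' a = if a ∈ stair h s then H else h a

/-- The geometric access lemma, for the cost measure `c * |stair|`. -/
def SatisfiesGeometricAccessLemma (c : ℝ) (𝒢 : GeometricAlgorithm) : Prop :=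
  ∃ K : ℝ, ∀ (n : ℕ) (h : Fin n → ℕ) (s : Fin n) (h' : Fin n → ℕ) (w : Fin n → ℝ),
    𝒢 n h s h' → (∀ a, 0 < w a) →
      c * ((stair h s).card : ℝ) ≤
        geometricPotential w h - geometricPotential w h'
          + K * (1 + Real.logb 2 ((∑ a, w a) / w s))

end AccessLemma

/-! Apart from splaying, everything is a comparison of subtree weights on each side of `s`. Let `N
a` and `N' a` be the descendant sets (for Greedy: the neighborhoods) of `a` before and after the
access, and write L for log₂(W / w(s)). Off the search path nothing changes, and `s` itself costs at
most L. A path element `a > s` has `s` in `N a`, so by convexity `N a` contains all elements of [s,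
a], while `N' a` lies strictly to the right of `s`, which is now the root. If `N' a` ends before the
next larger element a⁺, its weight is at most that of [s, a⁺], and the sum of logarithms telescopes
to L. This needs a family of elements none of which is an ancestor of a larger member; colouring by
side depth splits the path into boundedly many such families. Hence bounded side depth already gives
a potential increase of O(L).

Two kinds of elements moreover pay for themselves. (1) Leaves of the after-tree: `N' a` is also
disjoint from [s, a⁻] for the preceding leaf a⁻, so any prescribed constant is gained on each leaf
at the price of a multiple of log w[s, a⁺] - log w[s, a⁻], which telescopes again
(`exists_logb_loss`, `exists_leaves_bound`). (2) Zigzags, where the search path crosses over `s`: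
the new subtrees of the two nodes lie on different sides of `s`, and log x + log y + 2 ≤ 2 log (x +
y) gains 2 (`zigzag_bound`).

Greedy BST: the elements of the stair receive a common height and block each other, so each of them
pays like a leaf. Strict depth-halving: the bound on gained descendants bounds the side depth, and
it makes each leaf account for at most `d` elements off the spines of the after-tree; on a spine all
elements are kept ancestors of one node, so the two spines together hold at most (1 - 2ε)|P| + O(1)
elements. Thus |P| is O(number of leaves) + O(1), and as the gain per leaf is arbitrary, the cost
factor is 1.

Local algorithms: windows have bounded size and move up the path, so side depth is bounded and |P| =
O(k); it remains to bound the number k of steps by leaves and zigzags. Consider a run of steps that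
drop no leaf and whose entering elements all lie to the right. The set of window elements with a
larger element among those already dropped (`supply`) cannot grow. Under the
Georgakopoulos–McClurkin conditions it shrinks whenever the window is not turned into a path; under
Subramanian's it shrinks during any 2m steps. It has at most `w` elements, so such runs contain O(1)
counted steps, and every interruption is charged to a leaf or a zigzag.

Splaying is treated by the classical induction over double rotations; its global description is
proved separately as an identity of trees. -/

namespace AccessLemma

open BinaryTree

/-! ### The descendant order of a search tree -/

/-- The abstract properties of the map sending a node of a search tree on `K` to the set of its
descendants (itself included). They are invariant under reversing the order. -/
structure IsTreeOrder {α : Type*} [LinearOrder α] (K : Finset α) (N : α → Finset α) : Prop where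
  subset : ∀ x ∈ K, ∀ y ∈ N x, y ∈ K
  self_mem : ∀ x ∈ K, x ∈ N x
  trans : ∀ x ∈ K, ∀ y ∈ N x, ∀ z ∈ N y, z ∈ N x
  antisymm : ∀ x ∈ K, ∀ y ∈ N x, x ∈ N y → x = y
  chain : ∀ x ∈ K, ∀ y ∈ K, ∀ z, z ∈ N x → z ∈ N y → y ∈ N x ∨ x ∈ N y
  convex : ∀ x ∈ K, ∀ y ∈ N x, ∀ z ∈ K, (x ≤ z ∧ z ≤ y ∨ y ≤ z ∧ z ≤ x) → z ∈ N x
  lca : ∀ x ∈ K, ∀ y ∈ K, ∃ z ∈ K, (x ≤ z ∧ z ≤ y ∨ y ≤ z ∧ z ≤ x) ∧ x ∈ N z ∧ y ∈ N z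

/-- The axioms are symmetric under reversal, so every statement about elements larger than `s`
yields its mirror image by passing to the order dual. -/
theorem IsTreeOrder.dual {α : Type*} [LinearOrder α] {K : Finset α} {N : α → Finset α}
    (h : IsTreeOrder K N) : IsTreeOrder (α := αᵒᵈ) K N where
  subset := h.subset
  self_mem := h.self_mem
  trans := h.trans
  antisymm := h.antisymm
  chain := h.chain
  convex x hx y hy z hz hb := h.convex x hx y hy z hz (hb.symm.imp And.symm And.symm)
  lca x hx y hy := by
    obtain ⟨z, hz, hb, h1, h2⟩ := h.lca x hx y hy
    exact ⟨z, hz, hb.symm.imp And.symm And.symm, h1, h2⟩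

/-- The descendants of `x` in the search tree `T`, including `x` itself. -/
def desc (T : BinaryTree ℕ) (x : ℕ) : Finset ℕ :=
  (keys T).filter fun y => x ∈ searchPath T y

theorem mem_desc {T : BinaryTree ℕ} {x y : ℕ} :
    y ∈ desc T x ↔ y ∈ keys T ∧ x ∈ searchPath T y := by
  simp [desc]

theorem mem_keys_node {x y : ℕ} {l r : BinaryTree ℕ} :
    y ∈ keys (node x l r) ↔ y = x ∨ y ∈ keys l ∨ y ∈ keys r := by
  simp [keys]

theorem searchPath_subset_keys (T : BinaryTree ℕ) (s x : ℕ) (h : x ∈ searchPath T s) :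
    x ∈ keys T := by
  induction T with
  | nil => simp [searchPath] at h
  | node v l r hl hr =>
    rw [mem_keys_node]
    simp only [searchPath] at h
    split_ifs at h <;> simp only [List.mem_cons, List.not_mem_nil, or_false] at h <;> tauto

theorem mem_searchPath_self {T : BinaryTree ℕ} (hT : IsBST T) {s : ℕ} (hs : s ∈ keys T) :
    s ∈ searchPath T s := by
  induction T with
  | nil => simp [keys] at hs
  | node v l r hl hr =>
    obtain ⟨h1, h2, h3, h4⟩ := hT
    rw [mem_keys_node] at hs
    simp only [searchPath]
    rcases hs with rfl | hs | hs
    · simp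
    · have := h1 s hs
      simp [this, hl h3 hs]
    · have := h2 s hs
      simp [this, this.not_gt, hr h4 hs]

theorem desc_root {x : ℕ} {l r : BinaryTree ℕ} : desc (node x l r) x = keys (node x l r) := by
  ext y
  rw [mem_desc]
  simp only [searchPath]
  split_ifs <;> simp

theorem desc_left {x : ℕ} {l r : BinaryTree ℕ} (hT : IsBST (node x l r)) {z : ℕ}
    (hz : z ∈ keys l) : desc (node x l r) z = desc l z := by
  obtain ⟨h1, h2, h3, h4⟩ := hT
  have hzx := h1 z hz
  ext y
  simp only [mem_desc, mem_keys_node, searchPath]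
  split_ifs with h h'
  · have : y ∉ keys r := fun hy => by have := h2 y hy; omega
    simp [hzx.ne, this, h.ne]
  · have h5 : z ∉ searchPath r y := fun hy => by
      have := h2 z (searchPath_subset_keys r y z hy); omega
    have : y ∉ keys l := fun hy => by have := h1 y hy; omega
    simp [hzx.ne, this, h5]
  · have : y ∉ keys l := fun hy => by have := h1 y hy; omega
    simp [hzx.ne, this]

theorem desc_right {x : ℕ} {l r : BinaryTree ℕ} (hT : IsBST (node x l r)) {z : ℕ}
    (hz : z ∈ keys r) : desc (node x l r) z = desc r z := by
  obtain ⟨h1, h2, h3, h4⟩ := hT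
  have hzx := h2 z hz
  ext y
  simp only [mem_desc, mem_keys_node, searchPath]
  split_ifs with h h'
  · have h5 : z ∉ searchPath l y := fun hy => by
      have := h1 z (searchPath_subset_keys l y z hy); omega
    have : y ∉ keys r := fun hy => by have := h2 y hy; omega
    simp [hzx.ne', this, h5]
  · have : y ∉ keys l := fun hy => by have := h1 y hy; omega
    simp [hzx.ne', this, h'.ne']
  · have : y ∉ keys r := fun hy => by have := h2 y hy; omega
    simp [hzx.ne', this]

theorem desc_subset {T : BinaryTree ℕ} {x : ℕ} : desc T x ⊆ keys T := Finset.filter_subset _ _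

/-- Induction on the tree: the root is comparable to everything and is the common ancestor of any
two elements that it separates; all other cases live inside one subtree. -/
theorem isTreeOrder_desc {T : BinaryTree ℕ} (hT : IsBST T) : IsTreeOrder (keys T) (desc T) := by
  induction T with
  | nil => constructor <;> simp [keys]
  | node v l r ihl ihr =>
    have hB := hT
    obtain ⟨h1, h2, h3, h4⟩ := hT
    have il := ihl h3
    have ir := ihr h4
    have hroot : ∀ z, z ∈ desc (node v l r) v ↔ z = v ∨ z ∈ keys l ∨ z ∈ keys r := by
      intro z; rw [desc_root, mem_keys_node]
    have hl : ∀ x ∈ keys l, desc (node v l r) x = desc l x := fun x hx => desc_left hB hx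
    have hr : ∀ x ∈ keys r, desc (node v l r) x = desc r x := fun x hx => desc_right hB hx
    have sl : ∀ x, ∀ y ∈ desc l x, y ∈ keys l := fun x y hy => desc_subset hy
    have sr : ∀ x, ∀ y ∈ desc r x, y ∈ keys r := fun x y hy => desc_subset hy
    have nlr : ∀ x ∈ keys l, x ∉ keys r := fun x hx hx' => by
      have := h1 x hx; have := h2 x hx'; omega
    have nl : v ∉ keys l := fun hx => by have := h1 v hx; omega
    have nr : v ∉ keys r := fun hx => by have := h2 v hx; omega
    constructor
    · intro x _ y hy
      exact desc_subset hy
    · intro x hx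
      rw [mem_keys_node] at hx
      rcases hx with rfl | hx | hx
      · rw [hroot]; simp
      · rw [hl x hx]; exact il.self_mem x hx
      · rw [hr x hx]; exact ir.self_mem x hx
    · intro x hx y hy z hz
      rw [mem_keys_node] at hx
      rcases hx with rfl | hx | hx
      · rw [desc_root]; exact desc_subset hz
      · rw [hl x hx] at hy ⊢
        rw [hl y (sl _ _ hy)] at hz
        exact il.trans x hx y hy z hz
      · rw [hr x hx] at hy ⊢
        rw [hr y (sr _ _ hy)] at hz
        exact ir.trans x hx y hy z hz
    · intro x hx y hy hxy
      rw [mem_keys_node] at hx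
      rcases hx with rfl | hx | hx
      · rw [hroot] at hy
        rcases hy with rfl | hy | hy
        · rfl
        · rw [hl y hy] at hxy; exact absurd (sl _ _ hxy) nl
        · rw [hr y hy] at hxy; exact absurd (sr _ _ hxy) nr
      · rw [hl x hx] at hy
        rw [hl y (sl _ _ hy)] at hxy
        exact il.antisymm x hx y hy hxy
      · rw [hr x hx] at hy
        rw [hr y (sr _ _ hy)] at hxy
        exact ir.antisymm x hx y hy hxy
    · intro x hx y hy z hzx hzy
      rcases mem_keys_node.1 hx with rfl | hx' | hx'
      · left; rwa [desc_root]
      · rcases mem_keys_node.1 hy with rfl | hy' | hy'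
        · right; rwa [desc_root]
        · rw [hl _ hx'] at hzx ⊢; rw [hl _ hy'] at hzy ⊢
          exact il.chain x hx' y hy' z hzx hzy
        · rw [hl _ hx'] at hzx; rw [hr _ hy'] at hzy
          exact absurd (sr _ _ hzy) (nlr _ (sl _ _ hzx))
      · rcases mem_keys_node.1 hy with rfl | hy' | hy'
        · right; rwa [desc_root]
        · rw [hr _ hx'] at hzx; rw [hl _ hy'] at hzy
          exact absurd (sr _ _ hzx) (nlr _ (sl _ _ hzy))
        · rw [hr _ hx'] at hzx ⊢; rw [hr _ hy'] at hzy ⊢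
          exact ir.chain x hx' y hy' z hzx hzy
    · intro x hx y hy z hz hb
      rcases mem_keys_node.1 hx with rfl | hx' | hx'
      · rwa [desc_root]
      · rw [hl _ hx'] at hy ⊢
        have := h1 _ hx'
        have := h1 _ (sl _ _ hy)
        have hz' : z ∈ keys l := by
          rcases mem_keys_node.1 hz with rfl | h | h
          · omega
          · exact h
          · have := h2 _ h; omega
        exact il.convex x hx' y hy z hz' hb
      · rw [hr _ hx'] at hy ⊢
        have := h2 _ hx'
        have := h2 _ (sr _ _ hy)
        have hz' : z ∈ keys r := by
          rcases mem_keys_node.1 hz with rfl | h | h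
          · omega
          · have := h1 _ h; omega
          · exact h
        exact ir.convex x hx' y hy z hz' hb
    · intro x hx y hy
      have key : (x ≤ v ∧ v ≤ y ∨ y ≤ v ∧ v ≤ x) →
          ∃ z ∈ keys (node v l r), (x ≤ z ∧ z ≤ y ∨ y ≤ z ∧ z ≤ x) ∧
            x ∈ desc (node v l r) z ∧ y ∈ desc (node v l r) z := fun h =>
        ⟨v, by simp [keys], h, by rwa [desc_root], by rwa [desc_root]⟩
      rcases mem_keys_node.1 hx with rfl | hx' | hx'
      · exact key (by omega)
      · have := h1 _ hx'
        rcases mem_keys_node.1 hy with rfl | hy' | hy'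
        · exact key (by omega)
        · obtain ⟨z, hz, hb, hzx, hzy⟩ := il.lca x hx' y hy'
          exact ⟨z, by simp [keys, hz], hb, by rwa [hl z hz], by rwa [hl z hz]⟩
        · have := h2 _ hy'
          exact key (by omega)
      · have := h2 _ hx'
        rcases mem_keys_node.1 hy with rfl | hy' | hy'
        · exact key (by omega)
        · have := h1 _ hy'
          exact key (by omega)
        · obtain ⟨z, hz, hb, hzx, hzy⟩ := ir.lca x hx' y hy'
          exact ⟨z, by simp [keys, hz], hb, by rwa [hr z hz], by rwa [hr z hz]⟩

/-- Turns the recursive potential into a sum indexed by elements, so that two trees on the same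
elements can be compared term by term. -/
theorem potential_eq_sum (w : ℕ → ℝ) {T : BinaryTree ℕ} (hT : IsBST T) :
    potential w T = ∑ x ∈ keys T, Real.logb 2 (∑ y ∈ desc T x, w y) := by
  induction T with
  | nil => simp [potential, keys]
  | node v l r ihl ihr =>
    have hB := hT
    obtain ⟨h1, h2, h3, h4⟩ := hT
    have nlr : Disjoint (keys l) (keys r) := Finset.disjoint_left.2 fun x hx hx' => by
      have := h1 x hx; have := h2 x hx'; omega
    have nl : v ∉ keys l ∪ keys r := by
      rw [Finset.mem_union]
      rintro (h | h)
      · have := h1 v h; omega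
      · have := h2 v h; omega
    rw [show keys (node v l r) = insert v (keys l ∪ keys r) from rfl, Finset.sum_insert nl,
      Finset.sum_union nlr, potential, desc_root, ihl h3, ihr h4, weight]
    have e1 : ∑ x ∈ keys l, Real.logb 2 (∑ y ∈ desc (node v l r) x, w y) =
        ∑ x ∈ keys l, Real.logb 2 (∑ y ∈ desc l x, w y) :=
      Finset.sum_congr rfl fun x hx => by rw [desc_left hB hx]
    have e2 : ∑ x ∈ keys r, Real.logb 2 (∑ y ∈ desc (node v l r) x, w y) =
        ∑ x ∈ keys r, Real.logb 2 (∑ y ∈ desc r x, w y) :=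
      Finset.sum_congr rfl fun x hx => by rw [desc_right hB hx]
    rw [e1, e2]
    ring

/-! ### Inorder traversals -/

/-- The elements of a tree from left to right. -/
def inorder : BinaryTree ℕ → List ℕ
  | nil => []
  | node x l r => inorder l ++ x :: inorder r

theorem mem_inorder {T : BinaryTree ℕ} {x : ℕ} : x ∈ inorder T ↔ x ∈ keys T := by
  induction T with
  | nil => simp [inorder, keys]
  | node v l r ihl ihr =>
    rw [mem_keys_node, inorder, List.mem_append, List.mem_cons, ihl, ihr]
    tauto

theorem isBST_iff {T : BinaryTree ℕ} : IsBST T ↔ (inorder T).Pairwise (· < ·) := by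
  induction T with
  | nil => simp [inorder, IsBST]
  | node v l r ihl ihr =>
    simp only [IsBST, inorder, List.pairwise_append, List.pairwise_cons, List.mem_cons, ihl, ihr,
      mem_inorder]
    constructor
    · rintro ⟨h1, h2, h3, h4⟩
      refine ⟨h3, ⟨h2, h4⟩, ?_⟩
      rintro a ha b (rfl | hb)
      · exact h1 a ha
      · exact (h1 a ha).trans (h2 b hb)
    · rintro ⟨h3, ⟨h2, h4⟩, h5⟩
      exact ⟨fun y hy => h5 y hy v (Or.inl rfl), h2, h3, h4⟩

theorem inorder_eq_of_keys_eq {T T' : BinaryTree ℕ} (hT : IsBST T) (hT' : IsBST T')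
    (h : keys T = keys T') : inorder T = inorder T' := by
  rw [isBST_iff] at hT hT'
  refine List.Perm.eq_of_pairwise (fun a b _ _ h1 h2 => absurd h2 h1.not_gt) hT hT' ?_
  rw [List.perm_ext_iff_of_nodup (hT.imp fun h => h.ne) (hT'.imp fun h => h.ne)]
  intro a
  rw [mem_inorder, mem_inorder, h]

theorem length_inorder (T : BinaryTree ℕ) : (inorder T).length = T.numNodes := by
  induction T with
  | nil => rfl
  | node v l r ihl ihr => simp [inorder, ihl, ihr]; omega

theorem card_keys {T : BinaryTree ℕ} (hT : IsBST T) : (keys T).card = T.numNodes := by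
  rw [isBST_iff] at hT
  rw [← length_inorder, ← List.toFinset_card_of_nodup (hT.imp fun h => h.ne)]
  congr 1
  ext x
  rw [List.mem_toFinset, mem_inorder]

/-- Interleave a list of elements with a list of blocks. -/
def weave : List ℕ → List (List ℕ) → List ℕ
  | [], L => L.headD []
  | x :: xs, L => L.headD [] ++ x :: weave xs L.tail

theorem weave_append (xs ys : List ℕ) (x : ℕ) (L : List (List ℕ)) (hL : xs.length + 1 ≤ L.length) :
    weave (xs ++ x :: ys) L =
      weave xs (L.take (xs.length + 1)) ++ x :: weave ys (L.drop (xs.length + 1)) := by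
  induction xs generalizing L with
  | nil =>
    cases L with
    | nil => simp at hL
    | cons a L => simp [weave]
  | cons y xs ih =>
    cases L with
    | nil => simp at hL
    | cons a L =>
      simp only [List.length_cons, add_le_add_iff_right] at hL
      simp [weave, ih L hL]

/-- The inorder list of a filled tree depends on the skeleton only through the inorder list of the
skeleton. Exchanging the path for another search tree on its nodes therefore preserves the search
tree property and the elements. -/
theorem inorder_fill (t : BinaryTree ℕ) (L : List (BinaryTree ℕ))
    (hL : L.length = t.numNodes + 1) :
    inorder (fill t L) = weave (inorder t) (L.map inorder) := by
  induction t generalizing L with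
  | nil =>
    cases L with
    | nil => simp at hL
    | cons a L => simp [fill, inorder, weave]
  | node v l r ihl ihr =>
    simp only [numNodes] at hL
    rw [inorder, weave_append, fill, inorder, ihl, ihr, length_inorder, List.map_take,
      List.map_drop]
    · simp; omega
    · simp; omega
    · simp [length_inorder]; omega

theorem length_pendants (T : BinaryTree ℕ) (s : ℕ) :
    (pendants T s).length = (pathTree T s).numNodes + 1 := by
  induction T with
  | nil => rfl
  | node v l r ihl ihr =>
    simp only [pendants, pathTree]
    split_ifs <;> simp [ihl, ihr]

/-- Exhibits the tree before the access as a filling too, so that facts about `fill` describe both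
sides of a rearrangement. -/
theorem fill_pathTree (T : BinaryTree ℕ) (s : ℕ) : fill (pathTree T s) (pendants T s) = T := by
  induction T with
  | nil => rfl
  | node v l r ihl ihr =>
    simp only [pendants, pathTree]
    split_ifs
    · rw [fill, ← length_pendants, List.take_left, List.drop_left, ihl]; rfl
    · simp [fill, ihr]
    · simp [fill]

theorem toFinset_searchPath (T : BinaryTree ℕ) (s : ℕ) :
    (searchPath T s).toFinset = keys (pathTree T s) := by
  induction T with
  | nil => rfl
  | node v l r ihl ihr =>
    simp only [searchPath, pathTree]
    split_ifs <;> simp [keys, ihl, ihr]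

theorem mem_keys_pathTree {T : BinaryTree ℕ} {s x : ℕ} :
    x ∈ keys (pathTree T s) ↔ x ∈ searchPath T s := by
  rw [← toFinset_searchPath, List.mem_toFinset]

theorem isBST_pathTree {T : BinaryTree ℕ} (hT : IsBST T) (s : ℕ) : IsBST (pathTree T s) := by
  induction T with
  | nil => trivial
  | node v l r ihl ihr =>
    obtain ⟨h1, h2, h3, h4⟩ := hT
    have hl : ∀ y ∈ keys (pathTree l s), y ∈ keys l := fun y hy =>
      searchPath_subset_keys _ _ _ (mem_keys_pathTree.1 hy)
    have hr : ∀ y ∈ keys (pathTree r s), y ∈ keys r := fun y hy =>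
      searchPath_subset_keys _ _ _ (mem_keys_pathTree.1 hy)
    simp only [pathTree]
    split_ifs
    · exact ⟨fun y hy => h1 y (hl y hy), by simp [keys], ihl h3, trivial⟩
    · exact ⟨by simp [keys], fun y hy => h2 y (hr y hy), trivial, ihr h4⟩
    · exact ⟨by simp [keys], by simp [keys], trivial, trivial⟩

theorem length_searchPath (T : BinaryTree ℕ) (s : ℕ) :
    (searchPath T s).length = (pathTree T s).numNodes := by
  induction T with
  | nil => rfl
  | node v l r ihl ihr =>
    simp only [searchPath, pathTree]
    split_ifs <;> simp [ihl, ihr]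

/-! ### Rearranging a path -/

theorem keys_eq_toFinset_inorder (T : BinaryTree ℕ) : keys T = (inorder T).toFinset := by
  ext x
  rw [List.mem_toFinset, mem_inorder]

section Rearrange

variable {B t : BinaryTree ℕ} {b : ℕ}

theorem inorder_fill_pendants (hB : IsBST B) (ht : IsRearrangedTree (pathTree B b) t) :
    inorder (fill t (pendants B b)) = inorder B := by
  have h := inorder_eq_of_keys_eq ht.1 (isBST_pathTree hB b) ht.2
  have hn : t.numNodes = (pathTree B b).numNodes := by
    rw [← length_inorder, h, length_inorder]
  conv_rhs => rw [← fill_pathTree B b]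
  rw [inorder_fill _ _ (length_pendants B b), inorder_fill, h]
  rw [hn, length_pendants]

theorem isBST_fill_pendants (hB : IsBST B) (ht : IsRearrangedTree (pathTree B b) t) :
    IsBST (fill t (pendants B b)) := by
  rw [isBST_iff, inorder_fill_pendants hB ht, ← isBST_iff]
  exact hB

theorem keys_fill_pendants (hB : IsBST B) (ht : IsRearrangedTree (pathTree B b) t) :
    keys (fill t (pendants B b)) = keys B := by
  rw [keys_eq_toFinset_inorder, inorder_fill_pendants hB ht, ← keys_eq_toFinset_inorder]

end Rearrange

theorem mem_keys_fill {t : BinaryTree ℕ} {L : List (BinaryTree ℕ)}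
    (hL : L.length = t.numNodes + 1) {x : ℕ} :
    x ∈ keys (fill t L) ↔ x ∈ keys t ∨ ∃ M ∈ L, x ∈ keys M := by
  induction t generalizing L with
  | nil =>
    cases L with
    | nil => simp at hL
    | cons a L =>
      have : L = [] := by simpa using hL
      simp [fill, keys, this]
  | node v l r ihl ihr =>
    simp only [numNodes] at hL
    rw [fill, mem_keys_node, mem_keys_node, ihl (by simp; omega), ihr (by simp; omega)]
    conv_rhs => rw [← List.take_append_drop (l.numNodes + 1) L]
    simp only [List.mem_append, or_and_right, exists_or]
    simp only [or_assoc, or_left_comm]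

theorem desc_fill_of_mem_pendant {t : BinaryTree ℕ} {L : List (BinaryTree ℕ)}
    (hL : L.length = t.numNodes + 1) (hB : IsBST (fill t L)) {M : BinaryTree ℕ} (hM : M ∈ L)
    {y : ℕ} (hy : y ∈ keys M) : desc (fill t L) y = desc M y := by
  induction t generalizing L with
  | nil =>
    cases L with
    | nil => simp at hL
    | cons a L =>
      have : L = [] := by simpa using hL
      subst this
      rw [List.mem_singleton] at hM
      subst hM
      rfl
  | node v l r ihl ihr =>
    simp only [numNodes] at hL
    have e1 : (L.take (l.numNodes + 1)).length = l.numNodes + 1 := by simp; omega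
    have e2 : (L.drop (l.numNodes + 1)).length = r.numNodes + 1 := by simp; omega
    rw [fill] at hB ⊢
    rw [← List.take_append_drop (l.numNodes + 1) L, List.mem_append] at hM
    rcases hM with hM | hM
    · rw [desc_left hB ((mem_keys_fill e1).2 (Or.inr ⟨M, hM, hy⟩)), ihl e1 hB.2.2.1 hM]
    · rw [desc_right hB ((mem_keys_fill e2).2 (Or.inr ⟨M, hM, hy⟩)), ihr e2 hB.2.2.2 hM]

theorem isBST_of_fill {t : BinaryTree ℕ} {L : List (BinaryTree ℕ)}
    (hL : L.length = t.numNodes + 1) (hB : IsBST (fill t L)) : IsBST t := by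
  induction t generalizing L with
  | nil => trivial
  | node v l r ihl ihr =>
    simp only [numNodes] at hL
    have e1 : (L.take (l.numNodes + 1)).length = l.numNodes + 1 := by simp; omega
    have e2 : (L.drop (l.numNodes + 1)).length = r.numNodes + 1 := by simp; omega
    rw [fill] at hB
    obtain ⟨h1, h2, h3, h4⟩ := hB
    exact ⟨fun y hy => h1 y ((mem_keys_fill e1).2 (Or.inl hy)),
      fun y hy => h2 y ((mem_keys_fill e2).2 (Or.inl hy)), ihl e1 h3, ihr e2 h4⟩

theorem mem_desc_fill {t : BinaryTree ℕ} {L : List (BinaryTree ℕ)}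
    (hL : L.length = t.numNodes + 1) (hB : IsBST (fill t L)) {x y : ℕ} (hx : x ∈ keys t)
    (hy : y ∈ keys t) : y ∈ desc (fill t L) x ↔ y ∈ desc t x := by
  have ht := isBST_of_fill hL hB
  induction t generalizing L with
  | nil => simp [keys] at hx
  | node v l r ihl ihr =>
    simp only [numNodes] at hL
    have e1 : (L.take (l.numNodes + 1)).length = l.numNodes + 1 := by simp; omega
    have e2 : (L.drop (l.numNodes + 1)).length = r.numNodes + 1 := by simp; omega
    have hyF : y ∈ keys (fill (node v l r) L) :=
      (mem_keys_fill (by simpa using hL)).2 (Or.inl hy)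
    rw [fill] at hB hyF ⊢
    have hlt : ∀ z ∈ keys (fill l (L.take (l.numNodes + 1))), z < v := hB.1
    have hgt : ∀ z ∈ keys (fill r (L.drop (l.numNodes + 1))), v < z := hB.2.1
    rcases mem_keys_node.1 hx with rfl | hx' | hx'
    · rw [desc_root, desc_root]
      simp [hy, hyF]
    · rw [desc_left hB ((mem_keys_fill e1).2 (Or.inl hx')), desc_left ht hx']
      rcases mem_keys_node.1 hy with rfl | hy' | hy'
      · exact iff_of_false (fun h => absurd (hlt _ (desc_subset h)) (lt_irrefl _))
          (fun h => absurd (ht.1 _ (desc_subset h)) (lt_irrefl _))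
      · exact ihl e1 hB.2.2.1 hx' hy' ht.2.2.1
      · have := ht.2.1 _ hy'
        exact iff_of_false (fun h => absurd (hlt _ (desc_subset h)) this.not_gt)
          (fun h => absurd (ht.1 _ (desc_subset h)) this.not_gt)
    · rw [desc_right hB ((mem_keys_fill e2).2 (Or.inl hx')), desc_right ht hx']
      rcases mem_keys_node.1 hy with rfl | hy' | hy'
      · exact iff_of_false (fun h => absurd (hgt _ (desc_subset h)) (lt_irrefl _))
          (fun h => absurd (ht.2.1 _ (desc_subset h)) (lt_irrefl _))
      · have := ht.1 _ hy'
        exact iff_of_false (fun h => absurd (hgt _ (desc_subset h)) this.not_gt)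
          (fun h => absurd (ht.2.1 _ (desc_subset h)) this.not_gt)
      · exact ihr e2 hB.2.2.2 hx' hy' ht.2.2.2

section Rearrange

variable {B t : BinaryTree ℕ} {b : ℕ}

theorem mem_desc_pathTree (hB : IsBST B) {x y : ℕ} (hx : x ∈ keys (pathTree B b))
    (hy : y ∈ keys (pathTree B b)) : y ∈ desc (pathTree B b) x ↔ y ∈ desc B x := by
  have h := mem_desc_fill (length_pendants B b) (by rwa [fill_pathTree]) hx hy
  rw [fill_pathTree] at h
  exact h.symm

theorem length_pendants_eq (hB : IsBST B) (ht : IsRearrangedTree (pathTree B b) t) :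
    (pendants B b).length = t.numNodes + 1 := by
  rw [length_pendants, ← card_keys ht.1, ht.2, card_keys (isBST_pathTree hB b)]

theorem desc_fill_pendants (hB : IsBST B) (ht : IsRearrangedTree (pathTree B b) t) {y : ℕ}
    (hy : y ∈ keys B) (hy' : y ∉ keys (pathTree B b)) :
    desc (fill t (pendants B b)) y = desc B y := by
  have h : ∃ M ∈ pendants B b, y ∈ keys M := by
    have h := hy
    rw [← fill_pathTree B b, mem_keys_fill (length_pendants B b)] at h
    exact h.resolve_left hy'
  obtain ⟨M, hM, hyM⟩ := h
  rw [desc_fill_of_mem_pendant (length_pendants_eq hB ht) (isBST_fill_pendants hB ht) hM hyM]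
  conv_rhs => rw [← fill_pathTree B b]
  rw [desc_fill_of_mem_pendant (length_pendants B b) (by rwa [fill_pathTree]) hM hyM]

theorem mem_desc_fill_pendants (hB : IsBST B) (ht : IsRearrangedTree (pathTree B b) t) {x y : ℕ}
    (hx : x ∈ keys (pathTree B b)) (hy : y ∈ keys (pathTree B b)) :
    y ∈ desc (fill t (pendants B b)) x ↔ y ∈ desc t x :=
  mem_desc_fill (length_pendants_eq hB ht) (isBST_fill_pendants hB ht) (ht.2 ▸ hx) (ht.2 ▸ hy)

theorem mem_keys_pathTree_iff_desc (hb : b ∈ keys B) {x : ℕ} :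
    x ∈ keys (pathTree B b) ↔ b ∈ desc B x := by
  rw [mem_keys_pathTree, mem_desc]
  tauto

end Rearrange

theorem ReplacesSubtree.keys_eq {B B' Q Q' : BinaryTree ℕ} (h : ReplacesSubtree B B' Q Q')
    (hk : keys B' = keys B) : keys Q' = keys Q := by
  induction h with
  | here => exact hk
  | left _ ih => simp [keys, ih]
  | right _ ih => simp [keys, ih]

theorem ReplacesSubtree.subset {B B' Q Q' : BinaryTree ℕ} (h : ReplacesSubtree B B' Q Q') :
    keys B ⊆ keys Q := by
  induction h with
  | here => exact subset_rfl
  | left _ ih => exact ih.trans fun y hy => by simp [keys, hy]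
  | right _ ih => exact ih.trans fun y hy => by simp [keys, hy]

theorem ReplacesSubtree.isBST_left {B B' Q Q' : BinaryTree ℕ} (h : ReplacesSubtree B B' Q Q')
    (hQ : IsBST Q) : IsBST B := by
  induction h with
  | here => exact hQ
  | left _ ih => exact ih hQ.2.2.1
  | right _ ih => exact ih hQ.2.2.2

theorem ReplacesSubtree.isBST {B B' Q Q' : BinaryTree ℕ} (h : ReplacesSubtree B B' Q Q')
    (hQ : IsBST Q) (hB' : IsBST B') (hk : keys B' = keys B) : IsBST Q' := by
  induction h with
  | here => exact hB'
  | left h ih =>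
    exact ⟨by rw [h.keys_eq hk]; exact hQ.1, hQ.2.1, ih hQ.2.2.1, hQ.2.2.2⟩
  | right h ih =>
    exact ⟨hQ.1, by rw [h.keys_eq hk]; exact hQ.2.1, hQ.2.2.1, ih hQ.2.2.2⟩

theorem ReplacesSubtree.desc_of_mem {B B' Q Q' : BinaryTree ℕ} (h : ReplacesSubtree B B' Q Q')
    (hQ : IsBST Q) {y : ℕ} (hy : y ∈ keys B) : desc Q y = desc B y := by
  induction h with
  | here => rfl
  | left h ih => rw [desc_left hQ (h.subset hy), ih hQ.2.2.1]
  | right h ih => rw [desc_right hQ (h.subset hy), ih hQ.2.2.2]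

theorem ReplacesSubtree.symm {B B' Q Q' : BinaryTree ℕ} (h : ReplacesSubtree B B' Q Q') :
    ReplacesSubtree B' B Q' Q := by
  induction h with
  | here => exact .here
  | left _ ih => exact .left ih
  | right _ ih => exact .right ih

theorem ReplacesSubtree.desc_of_notMem {B B' Q Q' : BinaryTree ℕ} (h : ReplacesSubtree B B' Q Q')
    (hQ : IsBST Q) (hB' : IsBST B') (hk : keys B' = keys B) {y : ℕ} (hy : y ∈ keys Q)
    (hy' : y ∉ keys B) : desc Q' y = desc Q y := by
  induction h with
  | here => exact absurd hy hy'
  | @left x l l' r h ih =>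
    have hQ' := (ReplacesSubtree.left (x := x) (r := r) h).isBST hQ hB' hk
    have e := h.keys_eq hk
    rcases mem_keys_node.1 hy with rfl | hy | hy
    · rw [desc_root, desc_root]; simp [keys, e]
    · rw [desc_left hQ hy, desc_left hQ' (e ▸ hy), ih hQ.2.2.1 hy]
    · rw [desc_right hQ hy, desc_right hQ' hy]
  | @right x l r r' h ih =>
    have hQ' := (ReplacesSubtree.right (x := x) (l := l) h).isBST hQ hB' hk
    have e := h.keys_eq hk
    rcases mem_keys_node.1 hy with rfl | hy | hy
    · rw [desc_root, desc_root]; simp [keys, e]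
    · rw [desc_left hQ hy, desc_left hQ' hy]
    · rw [desc_right hQ hy, desc_right hQ' (e ▸ hy), ih hQ.2.2.2 hy]

/-- The effect of rearranging a path on the descendant order. -/
theorem RearrangesPath.spec {Q p t Q' : BinaryTree ℕ} {b : ℕ} (h : RearrangesPath Q p b t Q')
    (hQ : IsBST Q) :
    keys Q' = keys Q ∧ IsBST Q' ∧ (∀ y ∈ keys Q, y ∉ keys p → desc Q' y = desc Q y) ∧
      (∀ x ∈ keys p, ∀ y ∈ keys p, (y ∈ desc Q' x ↔ y ∈ desc t x)) ∧
      (∃ r ∈ keys Q, ∀ x, x ∈ keys p ↔ x ∈ desc Q r ∧ b ∈ desc Q x) ∧ IsBST t ∧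
      keys t = keys p ∧ b ∈ keys p ∧ IsBST p := by
  obtain ⟨B, hb, rfl, ht, hr⟩ := h
  have hB := hr.isBST_left hQ
  have hB' := isBST_fill_pendants hB ht
  have hk := keys_fill_pendants hB ht
  have hQ' := hr.isBST hQ hB' hk
  have hpB : ∀ x ∈ keys (pathTree B b), x ∈ keys B := fun x hx =>
    searchPath_subset_keys _ _ _ (mem_keys_pathTree.1 hx)
  refine ⟨hr.keys_eq hk, hQ', ?_, ?_, ?_, ht.1, ht.2, ?_, isBST_pathTree hB b⟩
  · intro y hy hyp
    by_cases hyB : y ∈ keys B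
    · rw [hr.desc_of_mem hQ hyB, hr.symm.desc_of_mem hQ' (hk ▸ hyB),
        desc_fill_pendants hB ht hyB hyp]
    · exact hr.desc_of_notMem hQ hB' hk hy hyB
  · intro x hx y hy
    rw [hr.symm.desc_of_mem hQ' (hk ▸ hpB x hx), mem_desc_fill_pendants hB ht hx hy]
  · obtain _ | ⟨r, l, r'⟩ := B
    · simp [keys] at hb
    · have hrB : r ∈ keys (node r l r') := by simp [keys]
      refine ⟨r, hr.subset hrB, fun x => ?_⟩
      rw [hr.desc_of_mem hQ hrB, desc_root]
      constructor
      · intro hx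
        exact ⟨hpB x hx, by
          rw [hr.desc_of_mem hQ (hpB x hx)]; exact (mem_keys_pathTree_iff_desc hb).1 hx⟩
      · rintro ⟨h1, h2⟩
        rw [hr.desc_of_mem hQ h1] at h2
        exact (mem_keys_pathTree_iff_desc hb).2 h2
  · rw [mem_keys_pathTree]; exact mem_searchPath_self hB hb

/-! ### Logarithmic estimates -/

/-- Either `m` is at most the fraction 2^(-d) of `S`, and then log `m` is smaller than log `S` by
`d`; or `u` is at most the fraction 1 - 2^(-d), and then log `S` - log `u` exceeds a positive
constant, which a large enough `C` scales up to `d`. -/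
theorem exists_logb_loss (c : ℝ) : ∃ C : ℝ, 0 ≤ C ∧ ∀ S u m : ℝ, 0 < u → 0 < m → m + u ≤ S →
    Real.logb 2 m + c ≤ Real.logb 2 S + C * (Real.logb 2 S - Real.logb 2 u) := by
  have h2 : (1 : ℝ) < 2 := by norm_num
  -- Replacing `c` by a positive number makes the fraction `q` smaller than 1.
  set d := max c 1 with hd
  have hd0 : 0 < d := lt_of_lt_of_le one_pos (le_max_right _ _)
  set q : ℝ := 2 ^ (-d) with hq
  have hq0 : 0 < q := by positivity
  have hq1 : q < 1 := Real.rpow_lt_one_of_one_lt_of_neg h2 (by linarith)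
  have hη : 0 < -Real.logb 2 (1 - q) := by
    have := Real.logb_neg h2 (show 0 < 1 - q by linarith) (by linarith)
    linarith
  refine ⟨d / -Real.logb 2 (1 - q), by positivity, fun S u m hu hm hS => ?_⟩
  have hS0 : 0 < S := by linarith
  have hcd : c ≤ d := le_max_left _ _
  have hSu : Real.logb 2 u ≤ Real.logb 2 S := Real.logb_le_logb_of_le h2 hu (by linarith)
  by_cases hmq : m ≤ q * S
  · have h1 : Real.logb 2 m ≤ Real.logb 2 (q * S) := Real.logb_le_logb_of_le h2 hm hmq
    rw [Real.logb_mul hq0.ne' hS0.ne', hq, Real.logb_rpow (by norm_num) (by norm_num)] at h1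
    have : 0 ≤ d / -Real.logb 2 (1 - q) * (Real.logb 2 S - Real.logb 2 u) :=
      mul_nonneg (by positivity) (by linarith)
    linarith
  · have h1 : Real.logb 2 m ≤ Real.logb 2 S := Real.logb_le_logb_of_le h2 hm (by linarith)
    have h3 : Real.logb 2 u ≤ Real.logb 2 ((1 - q) * S) :=
      Real.logb_le_logb_of_le h2 hu (by linarith)
    rw [Real.logb_mul (by linarith) hS0.ne'] at h3
    have h4 : d ≤ d / -Real.logb 2 (1 - q) * (Real.logb 2 S - Real.logb 2 u) := by
      calc d = d / -Real.logb 2 (1 - q) * -Real.logb 2 (1 - q) :=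
            (div_mul_cancel₀ d hη.ne').symm
        _ ≤ _ := by gcongr; linarith
    linarith

/-- This is 4ab ≤ (a + b)². -/
theorem logb_add_logb_add_two_le {a b S : ℝ} (ha : 0 < a) (hb : 0 < b) (h : a + b ≤ S) :
    Real.logb 2 a + Real.logb 2 b + 2 ≤ 2 * Real.logb 2 S := by
  have h2 : (1 : ℝ) < 2 := by norm_num
  have hS : 0 < S := by linarith
  have h4 : Real.logb 2 4 = 2 := by
    rw [show (4 : ℝ) = 2 ^ (2 : ℝ) by norm_num, Real.logb_rpow] <;> norm_num
  have h5 : Real.logb 2 (a * b * 4) ≤ Real.logb 2 (S * S) :=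
    Real.logb_le_logb_of_le h2 (by positivity) (by nlinarith [sq_nonneg (a - b)])
  rw [Real.logb_mul (by positivity) (by norm_num), Real.logb_mul ha.ne' hb.ne',
    Real.logb_mul hS.ne' hS.ne', h4] at h5
  linarith

/-- With `q'` and `p'` the values of `ls` at the next and the previous element, the sum of the `q'`
is the sum of `ls` shifted by one place, and the sum of the differences `q' - p'` telescopes over
two places. `p` plays the part of the value preceding the least element, `hi` that of the value
following the greatest. -/
theorem sum_le_of_telescoping {α : Type*} [LinearOrder α] (f g ls : α → ℝ) {c C hi : ℝ}
    (hC : 0 ≤ C) (R : Finset α) (hf : ∀ a ∈ R, ls a ≤ f a) (hhi : ∀ a ∈ R, ls a ≤ hi) :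
    ∀ p r : ℝ, p ≤ hi → r ≤ hi → (∀ a ∈ R, r ≤ ls a) →
    (∀ a ∈ R, ∀ p' q', (p' = p ∨ ∃ x ∈ R, x < a ∧ p' = ls x) →
      (q' = hi ∨ ∃ y ∈ R, a < y ∧ q' = ls y) → g a + c ≤ q' + C * (q' - p')) →
    ∑ a ∈ R, (g a + c) ≤ ∑ a ∈ R, f a + (hi - r) + C * (2 * hi - p - r) := by
  classical
  induction R using Finset.induction_on_min with
  | empty =>
    intro p r hp hr _ _
    have : 0 ≤ C * (2 * hi - p - r) := mul_nonneg hC (by linarith)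
    simp
    linarith
  | insert a R ha ih =>
    intro p r hp hr hr' H
    have haR : a ∉ R := fun h => lt_irrefl _ (ha a h)
    have hls : r ≤ ls a := hr' a (Finset.mem_insert_self _ _)
    have hfa : ls a ≤ f a := hf a (Finset.mem_insert_self _ _)
    have hia : ls a ≤ hi := hhi a (Finset.mem_insert_self _ _)
    -- `r'` is the least value of `ls` on the remaining elements (`hi` if there are none). It serves
    -- both as the successor value for `a` and as the lower bound in the induction hypothesis;
    -- monotonicity of `ls` is not required.
    obtain ⟨r', hr1, hr2, hr3⟩ : ∃ r', r' ≤ hi ∧ (∀ x ∈ R, r' ≤ ls x) ∧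
        (r' = hi ∨ ∃ y ∈ R, a < y ∧ r' = ls y) := by
      rcases R.eq_empty_or_nonempty with rfl | hne
      · exact ⟨hi, le_rfl, by simp, Or.inl rfl⟩
      · obtain ⟨y, hy, hmin⟩ := R.exists_min_image ls hne
        exact ⟨ls y, hhi y (Finset.mem_insert_of_mem hy), hmin, Or.inr ⟨y, hy, ha y hy, rfl⟩⟩
    have h1 := ih (fun x hx => hf x (Finset.mem_insert_of_mem hx))
      (fun x hx => hhi x (Finset.mem_insert_of_mem hx)) (ls a) r' hia hr1 hr2 (by
        intro x hx p' q' hp' hq'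
        refine H x (Finset.mem_insert_of_mem hx) p' q' (Or.inr ?_) (hq'.imp id ?_)
        · rcases hp' with rfl | ⟨y, hy, h⟩
          · exact ⟨a, Finset.mem_insert_self _ _, ha x hx, rfl⟩
          · exact ⟨y, Finset.mem_insert_of_mem hy, h⟩
        · rintro ⟨y, hy, h⟩
          exact ⟨y, Finset.mem_insert_of_mem hy, h⟩)
    have h2 := H a (Finset.mem_insert_self _ _) p r' (Or.inl rfl) (hr3.imp id (by
      rintro ⟨y, hy, h⟩
      exact ⟨y, Finset.mem_insert_of_mem hy, h⟩))
    rw [Finset.sum_insert haR, Finset.sum_insert haR]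
    have h3 : 0 ≤ C * (ls a - r) := mul_nonneg hC (by linarith)
    nlinarith

/-- The binary logarithm of the total weight of a set. -/
noncomputable def logWeight {α : Type*} (w : α → ℝ) (X : Finset α) : ℝ :=
  Real.logb 2 (∑ y ∈ X, w y)

section LogWeight

variable {α : Type*} {w : α → ℝ}

theorem sum_weight_pos (hw : ∀ a, 0 < w a) {X : Finset α} (hX : X.Nonempty) :
    0 < ∑ y ∈ X, w y := Finset.sum_pos (fun a _ => hw a) hX

theorem sum_weight_mono (hw : ∀ a, 0 < w a) {X Y : Finset α} (hXY : X ⊆ Y) :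
    ∑ y ∈ X, w y ≤ ∑ y ∈ Y, w y :=
  Finset.sum_le_sum_of_subset_of_nonneg hXY fun a _ _ => (hw a).le

theorem sum_weight_add_le (hw : ∀ a, 0 < w a) {X Y Z : Finset α} (hXZ : X ⊆ Z)
    (hYZ : Y ⊆ Z) (h : ∀ a ∈ X, a ∉ Y) : ∑ y ∈ X, w y + ∑ y ∈ Y, w y ≤ ∑ y ∈ Z, w y := by
  classical
  rw [← Finset.sum_union (Finset.disjoint_left.2 h)]
  exact sum_weight_mono hw (Finset.union_subset hXZ hYZ)

theorem logWeight_mono (hw : ∀ a, 0 < w a) {X Y : Finset α} (hX : X.Nonempty) (hXY : X ⊆ Y) :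
    logWeight w X ≤ logWeight w Y :=
  Real.logb_le_logb_of_le (by norm_num) (sum_weight_pos hw hX) (sum_weight_mono hw hXY)

end LogWeight

/-! ### Potential change on one side of the accessed element -/

section OneSide

variable {α : Type*} [LinearOrder α] {w : α → ℝ} {K : Finset α} {s : α}

/-- Potential change of elements to the right of `s` whose new neighborhoods overlap, at most,
between consecutive elements. -/
theorem sum_logWeight_separated {c C : ℝ} (hC : 0 ≤ C)
    (hcC : ∀ S u m : ℝ, 0 < u → 0 < m → m + u ≤ S →
      Real.logb 2 m + c ≤ Real.logb 2 S + C * (Real.logb 2 S - Real.logb 2 u))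
    (hw : ∀ a, 0 < w a) (hs : s ∈ K) {N N' : α → Finset α} {R : Finset α}
    (hRs : ∀ a ∈ R, s < a) (hN : ∀ a ∈ R, ∀ y ∈ K, s ≤ y → y ≤ a → y ∈ N a)
    (hN' : ∀ a ∈ R, (N' a).Nonempty ∧ N' a ⊆ K ∧ ∀ y ∈ N' a, s < y)
    (hlt : ∀ a ∈ R, ∀ q ∈ R, a < q → ∀ y ∈ N' a, y < q)
    (hgt : ∀ a ∈ R, ∀ p ∈ R, p < a → ∀ y ∈ N' a, p < y) :
    ∑ a ∈ R, (logWeight w (N' a) + c) ≤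
      ∑ a ∈ R, logWeight w (N a) + (1 + 2 * C) * (logWeight w K - logWeight w {s}) := by
  have hsub : ∀ a, K.filter (fun y => s ≤ y ∧ y ≤ a) ⊆ K := fun a => Finset.filter_subset _ _
  have hmem : ∀ a ∈ R, s ∈ K.filter (fun y => s ≤ y ∧ y ≤ a) := fun a ha => by
    simp [hs, (hRs a ha).le]
  have h := sum_le_of_telescoping (fun a => logWeight w (N a)) (fun a => logWeight w (N' a))
    (fun a => logWeight w (K.filter fun y => s ≤ y ∧ y ≤ a)) (c := c) (hi := logWeight w K) hC R
    (fun a ha => logWeight_mono hw ⟨s, hmem a ha⟩ fun y hy => by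
      simp only [Finset.mem_filter] at hy
      exact hN a ha y hy.1 hy.2.1 hy.2.2)
    (fun a ha => logWeight_mono hw ⟨s, hmem a ha⟩ (hsub a))
    (logWeight w {s}) (logWeight w {s})
    (logWeight_mono hw (by simp) (by simpa using hs))
    (logWeight_mono hw (by simp) (by simpa using hs))
    (fun a ha => logWeight_mono hw (by simp) (by simpa using hmem a ha)) ?_
  · linarith
  · intro a ha p' q' hp' hq'
    -- `Xp` is the interval from `s` to a smaller member of `R`, or `{s}`; `Xq` is the interval from
    -- `s` to a larger member, or all of `K`. The new set of `a` and `Xp` are disjoint parts of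
    -- `Xq`, as `hcC` requires.
    obtain ⟨Xp, rfl, hXp, hXp1⟩ : ∃ X : Finset α, p' = logWeight w X ∧ s ∈ X ∧
        ∀ y ∈ X, y ∈ K ∧ s ≤ y ∧ (y = s ∨ ∃ p ∈ R, p < a ∧ y ≤ p) := by
      rcases hp' with rfl | ⟨p, hp, hpa, rfl⟩
      · exact ⟨{s}, rfl, by simp, by simpa using hs⟩
      · refine ⟨_, rfl, hmem p hp, fun y hy => ?_⟩
        simp only [Finset.mem_filter] at hy
        exact ⟨hy.1, hy.2.1, Or.inr ⟨p, hp, hpa, hy.2.2⟩⟩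
    obtain ⟨Xq, rfl, hXq⟩ : ∃ X : Finset α, q' = logWeight w X ∧
        ∀ y ∈ K, s ≤ y → (∀ q ∈ R, a < q → y ≤ q) → y ∈ X := by
      rcases hq' with rfl | ⟨q, hq, haq, rfl⟩
      · exact ⟨K, rfl, fun y hy _ _ => hy⟩
      · refine ⟨_, rfl, fun y hy hsy h => ?_⟩
        simp only [Finset.mem_filter]
        exact ⟨hy, hsy, h q hq haq⟩
    obtain ⟨hne, hNK, hsN⟩ := hN' a ha
    refine hcC _ _ _ (sum_weight_pos hw ⟨s, hXp⟩) (sum_weight_pos hw hne)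
      (sum_weight_add_le hw (fun y hy => ?_) (fun y hy => ?_) fun y hy hy' => ?_)
    · exact hXq y (hNK hy) (hsN y hy).le fun q hq haq => (hlt a ha q hq haq y hy).le
    · obtain ⟨hyK, hys, h⟩ := hXp1 y hy
      refine hXq y hyK hys fun q hq haq => ?_
      rcases h with rfl | ⟨p, _, hpa, hyp⟩
      · exact (hRs q hq).le
      · exact hyp.trans (hpa.trans haq).le
    · rcases (hXp1 y hy').2.2 with rfl | ⟨p, hp, hpa, hyp⟩
      · exact lt_irrefl _ (hsN _ hy)
      · exact absurd (hgt a ha p hp hpa y hy) hyp.not_gt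

theorem sum_logWeight_separated_left {c C : ℝ} (hC : 0 ≤ C)
    (hcC : ∀ S u m : ℝ, 0 < u → 0 < m → m + u ≤ S →
      Real.logb 2 m + c ≤ Real.logb 2 S + C * (Real.logb 2 S - Real.logb 2 u))
    (hw : ∀ a, 0 < w a) (hs : s ∈ K) {N N' : α → Finset α} {R : Finset α}
    (hRs : ∀ a ∈ R, a < s) (hN : ∀ a ∈ R, ∀ y ∈ K, y ≤ s → a ≤ y → y ∈ N a)
    (hN' : ∀ a ∈ R, (N' a).Nonempty ∧ N' a ⊆ K ∧ ∀ y ∈ N' a, y < s)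
    (hgt : ∀ a ∈ R, ∀ q ∈ R, q < a → ∀ y ∈ N' a, q < y)
    (hlt : ∀ a ∈ R, ∀ p ∈ R, a < p → ∀ y ∈ N' a, y < p) :
    ∑ a ∈ R, (logWeight w (N' a) + c) ≤
      ∑ a ∈ R, logWeight w (N a) + (1 + 2 * C) * (logWeight w K - logWeight w {s}) :=
  sum_logWeight_separated (α := αᵒᵈ) hC hcC hw hs hRs hN hN' hgt hlt

/-- If nothing is to be gained, separation from the larger elements is enough: the telescoping is
used with both constants equal to zero. -/
theorem sum_logWeight_monochromatic
    (hw : ∀ a, 0 < w a) (hs : s ∈ K) {N N' : α → Finset α} {R : Finset α}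
    (hRs : ∀ a ∈ R, s < a) (hN : ∀ a ∈ R, ∀ y ∈ K, s ≤ y → y ≤ a → y ∈ N a)
    (hN' : ∀ a ∈ R, (N' a).Nonempty ∧ N' a ⊆ K ∧ ∀ y ∈ N' a, s < y)
    (hlt : ∀ a ∈ R, ∀ q ∈ R, a < q → ∀ y ∈ N' a, y < q) :
    ∑ a ∈ R, logWeight w (N' a) ≤
      ∑ a ∈ R, logWeight w (N a) + (logWeight w K - logWeight w {s}) := by
  have hmem : ∀ a ∈ R, s ∈ K.filter (fun y => s ≤ y ∧ y ≤ a) := fun a ha => by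
    simp [hs, (hRs a ha).le]
  have h := sum_le_of_telescoping (fun a => logWeight w (N a)) (fun a => logWeight w (N' a))
    (fun a => logWeight w (K.filter fun y => s ≤ y ∧ y ≤ a)) (c := 0) (hi := logWeight w K)
    le_rfl R
    (fun a ha => logWeight_mono hw ⟨s, hmem a ha⟩ fun y hy => by
      simp only [Finset.mem_filter] at hy
      exact hN a ha y hy.1 hy.2.1 hy.2.2)
    (fun a ha => logWeight_mono hw ⟨s, hmem a ha⟩ (Finset.filter_subset _ _))
    (logWeight w {s}) (logWeight w {s})
    (logWeight_mono hw (by simp) (by simpa using hs))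
    (logWeight_mono hw (by simp) (by simpa using hs))
    (fun a ha => logWeight_mono hw (by simp) (by simpa using hmem a ha)) ?_
  · simpa using h
  · intro a ha p' q' _ hq'
    obtain ⟨hne, hNK, hsN⟩ := hN' a ha
    rw [add_zero, zero_mul, add_zero]
    rcases hq' with rfl | ⟨q, hq, haq, rfl⟩
    · exact logWeight_mono hw hne hNK
    · refine logWeight_mono hw hne fun y hy => ?_
      simp only [Finset.mem_filter]
      exact ⟨hNK hy, (hsN y hy).le, (hlt a ha q hq haq y hy).le⟩

/-- If a bound holds on each class of a colouring with few colours, it holds with a factor. -/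
theorem sum_le_of_coloring {α β : Type*} {R : Finset α} {col : α → β} [DecidableEq β]
    {B : Finset β} (hB : ∀ a ∈ R, col a ∈ B) {f g : α → ℝ} {L : ℝ}
    (h : ∀ b ∈ B, ∑ a ∈ R with col a = b, g a ≤ ∑ a ∈ R with col a = b, f a + L) :
    ∑ a ∈ R, g a ≤ ∑ a ∈ R, f a + B.card * L := by
  rw [← Finset.sum_fiberwise_of_maps_to hB g, ← Finset.sum_fiberwise_of_maps_to hB f]
  calc _ ≤ ∑ b ∈ B, (∑ a ∈ R with col a = b, f a + L) := Finset.sum_le_sum h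
    _ = _ := by rw [Finset.sum_add_distrib]; simp

end OneSide

/-! ### The access lemma for rearrangements of bounded side depth -/

/-- The search path `V` of `s` in the search tree `(K, N)` is rearranged, giving the search tree
`(K, N')` with root `s`, in such a way that every element of the path has at most `D` ancestors
between itself and `s`. -/
structure IsPathRearrangement {α : Type*} [LinearOrder α] (K V : Finset α) (s : α)
    (N N' : α → Finset α) (D : ℕ) : Prop where
  before : IsTreeOrder K N
  after : IsTreeOrder K N'
  mem : s ∈ K
  root : ∀ x ∈ K, x ∈ N' s
  mem_path : ∀ x, x ∈ V ↔ x ∈ K ∧ s ∈ N x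
  unchanged : ∀ x ∈ K, x ∉ V → N' x = N x
  right : ∀ x ∈ V, s < x → ∀ Y : Finset α, (∀ y ∈ Y, y ∈ V ∧ s < y ∧ y < x ∧ x ∈ N' y) →
    Y.card ≤ D
  left : ∀ x ∈ V, x < s → ∀ Y : Finset α, (∀ y ∈ Y, y ∈ V ∧ y < s ∧ x < y ∧ x ∈ N' y) →
    Y.card ≤ D

namespace IsPathRearrangement

variable {α : Type*} [LinearOrder α] {K V : Finset α} {s : α} {N N' : α → Finset α} {D : ℕ}
  {w : α → ℝ}

theorem dual (h : IsPathRearrangement K V s N N' D) :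
    IsPathRearrangement (α := αᵒᵈ) K V s N N' D where
  before := h.before.dual
  after := h.after.dual
  mem := h.mem
  root := h.root
  mem_path := h.mem_path
  unchanged := h.unchanged
  right := h.left
  left := h.right

/-- The only use made of the search path: an element on it has `s` among its old descendants. -/
theorem interval_subset (h : IsPathRearrangement K V s N N' D) {a : α} (ha : a ∈ V) {y : α}
    (hy : y ∈ K) (h1 : s ≤ y) (h2 : y ≤ a) : y ∈ N a := by
  rw [h.mem_path] at ha
  exact h.before.convex a ha.1 s ha.2 y hy (Or.inr ⟨h1, h2⟩)

theorem s_notMem (h : IsPathRearrangement K V s N N' D) {a : α} (ha : a ∈ K) (has : a ≠ s) :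
    s ∉ N' a := fun hs => has (h.after.antisymm a ha s hs (h.root a ha))

/-- A descendant on the other side would, by convexity, make the new root `s` a descendant of `a`.
-/
theorem lt_of_mem (h : IsPathRearrangement K V s N N' D) {a : α} (ha : a ∈ K) (has : s < a)
    {y : α} (hy : y ∈ N' a) : s < y := by
  by_contra! hys
  exact h.s_notMem ha has.ne' (h.after.convex a ha y hy s h.mem (Or.inr ⟨hys, has.le⟩))

theorem after_props (h : IsPathRearrangement K V s N N' D) {a : α} (ha : a ∈ V) (has : s < a) :
    (N' a).Nonempty ∧ N' a ⊆ K ∧ ∀ y ∈ N' a, s < y := by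
  have haK := ((h.mem_path a).1 ha).1
  exact ⟨⟨a, h.after.self_mem a haK⟩, fun y hy => h.after.subset a haK y hy,
    fun y hy => h.lt_of_mem haK has hy⟩

/-- The colouring of the elements larger than `s` by their side depth. -/
theorem exists_coloring (h : IsPathRearrangement K V s N N' D) : ∃ col : α → ℕ,
    (∀ x ∈ V, s < x → col x ∈ Finset.range (D + 1)) ∧
    ∀ x ∈ V, s < x → ∀ x' ∈ V, x < x' → col x = col x' → ∀ y ∈ N' x, y < x' := by
  classical
  refine ⟨fun x => (V.filter fun y => s < y ∧ y < x ∧ x ∈ N' y).card, fun x hx hsx => ?_,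
    fun x hx hsx x' hx' hxx' hcol y hy => ?_⟩
  · rw [Finset.mem_range, Nat.lt_succ_iff]
    exact h.right x hx hsx _ fun y hy => by simpa using hy
  · by_contra! hyx
    have hxK := ((h.mem_path x).1 hx).1
    have hx'K := ((h.mem_path x').1 hx').1
    have hxx : x' ∈ N' x := h.after.convex x hxK y hy x' hx'K (Or.inl ⟨hxx'.le, hyx⟩)
    -- If `x'` were below `x`, it would have all side ancestors of `x` and `x` itself, hence a
    -- larger colour.
    refine hcol.not_lt (Finset.card_lt_card (Finset.ssubset_iff.2 ⟨x, by simp, ?_⟩))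
    intro z hz
    rw [Finset.mem_insert, Finset.mem_filter] at hz
    rw [Finset.mem_filter]
    rcases hz with rfl | ⟨hz, hsz, hzx, hzN⟩
    · exact ⟨hx, hsx, hxx', hxx⟩
    · exact ⟨hz, hsz, hzx.trans hxx',
        h.after.trans z ((h.mem_path z).1 hz).1 x hzN x' hxx⟩

/-- Each of the `D + 1` colour classes costs at most one logarithm of W / w(s). -/
theorem sum_right_le (h : IsPathRearrangement K V s N N' D) (hw : ∀ a, 0 < w a) {R : Finset α}
    (hR : ∀ x ∈ R, x ∈ V ∧ s < x) :
    ∑ a ∈ R, logWeight w (N' a) ≤ ∑ a ∈ R, logWeight w (N a) +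
      (D + 1) * (logWeight w K - logWeight w {s}) := by
  obtain ⟨col, hcol, hsep⟩ := h.exists_coloring
  have := sum_le_of_coloring (R := R) (col := col) (B := Finset.range (D + 1))
    (fun a ha => hcol a (hR a ha).1 (hR a ha).2) (f := fun a => logWeight w (N a))
    (g := fun a => logWeight w (N' a)) (L := logWeight w K - logWeight w {s})
    (fun b _ => sum_logWeight_monochromatic hw h.mem
      (fun a ha => (hR a (Finset.mem_filter.1 ha).1).2)
      (fun a ha y hy h1 h2 => h.interval_subset (hR a (Finset.mem_filter.1 ha).1).1 hy h1 h2)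
      (fun a ha => h.after_props (hR a (Finset.mem_filter.1 ha).1).1
        (hR a (Finset.mem_filter.1 ha).1).2)
      (fun a ha q hq haq => by
        rw [Finset.mem_filter] at ha hq
        exact hsep a (hR a ha.1).1 (hR a ha.1).2 q (hR q hq.1).1 haq (ha.2.trans hq.2.symm)))
  simpa using this

theorem sum_left_le (h : IsPathRearrangement K V s N N' D) (hw : ∀ a, 0 < w a) {R : Finset α}
    (hR : ∀ x ∈ R, x ∈ V ∧ x < s) :
    ∑ a ∈ R, logWeight w (N' a) ≤ ∑ a ∈ R, logWeight w (N a) +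
      (D + 1) * (logWeight w K - logWeight w {s}) :=
  h.dual.sum_right_le hw hR

/-- The new subtree of a leaf contains no other path element, so leaves are separated in both
directions without any colouring, and the price does not depend on `D`. -/
theorem sum_right_leaves_le {c C : ℝ} (hC : 0 ≤ C)
    (hcC : ∀ S u m : ℝ, 0 < u → 0 < m → m + u ≤ S →
      Real.logb 2 m + c ≤ Real.logb 2 S + C * (Real.logb 2 S - Real.logb 2 u))
    (h : IsPathRearrangement K V s N N' D) (hw : ∀ a, 0 < w a) {R : Finset α}
    (hR : ∀ x ∈ R, x ∈ V ∧ s < x) (hleaf : ∀ x ∈ R, ∀ y ∈ V, y ∈ N' x → y = x) :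
    ∑ a ∈ R, (logWeight w (N' a) + c) ≤ ∑ a ∈ R, logWeight w (N a) +
      (1 + 2 * C) * (logWeight w K - logWeight w {s}) := by
  have hK : ∀ a ∈ R, a ∈ K := fun a ha => ((h.mem_path a).1 (hR a ha).1).1
  refine sum_logWeight_separated hC hcC hw h.mem (fun a ha => (hR a ha).2)
    (fun a ha y hy h1 h2 => h.interval_subset (hR a ha).1 hy h1 h2)
    (fun a ha => h.after_props (hR a ha).1 (hR a ha).2) ?_ ?_
  · intro a ha q hq haq y hy
    by_contra! hyq
    exact haq.ne' (hleaf a ha q (hR q hq).1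
      (h.after.convex a (hK a ha) y hy q (hK q hq) (Or.inl ⟨haq.le, hyq⟩)))
  · intro a ha q hq haq y hy
    by_contra! hyq
    exact haq.ne (hleaf a ha q (hR q hq).1
      (h.after.convex a (hK a ha) y hy q (hK q hq) (Or.inr ⟨hyq, haq.le⟩)))

theorem sum_left_leaves_le {c C : ℝ} (hC : 0 ≤ C)
    (hcC : ∀ S u m : ℝ, 0 < u → 0 < m → m + u ≤ S →
      Real.logb 2 m + c ≤ Real.logb 2 S + C * (Real.logb 2 S - Real.logb 2 u))
    (h : IsPathRearrangement K V s N N' D) (hw : ∀ a, 0 < w a) {R : Finset α}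
    (hR : ∀ x ∈ R, x ∈ V ∧ x < s) (hleaf : ∀ x ∈ R, ∀ y ∈ V, y ∈ N' x → y = x) :
    ∑ a ∈ R, (logWeight w (N' a) + c) ≤ ∑ a ∈ R, logWeight w (N a) +
      (1 + 2 * C) * (logWeight w K - logWeight w {s}) :=
  h.dual.sum_right_leaves_le hC hcC hw hR hleaf

end IsPathRearrangement

/-! ### Payment by leaves of the after-tree and by zigzags of the search path -/

namespace IsPathRearrangement

variable {α : Type*} [LinearOrder α] {K V : Finset α} {s : α} {N N' : α → Finset α} {D : ℕ}
  {w : α → ℝ}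

theorem logWeight_singleton_le (h : IsPathRearrangement K V s N N' D) (hw : ∀ a, 0 < w a) :
    logWeight w {s} ≤ logWeight w K := logWeight_mono hw (by simp) (by simpa using h.mem)

/-- Terms off the path cancel, and the term of `s` rises from at least log w(s) to at most log W. -/
theorem sum_sub_le (h : IsPathRearrangement K V s N N' D) (hw : ∀ a, 0 < w a) :
    ∑ a ∈ K, logWeight w (N' a) - ∑ a ∈ K, logWeight w (N a) ≤
      (logWeight w K - logWeight w {s}) +
      ∑ a ∈ V with s < a, (logWeight w (N' a) - logWeight w (N a)) +
      ∑ a ∈ V with a < s, (logWeight w (N' a) - logWeight w (N a)) := by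
  have hVK : V ⊆ K := fun x hx => ((h.mem_path x).1 hx).1
  have hsN : s ∈ N s := h.before.self_mem s h.mem
  have hsV : s ∈ V := (h.mem_path s).2 ⟨h.mem, hsN⟩
  rw [← Finset.sum_sub_distrib, ← Finset.sum_subset hVK fun x hx hxV => by
    rw [h.unchanged x hx hxV, sub_self]]
  have e : V = insert s ((V.filter fun a => s < a) ∪ V.filter fun a => a < s) := by
    ext x
    simp only [Finset.mem_insert, Finset.mem_union, Finset.mem_filter]
    constructor
    · intro hx
      rcases lt_trichotomy s x with h | h | h
      · exact Or.inr (Or.inl ⟨hx, h⟩)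
      · exact Or.inl h.symm
      · exact Or.inr (Or.inr ⟨hx, h⟩)
    · rintro (rfl | h | h)
      exacts [hsV, h.1, h.1]
  have hd : Disjoint (V.filter fun a => s < a) (V.filter fun a => a < s) := by
    rw [Finset.disjoint_left]
    intro x hx hx'
    exact lt_asymm (Finset.mem_filter.1 hx).2 (Finset.mem_filter.1 hx').2
  conv_lhs => rw [e]
  rw [Finset.sum_insert (by simp), Finset.sum_union hd]
  have h1 : logWeight w (N' s) ≤ logWeight w K :=
    logWeight_mono hw ⟨s, h.root s h.mem⟩ fun y hy => h.after.subset s h.mem y hy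
  have h2 : logWeight w {s} ≤ logWeight w (N s) :=
    logWeight_mono hw (by simp) (by simpa using hsN)
  linarith

/-- Every leaf of the after-tree pays for itself. -/
theorem exists_leaves_bound (D : ℕ) {c : ℝ} (hc : 0 ≤ c) : ∃ M : ℝ, 0 ≤ M ∧
    ∀ {α : Type*} [LinearOrder α] {K V : Finset α} {s : α} {N N' : α → Finset α} {w : α → ℝ},
      IsPathRearrangement K V s N N' D → (∀ a, 0 < w a) → ∀ {Z : Finset α},
      (∀ x ∈ Z, x ∈ V ∧ ∀ y ∈ V, y ∈ N' x → y = x) →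
      c * Z.card ≤ ∑ a ∈ K, logWeight w (N a) - ∑ a ∈ K, logWeight w (N' a) +
        M * (1 + (logWeight w K - logWeight w {s})) := by
  obtain ⟨C, hC, hcC⟩ := exists_logb_loss c
  -- `c` covers `s` in case it belongs to `Z`, the summand 1 its potential, `2 * (D + 1)` the other
  -- elements on both sides, and `2 * (1 + 2 * C)` the leaves on both sides.
  refine ⟨c + 1 + 2 * (D + 1) + 2 * (1 + 2 * C), by positivity, ?_⟩
  intro α _ K V s N N' w h hw Z hZ
  classical
  have h0 := h.sum_sub_le hw
  have hL := h.logWeight_singleton_le hw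
  set L := logWeight w K - logWeight w {s} with hLdef
  have hL0 : 0 ≤ L := by linarith
  have hr1 := h.sum_right_le hw (R := V.filter fun a => s < a ∧ a ∉ Z)
    fun x hx => by simp only [Finset.mem_filter] at hx; tauto
  have hl1 := h.sum_left_le hw (R := V.filter fun a => a < s ∧ a ∉ Z)
    fun x hx => by simp only [Finset.mem_filter] at hx; tauto
  have hr2 := h.sum_right_leaves_le hC hcC hw (R := V.filter fun a => s < a ∧ a ∈ Z)
    (fun x hx => by simp only [Finset.mem_filter] at hx; tauto)
    (fun x hx => by simp only [Finset.mem_filter] at hx; exact (hZ x hx.2.2).2)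
  have hl2 := h.sum_left_leaves_le hC hcC hw (R := V.filter fun a => a < s ∧ a ∈ Z)
    (fun x hx => by simp only [Finset.mem_filter] at hx; tauto)
    (fun x hx => by simp only [Finset.mem_filter] at hx; exact (hZ x hx.2.2).2)
  have er := Finset.sum_filter_add_sum_filter_not (V.filter fun a => s < a) (fun a => a ∈ Z)
    fun a => logWeight w (N' a) - logWeight w (N a)
  have el := Finset.sum_filter_add_sum_filter_not (V.filter fun a => a < s) (fun a => a ∈ Z)
    fun a => logWeight w (N' a) - logWeight w (N a)
  rw [Finset.filter_filter, Finset.filter_filter] at er el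
  rw [Finset.sum_sub_distrib, Finset.sum_sub_distrib] at er el
  rw [Finset.sum_add_distrib, Finset.sum_const, nsmul_eq_mul] at hr2 hl2
  have hcard : (Z.card : ℝ) ≤ 1 + (V.filter fun a => s < a ∧ a ∈ Z).card +
      (V.filter fun a => a < s ∧ a ∈ Z).card := by
    have : Z ⊆ insert s ((V.filter fun a => s < a ∧ a ∈ Z) ∪ V.filter fun a => a < s ∧ a ∈ Z) := by
      intro x hx
      simp only [Finset.mem_insert, Finset.mem_union, Finset.mem_filter]
      have := (hZ x hx).1
      rcases lt_trichotomy s x with h | h | h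
      · exact Or.inr (Or.inl ⟨this, h, hx⟩)
      · exact Or.inl h.symm
      · exact Or.inr (Or.inr ⟨this, h, hx⟩)
    have h1 := (Finset.card_le_card this).trans ((Finset.card_insert_le _ _).trans
      (Nat.add_le_add_right (Finset.card_union_le _ _) 1))
    have h2 : (Z.card : ℝ) ≤ _ := Nat.cast_le.2 h1
    push_cast at h2
    linarith
  have := mul_le_mul_of_nonneg_left hcard hc
  have hM : 0 ≤ c * L := mul_nonneg hc hL0
  have hD : (0 : ℝ) ≤ D := by positivity
  nlinarith

/-- The common ancestor of `v` and `y` lies on the path because it is above `v`, lies below `u` by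
convexity, and is not `u`. As `v` is the path child of `u`, this ancestor can only be `v`. -/
theorem mem_of_between_child (h : IsPathRearrangement K V s N N' D) {u v y : α} (hu : u ∈ V)
    (hv : v ∈ V) (hvu : v ∈ N u)
    (hch : ∀ y ∈ V, y ∈ N u → y ≠ u → y ∈ N v) (hy : y ∈ K) (h1 : v < y) (h2 : y < u) :
    y ∈ N v := by
  have huK := ((h.mem_path u).1 hu).1
  have hvK := ((h.mem_path v).1 hv).1
  obtain ⟨z, hz, hb, hzv, hzy⟩ := h.before.lca v hvK y hy
  have hb' : v ≤ z ∧ z ≤ y := by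
    rcases hb with hb | hb
    · exact hb
    · exact absurd (hb.1.trans hb.2) h1.not_ge
  have hzV : z ∈ V := (h.mem_path z).2
    ⟨hz, h.before.trans z hz v hzv s ((h.mem_path v).1 hv).2⟩
  have hzu : z ∈ N u := h.before.convex u huK v hvu z hz (Or.inr ⟨hb'.1, (hb'.2.trans_lt h2).le⟩)
  have := hch z hzV hzu (hb'.2.trans_lt h2).ne
  rwa [h.before.antisymm v hvK z this hzv]

/-- A family of zigzags: `u` is an element of the search path larger than `s`, and its child
`v u` on the path is smaller than `s`. -/
structure IsZigzag (V : Finset α) (s : α) (N : α → Finset α) (Z : Finset α) (v : α → α) :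
    Prop where
  mem : ∀ u ∈ Z, u ∈ V
  lt : ∀ u ∈ Z, s < u
  child_mem : ∀ u ∈ Z, v u ∈ V
  child_lt : ∀ u ∈ Z, v u < s
  child : ∀ u ∈ Z, v u ∈ N u
  next : ∀ u ∈ Z, ∀ y ∈ V, y ∈ N u → y ≠ u → y ∈ N (v u)

/-- The larger `u'` is higher on the path, so `u` is below `v u'`. If `v u'` lay between `v u` and
`u`, it would also be below `u`. Nested zigzags thus span nested intervals. -/
theorem IsZigzag.anti (h : IsPathRearrangement K V s N N' D) {Z : Finset α} {v : α → α}
    (hZ : IsZigzag V s N Z v) {u u' : α} (hu : u ∈ Z) (hu' : u' ∈ Z) (huu' : u < u') :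
    v u' < v u := by
  have hK : ∀ x ∈ V, x ∈ K := fun x hx => ((h.mem_path x).1 hx).1
  have huK := hK u (hZ.mem u hu)
  have hvK := hK _ (hZ.child_mem u' hu')
  have h1 : u ∈ N (v u') := hZ.next u' hu' u (hZ.mem u hu)
    (h.interval_subset (hZ.mem u' hu') huK (hZ.lt u hu).le huu'.le) huu'.ne
  by_contra! hle
  have h2 : v u' ∈ N u := h.before.convex u huK (v u) (hZ.child u hu) (v u') hvK
    (Or.inr ⟨hle, ((hZ.child_lt u' hu').trans (hZ.lt u hu)).le⟩)
  have := h.before.antisymm u huK _ h2 h1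
  exact ((hZ.child_lt u' hu').trans (hZ.lt u hu)).ne this.symm

/-- The new subtrees of `u` and `v u` are disjoint. For zigzags of one colour both fit between `v
u'` and `u'`, where `u'` is the next zigzag, hence into the old subtree of `v u'`; the quantity that
telescopes is twice the logarithm of that weight. -/
theorem sum_zigzag_le (h : IsPathRearrangement K V s N N' D) (hw : ∀ a, 0 < w a) {Z : Finset α}
    {v : α → α} (hZ : IsZigzag V s N Z v) :
    ∑ u ∈ Z, (logWeight w (N' u) + logWeight w (N' (v u)) + 2) ≤
      ∑ u ∈ Z, (logWeight w (N u) + logWeight w (N (v u))) +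
        (D + 1) ^ 2 * (2 * (logWeight w K - logWeight w {s})) := by
  have hK : ∀ x ∈ V, x ∈ K := fun x hx => ((h.mem_path x).1 hx).1
  obtain ⟨col, hcol, hsep⟩ := h.exists_coloring
  obtain ⟨col', hcol', hsep'⟩ := h.dual.exists_coloring
  have hsV : ∀ x ∈ V, s ∈ N x := fun x hx => ((h.mem_path x).1 hx).2
  -- A zigzag is coloured by the side depths of both its elements, whence the square of `D + 1`.
  have key := sum_le_of_coloring (R := Z) (col := fun u => (col u, col' (v u)))
    (B := Finset.range (D + 1) ×ˢ Finset.range (D + 1))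
    (fun u hu => Finset.mem_product.2 ⟨hcol u (hZ.mem u hu) (hZ.lt u hu),
      hcol' (v u) (hZ.child_mem u hu) (hZ.child_lt u hu)⟩)
    (f := fun u => logWeight w (N u) + logWeight w (N (v u)))
    (g := fun u => logWeight w (N' u) + logWeight w (N' (v u)) + 2)
    (L := 2 * (logWeight w K - logWeight w {s})) ?_
  · simp only [Finset.card_product, Finset.card_range] at key
    push_cast at key
    linarith
  · intro b _
    have hm : ∀ u ∈ Z.filter (fun u => (col u, col' (v u)) = b), u ∈ Z :=
      fun u hu => (Finset.mem_filter.1 hu).1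
    have hN : ∀ u ∈ Z, (N (v u)).Nonempty := fun u hu => ⟨s, hsV _ (hZ.child_mem u hu)⟩
    have h2L := h.logWeight_singleton_le hw
    have t := sum_le_of_telescoping (fun u => logWeight w (N u) + logWeight w (N (v u)))
      (fun u => logWeight w (N' u) + logWeight w (N' (v u)))
      (fun u => 2 * logWeight w (N (v u))) (c := 2) (C := 0) (hi := 2 * logWeight w K) le_rfl
      (Z.filter fun u => (col u, col' (v u)) = b)
      (fun u hu => by
        have := logWeight_mono hw (hN u (hm u hu)) fun y hy =>
          h.before.trans u (hK u (hZ.mem u (hm u hu))) (v u) (hZ.child u (hm u hu)) y hy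
        linarith)
      (fun u hu => by
        have := logWeight_mono hw (hN u (hm u hu)) fun y hy =>
          h.before.subset _ (hK _ (hZ.child_mem u (hm u hu))) y hy
        linarith)
      (2 * logWeight w {s}) (2 * logWeight w {s}) (by linarith) (by linarith)
      (fun u hu => by
        have : logWeight w {s} ≤ logWeight w (N (v u)) := logWeight_mono hw (by simp)
          (by simpa using hsV _ (hZ.child_mem u (hm u hu)))
        linarith) ?_
    · linarith
    · intro u hu p' q' _ hq'
      have huZ := hm u hu
      obtain ⟨n1, k1, g1⟩ := h.after_props (hZ.mem u huZ) (hZ.lt u huZ)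
      obtain ⟨n2, k2, g2⟩ := h.dual.after_props (hZ.child_mem u huZ) (hZ.child_lt u huZ)
      have g2' : ∀ y ∈ N' (v u), y < s := g2
      have hdis : ∀ y ∈ N' u, y ∉ N' (v u) := fun y hy hy' => lt_asymm (g1 y hy) (g2' y hy')
      rw [zero_mul, add_zero]
      rcases hq' with rfl | ⟨u', hu', huu', rfl⟩
      · exact logb_add_logb_add_two_le (sum_weight_pos hw n1) (sum_weight_pos hw n2)
          (sum_weight_add_le hw k1 k2 hdis)
      · have hu'Z := hm u' hu'
        have hvv := hZ.anti h huZ hu'Z huu'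
        have hcc : (col u, col' (v u)) = (col u', col' (v u')) :=
          (Finset.mem_filter.1 hu).2.trans (Finset.mem_filter.1 hu').2.symm
        have m1 : ∀ y ∈ N' u, y < u' := hsep u (hZ.mem u huZ) (hZ.lt u huZ) u' (hZ.mem u' hu'Z) huu'
          (congrArg Prod.fst hcc)
        have m2 : ∀ y ∈ N' (v u), v u' < y := hsep' (v u) (hZ.child_mem u huZ)
          (hZ.child_lt u huZ) (v u') (hZ.child_mem u' hu'Z) hvv (congrArg Prod.snd hcc)
        have hmem : ∀ y ∈ K, v u' < y → y < u' → y ∈ N (v u') := fun y hy h1 h2 =>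
          h.mem_of_between_child (hZ.mem u' hu'Z) (hZ.child_mem u' hu'Z)
            (hZ.child u' hu'Z) (hZ.next u' hu'Z) hy h1 h2
        exact logb_add_logb_add_two_le (sum_weight_pos hw n1) (sum_weight_pos hw n2)
          (sum_weight_add_le hw
            (fun y hy => hmem y (k1 hy) ((hZ.child_lt u' hu'Z).trans (g1 y hy)) (m1 y hy))
            (fun y hy => hmem y (k2 hy) (m2 y hy) ((g2' y hy).trans (hZ.lt u' hu'Z))) hdis)

/-- Every zigzag of the search path pays for itself. -/
theorem zigzag_bound (h : IsPathRearrangement K V s N N' D) (hw : ∀ a, 0 < w a) {Z : Finset α}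
    {v : α → α} (hZ : IsZigzag V s N Z v) :
    2 * (Z.card : ℝ) ≤ ∑ a ∈ K, logWeight w (N a) - ∑ a ∈ K, logWeight w (N' a) +
      (1 + 2 * (D + 1) + 2 * (D + 1) ^ 2) * (logWeight w K - logWeight w {s}) := by
  classical
  have h0 := h.sum_sub_le hw
  have hz := h.sum_zigzag_le hw hZ
  have hinj : Set.InjOn v Z := by
    intro u hu u' hu' huu'
    by_contra hne
    rcases lt_or_gt_of_ne hne with hlt | hlt
    · exact (hZ.anti h hu hu' hlt).ne huu'.symm
    · exact (hZ.anti h hu' hu hlt).ne huu'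
  have hr1 := h.sum_right_le hw (R := V.filter fun a => s < a ∧ a ∉ Z)
    fun x hx => by simp only [Finset.mem_filter] at hx; tauto
  have hl1 := h.sum_left_le hw (R := V.filter fun a => a < s ∧ a ∉ Z.image v)
    fun x hx => by simp only [Finset.mem_filter] at hx; tauto
  have er := Finset.sum_filter_add_sum_filter_not (V.filter fun a => s < a) (fun a => a ∈ Z)
    fun a => logWeight w (N' a) - logWeight w (N a)
  have el := Finset.sum_filter_add_sum_filter_not (V.filter fun a => a < s)
    (fun a => a ∈ Z.image v) fun a => logWeight w (N' a) - logWeight w (N a)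
  rw [Finset.filter_filter, Finset.filter_filter] at er el
  have e1 : (V.filter fun a => s < a ∧ a ∈ Z) = Z := by
    ext x
    rw [Finset.mem_filter]
    exact ⟨fun h => h.2.2, fun hx => ⟨hZ.mem x hx, hZ.lt x hx, hx⟩⟩
  have e2 : (V.filter fun a => a < s ∧ a ∈ Z.image v) = Z.image v := by
    ext x
    rw [Finset.mem_filter]
    refine ⟨fun h => h.2.2, fun hx => ?_⟩
    obtain ⟨u, hu, rfl⟩ := Finset.mem_image.1 hx
    exact ⟨hZ.child_mem u hu, hZ.child_lt u hu, hx⟩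
  rw [e1] at er
  rw [e2, Finset.sum_image hinj] at el
  simp only [Finset.sum_sub_distrib, Finset.sum_add_distrib, Finset.sum_const, nsmul_eq_mul]
    at er el hz h0
  linarith

end IsPathRearrangement

/-! ### Greedy BST -/

section Greedy

variable {n : ℕ} {h h' : Fin n → ℕ} {s : Fin n}

theorem mem_stair {a b : Fin n} :
    b ∈ stair h a ↔ ∀ b', (a ≤ b' ∧ b' ≤ b ∨ b ≤ b' ∧ b' ≤ a) → b' ≠ b → h b' < h b := by
  simp only [stair, Finset.mem_filter, Finset.mem_univ, true_and, Finset.mem_uIcc']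

theorem mem_neighborhood {a b : Fin n} :
    b ∈ neighborhood h a ↔ ∀ b', (a ≤ b' ∧ b' ≤ b ∨ b ≤ b' ∧ b' ≤ a) → b' ≠ a → h b' < h a := by
  simp only [neighborhood, Finset.mem_filter, Finset.mem_univ, true_and, Finset.mem_uIcc']

theorem mem_neighborhood_self (a : Fin n) : a ∈ neighborhood h a := by
  rw [mem_neighborhood]
  intro b' hb hne
  omega

theorem mem_neighborhood_of_mem_stair {a y : Fin n} (ha : a ∈ stair h s)
    (hy : s ≤ y ∧ y ≤ a ∨ a ≤ y ∧ y ≤ s) : y ∈ neighborhood h a := by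
  rw [mem_stair] at ha
  rw [mem_neighborhood]
  intro b' hb hne
  exact ha b' (by omega) hne

/-- An element `a` outside the stair is hidden from `s` by some `c` between them that is at least as
high. The neighborhood of `a` does not reach `c`, and a stair element lower than `a` cannot be
hidden from `s` by `a` or `c`; so no stair element lies within the neighborhood except where it
already was a barrier. -/
theorem greedyBST_neighborhood_of_notMem {H : ℕ} (hH : ∀ a ∉ stair h s, h a < H)
    (hh' : ∀ a, h' a = if a ∈ stair h s then H else h a) {a : Fin n} (ha : a ∉ stair h s) :
    neighborhood h' a = neighborhood h a := by
  have ha' : h' a = h a := by rw [hh', if_neg ha]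
  ext y
  rw [mem_neighborhood, mem_neighborhood]
  constructor
  · intro hy b' hb hne
    have := hy b' hb hne
    by_cases hb' : b' ∈ stair h s
    · rw [hh' b', if_pos hb', ha'] at this
      exact absurd (hH a ha) this.not_gt
    · rwa [hh' b', if_neg hb', ha'] at this
  · intro hy b' hb hne
    have hlt := hy b' hb hne
    by_cases hb' : b' ∈ stair h s
    · exfalso
      rw [mem_stair] at ha hb'
      push Not at ha
      obtain ⟨c, hc, hca, hac⟩ := ha
      have h1 : a ≠ b' → ¬ (s ≤ a ∧ a ≤ b' ∨ b' ≤ a ∧ a ≤ s) := fun hne h1 =>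
        absurd (hb' a h1 hne) hlt.not_gt
      have h2 : ¬ (a ≤ c ∧ c ≤ y ∨ y ≤ c ∧ c ≤ a) := fun h2 =>
        absurd (hy c h2 hca) hac.not_gt
      have h3 : c ≠ b' → ¬ (s ≤ c ∧ c ≤ b' ∨ b' ≤ c ∧ c ≤ s) := fun hne h3 =>
        absurd ((hb' c h3 hne).trans hlt) hac.not_gt
      omega
    · rwa [hh' b', if_neg hb', ha']

/-- All elements of the stair now have the same height, so each is a barrier for every other. -/
theorem greedyBST_neighborhood_avoids {H : ℕ}
    (hh' : ∀ a, h' a = if a ∈ stair h s then H else h a) {a q y : Fin n} (ha : a ∈ stair h s)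
    (hq : q ∈ stair h s) (hne : q ≠ a) (hy : y ∈ neighborhood h' a) :
    ¬ (a ≤ q ∧ q ≤ y ∨ y ≤ q ∧ q ≤ a) := by
  intro hb
  have := mem_neighborhood.1 hy q hb hne
  rw [hh', hh', if_pos ha, if_pos hq] at this
  exact lt_irrefl _ this

theorem self_mem_stair : s ∈ stair h s := by
  rw [mem_stair]
  intro b' hb hne
  omega

end Greedy

theorem logb_div_eq {α : Type*} {w : α → ℝ} (hw : ∀ a, 0 < w a) {K : Finset α} {s : α}
    (hs : s ∈ K) :
    Real.logb 2 ((∑ a ∈ K, w a) / w s) = logWeight w K - logWeight w {s} := by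
  rw [logWeight, logWeight, Finset.sum_singleton,
    Real.logb_div (sum_weight_pos hw ⟨s, hs⟩).ne' (hw s).ne']

/-- Every stair element other than `s` gains 1, since the new neighborhoods of the stair are
separated by the stair elements. -/
theorem satisfiesGeometricAccessLemma_greedyBST : SatisfiesGeometricAccessLemma 1 greedyBST := by
  obtain ⟨C, hC, hcC⟩ := exists_logb_loss 1
  -- `1 + 2 * C` for each side of `s`; the remaining 2 is ample for the unit cost and the potential
  -- of `s`.
  refine ⟨2 + 2 * (1 + 2 * C), ?_⟩
  rintro n h s h' w ⟨H, hH, hh'⟩ hw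
  rw [logb_div_eq hw (Finset.mem_univ s)]
  set L := logWeight w Finset.univ - logWeight w {s} with hLdef
  have hL0 : 0 ≤ L := by
    have : logWeight w {s} ≤ logWeight w Finset.univ := logWeight_mono hw (by simp) (by simp)
    linarith
  have hne : ∀ a, (neighborhood h' a).Nonempty := fun a => ⟨a, mem_neighborhood_self a⟩
  have hR := sum_logWeight_separated hC hcC hw (Finset.mem_univ s) (N := neighborhood h)
    (N' := neighborhood h') (R := (stair h s).filter fun a => s < a)
    (fun a ha => (Finset.mem_filter.1 ha).2)
    (fun a ha y _ h1 h2 =>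
      mem_neighborhood_of_mem_stair (Finset.mem_filter.1 ha).1 (Or.inl ⟨h1, h2⟩))
    (fun a ha => ⟨hne a, by simp, fun y hy => by
      rw [Finset.mem_filter] at ha
      have := greedyBST_neighborhood_avoids hh' ha.1 self_mem_stair ha.2.ne hy
      omega⟩)
    (fun a ha q hq haq y hy => by
      rw [Finset.mem_filter] at ha hq
      have := greedyBST_neighborhood_avoids hh' ha.1 hq.1 haq.ne' hy
      omega)
    (fun a ha q hq haq y hy => by
      rw [Finset.mem_filter] at ha hq
      have := greedyBST_neighborhood_avoids hh' ha.1 hq.1 haq.ne hy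
      omega)
  have hLf := sum_logWeight_separated_left hC hcC hw (Finset.mem_univ s) (N := neighborhood h)
    (N' := neighborhood h') (R := (stair h s).filter fun a => a < s)
    (fun a ha => (Finset.mem_filter.1 ha).2)
    (fun a ha y _ h1 h2 =>
      mem_neighborhood_of_mem_stair (Finset.mem_filter.1 ha).1 (Or.inr ⟨h2, h1⟩))
    (fun a ha => ⟨hne a, by simp, fun y hy => by
      rw [Finset.mem_filter] at ha
      have := greedyBST_neighborhood_avoids hh' ha.1 self_mem_stair ha.2.ne' hy
      omega⟩)
    (fun a ha q hq haq y hy => by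
      rw [Finset.mem_filter] at ha hq
      have := greedyBST_neighborhood_avoids hh' ha.1 hq.1 haq.ne hy
      omega)
    (fun a ha q hq haq y hy => by
      rw [Finset.mem_filter] at ha hq
      have := greedyBST_neighborhood_avoids hh' ha.1 hq.1 haq.ne' hy
      omega)
  have e : stair h s = insert s
      (((stair h s).filter fun a => s < a) ∪ (stair h s).filter fun a => a < s) := by
    ext x
    simp only [Finset.mem_insert, Finset.mem_union, Finset.mem_filter]
    constructor
    · intro hx
      rcases lt_trichotomy s x with h | h | h
      · exact Or.inr (Or.inl ⟨hx, h⟩)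
      · exact Or.inl h.symm
      · exact Or.inr (Or.inr ⟨hx, h⟩)
    · rintro (rfl | h | h)
      exacts [self_mem_stair, h.1, h.1]
  have hd : Disjoint ((stair h s).filter fun a => s < a) ((stair h s).filter fun a => a < s) := by
    rw [Finset.disjoint_left]
    intro x hx hx'
    exact lt_asymm (Finset.mem_filter.1 hx).2 (Finset.mem_filter.1 hx').2
  have hsum : geometricPotential w h' - geometricPotential w h =
      ∑ a ∈ stair h s, (logWeight w (neighborhood h' a) - logWeight w (neighborhood h a)) := by
    rw [geometricPotential, geometricPotential, ← Finset.sum_sub_distrib]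
    symm
    refine Finset.sum_subset (Finset.subset_univ _) fun x _ hx => ?_
    rw [greedyBST_neighborhood_of_notMem hH hh' hx, sub_self]
  have hcard : ((stair h s).card : ℝ) = ∑ a ∈ stair h s, (1 : ℝ) := by simp
  have key : ∑ a ∈ stair h s, (logWeight w (neighborhood h' a) - logWeight w (neighborhood h a)) +
      ∑ a ∈ stair h s, (1 : ℝ) ≤ 1 + L + 2 * (1 + 2 * C) * L := by
    rw [e, Finset.sum_insert (by simp), Finset.sum_union hd, Finset.sum_insert (by simp),
      Finset.sum_union hd]
    simp only [Finset.sum_sub_distrib]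
    rw [Finset.sum_add_distrib] at hR hLf
    have h1 : logWeight w (neighborhood h' s) ≤ logWeight w Finset.univ :=
      logWeight_mono hw (hne s) (by simp)
    have h2 : logWeight w {s} ≤ logWeight w (neighborhood h s) :=
      logWeight_mono hw (by simp) (by simpa using mem_neighborhood_self s)
    linarith
  rw [← hsum, ← hcard] at key
  have : 0 ≤ (1 + 2 * C) * (1 + L) := by positivity
  nlinarith

/-! ### Rearrangements of search trees -/

section TreeRearrangement

variable {T A T' : BinaryTree ℕ} {s : ℕ}

theorem IsRearrangement.isBST (hT : IsBST T) (h : IsRearrangement T s A T') : IsBST T' :=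
  h.2.2 ▸ isBST_fill_pendants hT h.1

theorem IsRearrangement.keys_eq (hT : IsBST T) (h : IsRearrangement T s A T') :
    keys T' = keys T := h.2.2 ▸ keys_fill_pendants hT h.1

theorem IsRearrangement.mem_desc_iff (hT : IsBST T) (h : IsRearrangement T s A T') {x y : ℕ}
    (hx : x ∈ keys (pathTree T s)) (hy : y ∈ keys (pathTree T s)) :
    y ∈ desc T' x ↔ y ∈ desc A x := by
  rw [h.2.2]
  exact mem_desc_fill_pendants hT h.1 hx hy

theorem IsRearrangement.isPathRearrangement (hT : IsBST T) (hs : s ∈ keys T)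
    (h : IsRearrangement T s A T') {D : ℕ}
    (hr : ∀ x ∈ keys (pathTree T s), s < x → ∀ Y : Finset ℕ,
      (∀ y ∈ Y, y ∈ keys (pathTree T s) ∧ s < y ∧ y < x ∧ x ∈ desc A y) → Y.card ≤ D)
    (hl : ∀ x ∈ keys (pathTree T s), x < s → ∀ Y : Finset ℕ,
      (∀ y ∈ Y, y ∈ keys (pathTree T s) ∧ y < s ∧ x < y ∧ x ∈ desc A y) → Y.card ≤ D) :
    IsPathRearrangement (keys T) (keys (pathTree T s)) s (desc T) (desc T') D where
  before := isTreeOrder_desc hT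
  after := h.keys_eq hT ▸ isTreeOrder_desc (h.isBST hT)
  mem := hs
  root x hx := by
    rw [← h.keys_eq hT] at hx
    obtain ⟨l, r, hA⟩ := h.2.1
    rw [h.2.2, hA, fill] at hx ⊢
    rwa [desc_root]
  mem_path x := by
    rw [mem_keys_pathTree_iff_desc hs]
    refine ⟨fun h => ⟨?_, h⟩, fun h => h.2⟩
    exact searchPath_subset_keys T s x (mem_desc.1 h).2
  unchanged x hx hx' := by
    rw [h.2.2]
    exact desc_fill_pendants hT h.1 hx hx'
  right x hx hsx Y hY := hr x hx hsx Y fun y hy => by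
    obtain ⟨h1, h2, h3, h4⟩ := hY y hy
    exact ⟨h1, h2, h3, (h.mem_desc_iff hT h1 hx).1 h4⟩
  left x hx hsx Y hY := hl x hx hsx Y fun y hy => by
    obtain ⟨h1, h2, h3, h4⟩ := hY y hy
    exact ⟨h1, h2, h3, (h.mem_desc_iff hT h1 hx).1 h4⟩

theorem IsRearrangement.potential_sub (hT : IsBST T) (h : IsRearrangement T s A T')
    (w : ℕ → ℝ) : potential w T - potential w T' =
      ∑ a ∈ keys T, logWeight w (desc T a) - ∑ a ∈ keys T, logWeight w (desc T' a) := by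
  rw [potential_eq_sum w hT, potential_eq_sum w (h.isBST hT), h.keys_eq hT]
  rfl

theorem isTreeOrder_desc_pathTree (hT : IsBST T) (s : ℕ) :
    IsTreeOrder (keys (pathTree T s)) (desc (pathTree T s)) :=
  isTreeOrder_desc (isBST_pathTree hT s)

theorem mem_desc_pathTree_of_mem (hT : IsBST T) (hs : s ∈ keys T) {x : ℕ}
    (hx : x ∈ keys (pathTree T s)) : s ∈ desc (pathTree T s) x := by
  rw [mem_desc_pathTree hT hx, ← mem_keys_pathTree_iff_desc hs]
  · exact hx
  · exact mem_keys_pathTree.2 (mem_searchPath_self hT hs)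

theorem mem_ancestors {x y : ℕ} (hy : y ∈ keys T) : x ∈ ancestors T y ↔ x ≠ y ∧ y ∈ desc T x := by
  rw [ancestors, Finset.mem_erase, List.mem_toFinset, mem_desc]
  tauto

end TreeRearrangement

/-! ### Strict depth-halving -/

section DepthHalving

variable {α : Type*} [LinearOrder α] {V : Finset α} {s : α} {NP NA : α → Finset α} {d : ℕ}

/-- In a path ending in `s`, an element larger than `s` has only smaller descendants. -/
theorem IsTreeOrder.notMem_of_path (hP : IsTreeOrder V NP) (hsP : ∀ x ∈ V, s ∈ NP x) {x y : α}
    (hx : x ∈ V) (hsx : s < x) (hxy : x < y) : y ∉ NP x := by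
  intro hy
  have hyV := hP.subset x hx y hy
  have : x ∈ NP y := hP.convex y hyV s (hsP y hyV) x hx (Or.inr ⟨hsx.le, hxy.le⟩)
  exact hxy.ne (hP.antisymm x hx y hy this)

/-- Let `y₀` be the least of the side ancestors of `x`. The other side ancestors and `x` lie between
`y₀` and `x`, hence below `y₀` in the after-tree, and being larger than `y₀` they were not below it
on the path. So `y₀` has gained all of them. -/
theorem sideDepth_le_of_gained (hP : IsTreeOrder V NP) (hA : IsTreeOrder V NA)
    (hsP : ∀ x ∈ V, s ∈ NP x)
    (hgain : ∀ x ∈ V, x ≠ s → ∀ Y : Finset α,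
      (∀ y ∈ Y, y ∈ V ∧ y ≠ x ∧ y ∈ NA x ∧ y ∉ NP x) → Y.card ≤ d)
    {x : α} (hx : x ∈ V) {Y : Finset α} (hY : ∀ y ∈ Y, y ∈ V ∧ s < y ∧ y < x ∧ x ∈ NA y) :
    Y.card ≤ d := by
  classical
  rcases Y.eq_empty_or_nonempty with rfl | hne
  · simp
  obtain ⟨y₀, hy₀, hmin⟩ := Y.exists_min_image id hne
  obtain ⟨hV, hsy, hyx, hxy⟩ := hY y₀ hy₀
  have hxY : x ∉ Y.erase y₀ := fun h => lt_irrefl _ (hY x (Finset.mem_of_mem_erase h)).2.2.1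
  have := hgain y₀ hV hsy.ne' (insert x (Y.erase y₀)) (by
    intro z hz
    have hlt : y₀ < z ∧ z ∈ V ∧ z ≤ x := by
      rcases Finset.mem_insert.1 hz with rfl | hz
      · exact ⟨hyx, hx, le_rfl⟩
      · obtain ⟨h1, h2⟩ := Finset.mem_erase.1 hz
        exact ⟨lt_of_le_of_ne (hmin z h2) h1.symm, (hY z h2).1, (hY z h2).2.2.1.le⟩
    exact ⟨hlt.2.1, hlt.1.ne', hA.convex y₀ hV x hxy z hlt.2.1 (Or.inl ⟨hlt.1.le, hlt.2.2⟩),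
      hP.notMem_of_path hsP hV hsy hlt.1⟩)
  rwa [Finset.card_insert_of_notMem hxY, Finset.card_erase_add_one hy₀] at this

theorem IsTreeOrder.exists_leaf (hA : IsTreeOrder V NA) {x : α} (hx : x ∈ V) :
    ∃ y ∈ NA x, ∀ z ∈ NA y, z = y := by
  obtain ⟨y, hy, hmin⟩ := (NA x).exists_min_image (fun y => (NA y).card) ⟨x, hA.self_mem x hx⟩
  have hyV := hA.subset x hx y hy
  refine ⟨y, hy, fun z hz => ?_⟩
  have hsub : NA z ⊆ NA y := fun t ht => hA.trans y hyV z hz t ht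
  have heq := Finset.eq_of_subset_of_card_le hsub (hmin z (hA.trans x hx y hy z hz))
  exact (hA.antisymm y hyV z hz (heq ▸ hA.self_mem y hyV)).symm

/-- The elements larger than `s` are bounded by the number of leaves among them. -/
theorem card_right_le_of_depthHalving (hP : IsTreeOrder V NP) (hA : IsTreeOrder V NA) (hs : s ∈ V)
    (hsP : ∀ x ∈ V, s ∈ NP x) (hsA : ∀ x ∈ V, x ∈ NA s)
    (hgain : ∀ x ∈ V, x ≠ s → ∀ Y : Finset α,
      (∀ y ∈ Y, y ∈ V ∧ y ≠ x ∧ y ∈ NA x ∧ y ∉ NP x) → Y.card ≤ d) {κ : ℝ} (hκ : 0 ≤ κ)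
    (hkept : ∀ r ∈ V, ∀ Y : Finset α, (∀ x ∈ Y, x ∈ V ∧ x ≠ r ∧ r ∈ NA x ∧ r ∈ NP x) →
      (Y.card : ℝ) ≤ κ)
    {R Z : Finset α} (hR : ∀ x ∈ R, x ∈ V ∧ s < x)
    (hZ : ∀ x ∈ V, s < x → (∀ y ∈ NA x, y = x) → x ∈ Z) :
    (R.card : ℝ) ≤ d * Z.card + κ + 1 := by
  classical
  -- `X` consists of the elements with a smaller ancestor on their side of `s`. What remains of `R`
  -- is a spine: none of its elements has such an ancestor.
  set X := R.filter fun x => ∃ y ∈ V, s < y ∧ y < x ∧ x ∈ NA y with hX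
  have hbound : X.card ≤ d * Z.card := by
    have hleaf : ∀ x, ∃ y, x ∈ V → s < x → y ∈ NA x ∧ y ∈ Z := by
      intro x
      by_cases hx : x ∈ V ∧ s < x
      · obtain ⟨y, hy, hyl⟩ := hA.exists_leaf hx.1
        have hyV := hA.subset x hx.1 y hy
        have hsy : s < y := by
          by_contra! hys
          have hsx : s ∈ NA x := hA.convex x hx.1 y hy s hs (Or.inr ⟨hys, hx.2.le⟩)
          exact hx.2.ne' (hA.antisymm x hx.1 s hsx (hsA x hx.1))
        exact ⟨y, fun _ _ => ⟨hy, hZ y hyV hsy hyl⟩⟩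
      · exact ⟨x, fun h1 h2 => absurd ⟨h1, h2⟩ hx⟩
    choose l hl using hleaf
    have hXV : ∀ x ∈ X, x ∈ V ∧ s < x := fun x hx => hR x (Finset.mem_filter.1 hx).1
    -- Each element of `X` is charged to a leaf `l x` below it. It remains to show that one leaf is
    -- charged at most `d` times.
    refine Finset.card_le_mul_card_image_of_maps_to (f := l)
      (fun x hx => (hl x (hXV x hx).1 (hXV x hx).2).2) d fun z _ => ?_
    set F := X.filter fun x => l x = z with hF
    rcases F.eq_empty_or_nonempty with h0 | ⟨x₁, hx₁⟩
    · simp [h0]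
    have hFX : ∀ x ∈ F, x ∈ X ∧ z ∈ NA x := fun x hx => by
      obtain ⟨h1, h2⟩ := Finset.mem_filter.1 hx
      exact ⟨h1, h2 ▸ (hl x (hXV x h1).1 (hXV x h1).2).1⟩
    have hne : (V.filter fun y => s < y ∧ ∃ x ∈ F, y < x ∧ x ∈ NA y).Nonempty := by
      obtain ⟨y, hy, h1, h2, h3⟩ := (Finset.mem_filter.1 (hFX x₁ hx₁).1).2
      exact ⟨y, Finset.mem_filter.2 ⟨hy, h1, x₁, hx₁, h2, h3⟩⟩
    obtain ⟨y₀, hy₀, hmin⟩ := Finset.exists_min_image _ id hne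
    obtain ⟨hy₀V, hsy₀, x₀, hx₀, hyx₀, hxy₀⟩ := Finset.mem_filter.1 hy₀
    refine hgain y₀ hy₀V hsy₀.ne' F fun x hx => ?_
    obtain ⟨hxX, hzx⟩ := hFX x hx
    have hxV := (hXV x hxX).1
    obtain ⟨y, hyV, hsy, hyx, hxy⟩ := (Finset.mem_filter.1 hxX).2
    have hy₀y : y₀ ≤ y := hmin y (Finset.mem_filter.2 ⟨hyV, hsy, x, hx, hyx, hxy⟩)
    have hlt : y₀ < x := hy₀y.trans_lt hyx
    -- `y₀` is the least side ancestor of any element charged to `z`. Both `y₀` and `x` are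
    -- ancestors of `z`, hence comparable; were `y₀` below `x`, so would be the ancestor `y` of `x`.
    -- Thus `y₀` has gained every `x` charged to `z`.
    refine ⟨hxV, hlt.ne', ?_, hP.notMem_of_path hsP hy₀V hsy₀ hlt⟩
    rcases hA.chain y₀ hy₀V x hxV z (hA.trans y₀ hy₀V x₀ hxy₀ z (hFX x₀ hx₀).2) hzx with h | h
    · exact h
    · have hyN : y ∈ NA x := hA.convex x hxV y₀ h y hyV (Or.inr ⟨hy₀y, hyx.le⟩)
      exact absurd (hA.antisymm x hxV y hyN hxy) hyx.ne'
  -- Every spine element is an ancestor of the least element `r` of `R`, both on the path and in the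
  -- after-tree, so it is one of the ancestors that `r` keeps.
  have hspine : ((R.filter fun x => ¬ ∃ y ∈ V, s < y ∧ y < x ∧ x ∈ NA y).card : ℝ) ≤ κ + 1 := by
    rcases R.eq_empty_or_nonempty with rfl | hne
    · simp; linarith
    obtain ⟨r, hr, hmin⟩ := R.exists_min_image id hne
    have hrV := (hR r hr).1
    set S := R.filter fun x => ¬ ∃ y ∈ V, s < y ∧ y < x ∧ x ∈ NA y with hS
    have h1 := hkept r hrV (S.erase r) (by
      intro x hx
      obtain ⟨hxr, hxS⟩ := Finset.mem_erase.1 hx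
      obtain ⟨hxR, hno⟩ := Finset.mem_filter.1 hxS
      have hxV := (hR x hxR).1
      have hrx : r < x := lt_of_le_of_ne (hmin x hxR) hxr.symm
      refine ⟨hxV, hxr, ?_, hP.convex x hxV s (hsP x hxV) r hrV
        (Or.inr ⟨(hR r hr).2.le, hrx.le⟩)⟩
      obtain ⟨z, hzV, hb, hzr, hzx⟩ := hA.lca r hrV x hxV
      have hb' : r ≤ z ∧ z ≤ x := by
        rcases hb with hb | hb
        · exact hb
        · exact absurd (hb.1.trans hb.2) hrx.not_ge
      rcases hb'.2.lt_or_eq with hlt | rfl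
      · exact absurd ⟨z, hzV, (hR r hr).2.trans_le hb'.1, hlt, hzx⟩ hno
      · exact hzr)
    have h2 : S.card ≤ (S.erase r).card + 1 := by
      have := Finset.pred_card_le_card_erase (s := S) (a := r)
      omega
    have h3 : (S.card : ℝ) ≤ (S.erase r).card + 1 := by exact_mod_cast h2
    linarith
  have hsplit := Finset.card_filter_add_card_filter_not (s := R)
    (fun x => ∃ y ∈ V, s < y ∧ y < x ∧ x ∈ NA y)
  have h4 : (R.card : ℝ) = X.card + (R.filter fun x => ¬ ∃ y ∈ V, s < y ∧ y < x ∧ x ∈ NA y).card := by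
    exact_mod_cast hsplit.symm
  have h5 : (X.card : ℝ) ≤ d * Z.card := by exact_mod_cast hbound
  linarith

theorem card_left_le_of_depthHalving (hP : IsTreeOrder V NP) (hA : IsTreeOrder V NA) (hs : s ∈ V)
    (hsP : ∀ x ∈ V, s ∈ NP x) (hsA : ∀ x ∈ V, x ∈ NA s)
    (hgain : ∀ x ∈ V, x ≠ s → ∀ Y : Finset α,
      (∀ y ∈ Y, y ∈ V ∧ y ≠ x ∧ y ∈ NA x ∧ y ∉ NP x) → Y.card ≤ d) {κ : ℝ} (hκ : 0 ≤ κ)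
    (hkept : ∀ r ∈ V, ∀ Y : Finset α, (∀ x ∈ Y, x ∈ V ∧ x ≠ r ∧ r ∈ NA x ∧ r ∈ NP x) →
      (Y.card : ℝ) ≤ κ)
    {R Z : Finset α} (hR : ∀ x ∈ R, x ∈ V ∧ x < s)
    (hZ : ∀ x ∈ V, x < s → (∀ y ∈ NA x, y = x) → x ∈ Z) :
    (R.card : ℝ) ≤ d * Z.card + κ + 1 :=
  card_right_le_of_depthHalving (α := αᵒᵈ) hP.dual hA.dual hs hsP hsA hgain hκ hkept hR hZ

end DepthHalving

/-- Adding up both sides of `s` gives n ≤ d'·|Z| + (1 - 2e)n + 2c + 3 for a path of n nodes and the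
set `Z` of leaves, hence 2en ≤ d'·|Z| + 2c + 3. -/
theorem satisfiesAccessLemma_of_isStrictDepthHalving {ε c d : ℝ} (hε : 0 < ε) (hc : 0 < c)
    {𝒜 : Algorithm} (h𝒜 : IsStrictDepthHalving ε c d 𝒜) :
    SatisfiesAccessLemma 1 𝒜 := by
  classical
  -- Capping at 1/2 keeps the coefficient of the path length in `κ` nonnegative.
  set e := min ε (1 / 2) with he
  have he0 : 0 < e := lt_min hε (by norm_num)
  have heε : e ≤ ε := min_le_left _ _
  have he2 : e ≤ 1 / 2 := min_le_right _ _
  set d' := ⌊d⌋₊ with hd'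
  -- The gain per leaf is chosen as the number of path nodes for which a leaf has to account.
  obtain ⟨M, hM, hMb⟩ := IsPathRearrangement.exists_leaves_bound.{0} d' (c := d' / (2 * e))
    (by positivity)
  refine ⟨M + (2 * c + 3) / (2 * e), fun T s T' w hT hs hTT' hw => ?_⟩
  obtain ⟨A, hArr, ha, hb⟩ := h𝒜 T s T' hT hs hTT'
  have hP := isTreeOrder_desc_pathTree hT s
  have hA : IsTreeOrder (keys (pathTree T s)) (desc A) :=
    hArr.1.2 ▸ isTreeOrder_desc hArr.1.1
  have hsV : s ∈ keys (pathTree T s) := mem_keys_pathTree.2 (mem_searchPath_self hT hs)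
  have hsP : ∀ x ∈ keys (pathTree T s), s ∈ desc (pathTree T s) x := fun x hx =>
    mem_desc_pathTree_of_mem hT hs hx
  have hkeys := hArr.1.2
  have hsA : ∀ x ∈ keys (pathTree T s), x ∈ desc A s := by
    intro x hx
    rw [← hkeys] at hx
    obtain ⟨l, r, rfl⟩ := hArr.2.1
    rwa [desc_root]
  set V := keys (pathTree T s) with hV
  have hgain : ∀ x ∈ V, x ≠ s → ∀ Y : Finset ℕ,
      (∀ y ∈ Y, y ∈ V ∧ y ≠ x ∧ y ∈ desc A x ∧ y ∉ desc (pathTree T s) x) → Y.card ≤ d' := by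
    intro x hx hxs Y hY
    refine (Finset.card_le_card fun y hy => ?_).trans (Nat.le_floor (hb x hx hxs))
    obtain ⟨h1, h2, h3, h4⟩ := hY y hy
    rw [gainedDescendants, Finset.mem_filter, mem_ancestors (hkeys ▸ h1), mem_ancestors h1]
    exact ⟨h1, ⟨h2.symm, h3⟩, fun h => h4 h.2⟩
  have hn : (V.card : ℝ) = (searchPath T s).length := by
    rw [hV, card_keys (isBST_pathTree hT s), length_searchPath]
  set κ := (1 / 2 - e) * V.card + c with hκ
  have hκ0 : 0 ≤ κ := by
    have : 0 ≤ (1 / 2 - e) * (V.card : ℝ) := mul_nonneg (by linarith) (by positivity)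
    linarith
  have hkept : ∀ r ∈ V, ∀ Y : Finset ℕ,
      (∀ x ∈ Y, x ∈ V ∧ x ≠ r ∧ r ∈ desc A x ∧ r ∈ desc (pathTree T s) x) →
      (Y.card : ℝ) ≤ κ := by
    intro r hr Y hY
    have h1 := ha r hr
    have hsub : Y ∪ lostAncestors (pathTree T s) A r ⊆ ancestors (pathTree T s) r := by
      intro x hx
      rcases Finset.mem_union.1 hx with hx | hx
      · obtain ⟨_, h2, _, h4⟩ := hY x hx
        exact (mem_ancestors hr).2 ⟨h2, h4⟩
      · exact (Finset.mem_sdiff.1 hx).1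
    have hdis : Disjoint Y (lostAncestors (pathTree T s) A r) := by
      rw [Finset.disjoint_left]
      intro x hx hx'
      obtain ⟨_, h2, h3, _⟩ := hY x hx
      exact (Finset.mem_sdiff.1 hx').2 ((mem_ancestors (hkeys ▸ hr)).2 ⟨h2, h3⟩)
    have h2 := Finset.card_le_card hsub
    rw [Finset.card_union_of_disjoint hdis] at h2
    have h3 : (Y.card : ℝ) + (lostAncestors (pathTree T s) A r).card ≤
        depth (pathTree T s) r := by
      rw [depth]; exact_mod_cast h2
    have h4 : depth (pathTree T s) r ≤ V.card := Finset.card_le_card fun x hx =>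
      searchPath_subset_keys _ r x (by
        rw [ancestors, Finset.mem_erase, List.mem_toFinset] at hx
        exact hx.2)
    have h5 : (depth (pathTree T s) r : ℝ) ≤ V.card := by exact_mod_cast h4
    have h6 : (0 : ℝ) ≤ depth (pathTree T s) r := by positivity
    nlinarith
  have hpr := hArr.isPathRearrangement hT hs (D := d')
    (fun x hx _ Y hY => sideDepth_le_of_gained hP hA hsP hgain hx hY)
    (fun x hx _ Y hY => sideDepth_le_of_gained (α := ℕᵒᵈ) hP.dual hA.dual hsP hgain hx hY)
  set Z := V.filter fun x => ∀ y ∈ desc A x, y = x with hZ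
  have hr := card_right_le_of_depthHalving hP hA hsV hsP hsA hgain hκ0 hkept
    (R := V.filter fun x => s < x) (Z := Z.filter fun x => s < x)
    (fun x hx => Finset.mem_filter.1 hx)
    (fun x hx h1 h2 => Finset.mem_filter.2 ⟨Finset.mem_filter.2 ⟨hx, h2⟩, h1⟩)
  have hl := card_left_le_of_depthHalving hP hA hsV hsP hsA hgain hκ0 hkept
    (R := V.filter fun x => x < s) (Z := Z.filter fun x => x < s)
    (fun x hx => Finset.mem_filter.1 hx)
    (fun x hx h1 h2 => Finset.mem_filter.2 ⟨Finset.mem_filter.2 ⟨hx, h2⟩, h1⟩)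
  have hsum : ((Z.filter fun x => s < x).card : ℝ) + (Z.filter fun x => x < s).card ≤ Z.card := by
    rw [← Nat.cast_add, Nat.cast_le, ← Finset.card_union_of_disjoint]
    · exact Finset.card_le_card (Finset.union_subset (Finset.filter_subset _ _)
        (Finset.filter_subset _ _))
    · rw [Finset.disjoint_left]
      intro x hx hx'
      exact lt_asymm (Finset.mem_filter.1 hx).2 (Finset.mem_filter.1 hx').2
  have hVc : (V.card : ℝ) ≤ 1 + (V.filter fun x => s < x).card +
      (V.filter fun x => x < s).card := by
    have : V ⊆ insert s ((V.filter fun a => s < a) ∪ V.filter fun a => a < s) := by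
      intro x hx
      simp only [Finset.mem_insert, Finset.mem_union, Finset.mem_filter]
      rcases lt_trichotomy s x with h | h | h
      · exact Or.inr (Or.inl ⟨hx, h⟩)
      · exact Or.inl h.symm
      · exact Or.inr (Or.inr ⟨hx, h⟩)
    have h1 := (Finset.card_le_card this).trans ((Finset.card_insert_le _ _).trans
      (Nat.add_le_add_right (Finset.card_union_le _ _) 1))
    have h2 : (V.card : ℝ) ≤ _ := Nat.cast_le.2 h1
    push_cast at h2
    linarith
  have hmain := hMb hpr hw (Z := Z) (fun x hx => by
    obtain ⟨h1, h2⟩ := Finset.mem_filter.1 hx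
    exact ⟨h1, fun y hy hyx => h2 y ((hArr.mem_desc_iff hT h1 hy).1 hyx)⟩)
  rw [← hArr.potential_sub hT w] at hmain
  rw [weight, logb_div_eq hw hs, ← hn]
  have hL := hpr.logWeight_singleton_le hw
  set L := logWeight w (keys T) - logWeight w {s} with hLd
  have hL0 : 0 ≤ L := by linarith
  have h7 : 2 * e * V.card ≤ d' * Z.card + (2 * c + 3) := by
    have : (d' : ℝ) * ((Z.filter fun x => s < x).card + (Z.filter fun x => x < s).card) ≤
      d' * Z.card := by gcongr
    nlinarith
  have h8 : (V.card : ℝ) ≤ d' / (2 * e) * Z.card + (2 * c + 3) / (2 * e) := by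
    rw [div_mul_eq_mul_div, ← add_div, le_div_iff₀ (by positivity)]
    linarith
  have h9 : 0 ≤ (2 * c + 3) / (2 * e) * L := by positivity
  linarith

/-! ### Local decompositions -/

/-- The descendant orders `N 0, …, N k` occurring in a local decomposition of a path ending in `s`
into a tree with root `s`. The window of step `i` is `V i`, its bottom is `b i`. -/
structure LocalSystem {α : Type*} [LinearOrder α] (K : Finset α) (s : α) (k w : ℕ)
    (N : ℕ → α → Finset α) (V : ℕ → Finset α) (b : ℕ → α) : Prop where
  tree : ∀ i ≤ k, IsTreeOrder K (N i)
  mem : s ∈ K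
  path : ∀ x ∈ K, s ∈ N 0 x
  root : ∀ x ∈ K, x ∈ N k s
  unchanged : ∀ i < k, ∀ x ∈ K, x ∉ V i → N (i + 1) x = N i x
  window_path : ∀ i < k, ∃ r ∈ K, ∀ x, x ∈ V i ↔ x ∈ N i r ∧ b i ∈ N i x
  bottom_mem : ∀ i < k, b i ∈ V i
  window_tree : ∀ i < k, ∃ t : α → Finset α, IsTreeOrder (V i) t ∧
    ∀ x ∈ V i, ∀ y ∈ V i, y ∈ N (i + 1) x ↔ y ∈ t x
  start : 0 < k → s ∈ V 0
  progress : ∀ i, i + 1 < k → ∃ x ∈ V (i + 1), x ∉ V i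
  overlap : ∀ i, i + 1 < k → ∃ x ∈ V (i + 1), x ∈ V i
  noRevisit : ∀ i j, i + 1 < j → j < k → ∀ x ∈ V i, x ∉ V (i + 1) → x ∉ V j
  window : ∀ i < k, (V i).card ≤ w

/-- `x` belongs to one of the windows of the steps before step `i`. -/
def Seen {α : Type*} (V : ℕ → Finset α) (i : ℕ) (x : α) : Prop := ∃ j < i, x ∈ V j

theorem exists_drop {α : Type*} {V : ℕ → Finset α} {x : α} {l j : ℕ} (hlj : l ≤ j) (hl : x ∈ V l)
    (hj : x ∉ V j) : ∃ i, l ≤ i ∧ i < j ∧ x ∈ V i ∧ x ∉ V (i + 1) := by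
  induction j, hlj using Nat.le_induction with
  | base => exact absurd hl hj
  | succ j hlj ih =>
    by_cases h : x ∈ V j
    · exact ⟨j, hlj, j.lt_succ_self, h, hj⟩
    · obtain ⟨i, h1, h2, h3⟩ := ih h
      exact ⟨i, h1, h2.trans j.lt_succ_self, h3⟩

namespace LocalSystem

variable {α : Type*} [LinearOrder α] {K : Finset α} {s : α} {k w : ℕ}
    {N : ℕ → α → Finset α} {V : ℕ → Finset α} {b : ℕ → α}

theorem dual (h : LocalSystem K s k w N V b) : LocalSystem (α := αᵒᵈ) K s k w N V b where
  tree i hi := (h.tree i hi).dual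
  mem := h.mem
  path := h.path
  root := h.root
  unchanged := h.unchanged
  window_path := h.window_path
  bottom_mem := h.bottom_mem
  window_tree i hi := by
    obtain ⟨t, ht, h'⟩ := h.window_tree i hi
    exact ⟨t, ht.dual, h'⟩
  start := h.start
  progress := h.progress
  overlap := h.overlap
  noRevisit := h.noRevisit
  window := h.window

theorem window_subset (h : LocalSystem K s k w N V b) {i : ℕ} (hi : i < k) {x : α} (hx : x ∈ V i) :
    x ∈ K := by
  obtain ⟨r, hr, hV⟩ := h.window_path i hi
  exact (h.tree i hi.le).subset r hr x ((hV x).1 hx).1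

theorem bottom_mem_desc (h : LocalSystem K s k w N V b) {i : ℕ} (hi : i < k) {x : α}
    (hx : x ∈ V i) : b i ∈ N i x := by
  obtain ⟨r, hr, hV⟩ := h.window_path i hi
  exact ((hV x).1 hx).2

theorem eq_bottom (h : LocalSystem K s k w N V b) {i : ℕ} (hi : i < k) {x : α}
    (hx : x ∈ V i) (hxb : x ∈ N i (b i)) : x = b i :=
  (h.tree i hi.le).antisymm x (h.window_subset hi hx) _ (h.bottom_mem_desc hi hx) hxb

theorem desc_eq_of_not_seen (h : LocalSystem K s k w N V b) {i : ℕ} (hi : i ≤ k) {x : α}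
    (hx : x ∈ K) (hs : ¬ Seen V i x) : N i x = N 0 x := by
  induction i with
  | zero => rfl
  | succ i ih =>
    rw [h.unchanged i hi x hx fun hV => hs ⟨i, i.lt_succ_self, hV⟩]
    exact ih (by omega) fun ⟨j, hj, hV⟩ => hs ⟨j, by omega, hV⟩

/-- An element once dropped never returns, so an element already seen that is in the window now was
also in the preceding one. -/
theorem mem_prev_of_seen (h : LocalSystem K s k w N V b) {i : ℕ} (hi : i + 1 < k) {x : α}
    (hx : x ∈ V (i + 1)) (hs : Seen V (i + 1) x) : x ∈ V i := by
  by_contra hxi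
  obtain ⟨j, hj, hxj⟩ := hs
  obtain ⟨l, _, h2, h3, h4⟩ := exists_drop (by omega) hxj hxi
  exact h.noRevisit l (i + 1) (by omega) hi x h3 h4 hx

/-- The seen elements form a lower end of the original path: each window contains a seen element or
`s`, and the nodes below its unseen nodes are either seen already or themselves in the window. -/
theorem seen_closed (h : LocalSystem K s k w N V b) {i : ℕ} (hi : i ≤ k) :
    ∀ x ∈ K, Seen V i x → ∀ y ∈ N 0 x, Seen V i y := by
  induction i with
  | zero => rintro x _ ⟨j, hj, _⟩; omega
  | succ i ih =>
    have ih := ih (by omega)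
    have hik : i < k := hi
    intro x hx hsx y hy
    have t0 := h.tree 0 (Nat.zero_le _)
    have ti := h.tree i hik.le
    have hyK := t0.subset x hx y hy
    have mono : ∀ z, Seen V i z → Seen V (i + 1) z := fun z ⟨j, hj, hz⟩ => ⟨j, by omega, hz⟩
    by_cases hxi : Seen V i x
    · exact mono y (ih x hx hxi y hy)
    by_cases hyi : Seen V i y
    · exact mono y hyi
    have hxV : x ∈ V i := by
      obtain ⟨j, hj, hxj⟩ := hsx
      rcases Nat.lt_succ_iff_lt_or_eq.1 hj with hj | rfl
      · exact absurd ⟨j, hj, hxj⟩ hxi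
      · exact hxj
    refine ⟨i, i.lt_succ_self, ?_⟩
    obtain ⟨r, hr, hV⟩ := h.window_path i hik
    rw [hV]
    have hyx : y ∈ N i x := by rwa [h.desc_eq_of_not_seen hik.le hx hxi]
    refine ⟨ti.trans r hr x ((hV x).1 hxV).1 y hyx, ?_⟩
    cases i with
    | zero =>
      -- The first window contains `s`, the lowest node of the path, so `s` is its bottom.
      have hb : b 0 ∈ N 0 s := h.bottom_mem_desc hik (h.start hik)
      have hbs : s = b 0 := t0.antisymm s h.mem _ hb (h.path _ (t0.subset s h.mem _ hb))
      rw [← hbs]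
      exact h.path y hyK
    | succ i' =>
      -- `c` is a seen element of the window; the unseen `y` lies above it, hence above the bottom
      -- as well.
      obtain ⟨c, hc, hc'⟩ := h.overlap i' hik
      have hcK := h.window_subset hik hc
      have hcy : c ∈ N 0 y := by
        rcases t0.chain c hcK y hyK s (h.path c hcK) (h.path y hyK) with h1 | h1
        · exact absurd (ih c hcK ⟨i', i'.lt_succ_self, hc'⟩ y h1) hyi
        · exact h1
      rw [← h.desc_eq_of_not_seen hik.le hyK hyi] at hcy
      exact ti.trans y hyK c hcy _ (h.bottom_mem_desc hik hc)

theorem mem_desc_of_seen (h : LocalSystem K s k w N V b) {i : ℕ} (hi : i ≤ k) {x y : α}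
    (hx : x ∈ K) (hy : y ∈ K) (hsx : ¬ Seen V i x) (hsy : Seen V i y) : y ∈ N 0 x := by
  rcases (h.tree 0 (Nat.zero_le _)).chain x hx y hy s (h.path x hx) (h.path y hy) with h1 | h1
  · exact h1
  · exact absurd (h.seen_closed hi y hy hsy x h1) hsx

theorem seen_of_mem_desc (h : LocalSystem K s k w N V b) {i : ℕ} (hi : i ≤ k) {x y : α}
    (hx : x ∈ K) (hsx : Seen V i x) (hy : y ∈ N i x) : Seen V i y := by
  by_contra hsy
  have hyK := (h.tree i hi).subset x hx y hy
  have h1 := h.mem_desc_of_seen hi hyK hx hsy hsx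
  rw [← h.desc_eq_of_not_seen hi hyK hsy] at h1
  exact hsy ((h.tree i hi).antisymm x hx y hy h1 ▸ hsx)

theorem seen_all (h : LocalSystem K s k w N V b) (hk : 0 < k) {x : α} (hx : x ∈ K) :
    Seen V k x := by
  by_contra hsx
  have h1 := h.path x hx
  rw [← h.desc_eq_of_not_seen le_rfl hx hsx] at h1
  have := (h.tree k le_rfl).antisymm x hx s h1 (h.root x hx)
  exact hsx (this ▸ ⟨0, hk, h.start hk⟩)

theorem dropped_notMem (h : LocalSystem K s k w N V b) {i j : ℕ} (hij : i < j) (hj : j < k) {x : α}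
    (hx : x ∈ V i) (hx' : x ∉ V (i + 1)) : x ∉ V j := by
  rcases Nat.lt_or_eq_of_le (Nat.succ_le_of_lt hij) with h1 | rfl
  · exact h.noRevisit i j h1 hj x hx hx'
  · exact hx'

theorem dropped_desc (h : LocalSystem K s k w N V b) {i j : ℕ} (hij : i < j) (hj : j ≤ k) {x : α}
    (hx : x ∈ V i) (hx' : x ∉ V (i + 1)) : N j x = N (i + 1) x := by
  induction j, (Nat.succ_le_of_lt hij) using Nat.le_induction with
  | base => rfl
  | succ j hij' ih =>
    rw [h.unchanged j hj x (h.window_subset (by omega) hx)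
      (h.dropped_notMem hij' hj hx hx')]
    exact ih hij' (by omega)

theorem exists_entering (h : LocalSystem K s k w N V b) {i : ℕ} (hi : i + 1 < k) :
    ∃ u ∈ V (i + 1), ¬ Seen V (i + 1) u := by
  obtain ⟨u, hu, hu'⟩ := h.progress i hi
  exact ⟨u, hu, fun hs => hu' (h.mem_prev_of_seen hi hu hs)⟩

/-- If the subtree of a dropped `x` met a later window, `x` and the root of that window would be
comparable. With `x` below the root, `x` would lie on the window path; with `x` above it, an unseen
element entering some window would lie below the seen `x`. -/
theorem dropped_disjoint (h : LocalSystem K s k w N V b) {i j : ℕ} (hij : i < j) (hj : j < k)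
    {x y : α} (hx : x ∈ V i) (hx' : x ∉ V (i + 1)) (hy : y ∈ V j) : y ∉ N (i + 1) x := by
  rw [← h.dropped_desc hij hj.le hx hx']
  intro hyx
  have tj := h.tree j hj.le
  have hxK := h.window_subset (hij.trans hj) hx
  obtain ⟨r, hr, hV⟩ := h.window_path j hj
  rcases tj.chain r hr x hxK y ((hV y).1 hy).1 hyx with h1 | h1
  · exact h.dropped_notMem hij hj hx hx'
      ((hV x).2 ⟨h1, tj.trans x hxK y hyx _ ((hV y).1 hy).2⟩)
  · obtain ⟨j, rfl⟩ : ∃ j', j = j' + 1 := ⟨j - 1, by omega⟩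
    obtain ⟨u, hu, hus⟩ := h.exists_entering hj
    have huK := h.window_subset hj hu
    have hux : u ∈ N (j + 1) x := tj.trans x hxK r h1 u ((hV u).1 hu).1
    exact hus (h.seen_of_mem_desc hj.le hxK ⟨i, hij, hx⟩ hux)

/-- Every element gains at most as many ancestors as the windows have elements. -/
theorem card_gained_le (h : LocalSystem K s k w N V b) {x : α} (hx : x ∈ K) {Y : Finset α}
    (hY : ∀ y ∈ Y, y ∈ N 0 x ∧ y ≠ x ∧ x ∈ N k y) : Y.card ≤ w := by
  have t0 := h.tree 0 (Nat.zero_le _)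
  rcases Nat.eq_zero_or_pos k with rfl | hk
  · rcases Y.eq_empty_or_nonempty with rfl | ⟨y, hy⟩
    · simp
    · obtain ⟨h1, h2, h3⟩ := hY y hy
      exact absurd (t0.antisymm x hx y h1 h3).symm h2
  obtain ⟨j, hj, hxj⟩ := h.seen_all hk hx
  -- Any window containing `x` contains all of `Y`: an element below `x` on the path is seen by
  -- then, and had it been dropped earlier, its final subtree would avoid this window and hence `x`.
  refine (Finset.card_le_card fun y hy => ?_).trans (h.window j hj)
  obtain ⟨h1, h2, h3⟩ := hY y hy
  by_contra hyj
  obtain ⟨l, hl, hyl⟩ := h.seen_closed (i := j + 1) hj x hx ⟨j, j.lt_succ_self, hxj⟩ y h1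
  obtain ⟨i, _, h5, h6, h7⟩ := exists_drop (by omega) hyl hyj
  refine h.dropped_disjoint h5 hj h6 h7 hxj ?_
  rwa [← h.dropped_desc (h5.trans hj) le_rfl h6 h7]

/-- The bottom lies below a seen element of its window, so it is seen, and hence it was in the
preceding window. -/
theorem bottom_mem_prev (h : LocalSystem K s k w N V b) {i : ℕ} (hi : i + 1 < k) :
    b (i + 1) ∈ V i := by
  obtain ⟨c, hc, hc'⟩ := h.overlap i hi
  exact h.mem_prev_of_seen hi (h.bottom_mem _ hi) (h.seen_of_mem_desc hi.le
    (h.window_subset hi hc) ⟨i, i.lt_succ_self, hc'⟩ (h.bottom_mem_desc hi hc))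

/-! #### Runs of steps in which no leaf arises and all entering elements lie to the right -/

/-- `x` is a leaf of the tree into which the window of step `i` is rearranged. -/
def IsWindowLeaf (N : ℕ → α → Finset α) (V : ℕ → Finset α) (i : ℕ) (x : α) : Prop :=
  x ∈ V i ∧ ∀ y ∈ V i, y ∈ N (i + 1) x → y = x

/-- No leaf of the final tree leaves the window after step `i`, and all elements entering it
are larger than `s`. -/
structure RightGood (s : α) (N : ℕ → α → Finset α) (V : ℕ → Finset α) (i : ℕ) : Prop where
  enter : ∀ x ∈ V (i + 1), x ∉ V i → s < x
  drop : ∀ x ∈ V i, x ∉ V (i + 1) → ∃ y ∈ N (i + 1) x, y ≠ x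

open Classical in
/-- The elements of the window having a larger element among those that have left the window. -/
noncomputable def supply (V : ℕ → Finset α) (i : ℕ) : Finset α :=
  (V i).filter fun x => ∃ o, Seen V i o ∧ o ∉ V i ∧ x < o

theorem mem_supply {i : ℕ} {x : α} :
    x ∈ supply V i ↔ x ∈ V i ∧ ∃ o, Seen V i o ∧ o ∉ V i ∧ x < o := by
  simp [supply]

theorem exists_windowLeaf (h : LocalSystem K s k w N V b) {i : ℕ} (hi : i < k) {x : α}
    (hx : x ∈ V i) : ∃ y ∈ N (i + 1) x, IsWindowLeaf N V i y := by
  obtain ⟨t, ht, htN⟩ := h.window_tree i hi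
  obtain ⟨y, hy, hleaf⟩ := ht.exists_leaf hx
  have hyV := ht.subset x hx y hy
  exact ⟨y, (htN x hx y hyV).2 hy, hyV, fun z hz hzy => hleaf z ((htN y hyV z hz).1 hzy)⟩

/-- A dropped window leaf is not a leaf of the final tree, so something hangs below it; this has
been seen but is not in the window, so it was dropped before. -/
theorem exists_old_below (h : LocalSystem K s k w N V b) {i : ℕ} (hi : i + 1 < k)
    (hg : RightGood s N V i) {y : α} (hy : IsWindowLeaf N V i y) (hy' : y ∉ V (i + 1)) :
    ∃ o ∈ N (i + 1) y, Seen V i o ∧ o ∉ V i := by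
  obtain ⟨o, ho, hoy⟩ := hg.drop y hy.1 hy'
  have hoV : o ∉ V i := fun hV => hoy (hy.2 o hV ho)
  obtain ⟨j, hj, hjo⟩ := h.seen_of_mem_desc hi.le (h.window_subset (by omega) hy.1)
    ⟨i, i.lt_succ_self, hy.1⟩ ho
  rcases Nat.lt_succ_iff_lt_or_eq.1 hj with hj | rfl
  · exact ⟨o, ho, ⟨j, hj, hjo⟩, hoV⟩
  · exact absurd hjo hoV

theorem lt_of_entering (h : LocalSystem K s k w N V b) {i : ℕ} (hi : i < k)
    {x y : α} (hx : x ∈ V i) (hsx : s < x) (hns : ¬ Seen V i x) (hy : y ∈ K) (hys : Seen V i y) :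
    y < x := by
  have t0 := h.tree 0 (Nat.zero_le _)
  have hxK := h.window_subset hi hx
  have hyx := h.mem_desc_of_seen hi.le hxK hy hns hys
  by_contra! hle
  rcases hle.lt_or_eq with hlt | rfl
  · exact t0.notMem_of_path h.path hxK hsx hlt hyx
  · exact hns hys

theorem seen_mem (h : LocalSystem K s k w N V b) {i : ℕ} (hi : i ≤ k) {x : α} (hx : Seen V i x) :
    x ∈ K := by
  obtain ⟨j, hj, hxj⟩ := hx
  exact h.window_subset (hj.trans_le hi) hxj

/-- Entering elements exceed everything seen so far, so they do not join the supply. An element that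
leaves the window has an older dropped element below it that can replace it as a witness. -/
theorem supply_subset (h : LocalSystem K s k w N V b) {i : ℕ} (hi : i + 1 < k)
    (hg : RightGood s N V i) : supply V (i + 1) ⊆ supply V i := by
  intro x hx
  obtain ⟨hxV, o, hos, hoV, hxo⟩ := mem_supply.1 hx
  have hik : i < k := by omega
  have ti := h.tree (i + 1) hi.le
  have hxV' : x ∈ V i := by
    by_contra hxi
    have hns : ¬ Seen V (i + 1) x := fun hs => hxi (h.mem_prev_of_seen hi hxV hs)
    exact lt_asymm hxo (h.lt_of_entering hi hxV (hg.enter x hxV hxi) hns (h.seen_mem hi.le hos) hos)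
  by_cases hoi : o ∈ V i
  -- Here `o` has only just left. A window leaf `y` below it leaves too and covers an older `o'`. As
  -- `x` is outside the subtree of `o`, it cannot lie between `o'` and `o`, so `x < o'`.
  · obtain ⟨y, hyo, hyl⟩ := h.exists_windowLeaf hik hoi
    have hyV : y ∉ V (i + 1) := fun hy =>
      h.dropped_disjoint i.lt_succ_self hi hoi hoV hy hyo
    obtain ⟨o', ho', hs', hV'⟩ := h.exists_old_below hi hg hyl hyV
    have hoK := h.window_subset hik hoi
    have ho'o : o' ∈ N (i + 1) o := ti.trans o hoK y hyo o' ho'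
    refine mem_supply.2 ⟨hxV', o', hs', hV', ?_⟩
    by_contra! hle
    exact h.dropped_disjoint i.lt_succ_self hi hoi hoV hxV
      (ti.convex o hoK o' ho'o x (h.window_subset hi hxV) (Or.inr ⟨hle, hxo.le⟩))
  · obtain ⟨j, hj, hjo⟩ := hos
    rcases Nat.lt_succ_iff_lt_or_eq.1 hj with hj | rfl
    · exact mem_supply.2 ⟨hxV', o, ⟨j, hj, hjo⟩, hoi, hxo⟩
    · exact absurd hjo hoi

/-- A window leaf is not contained in the interval between another window leaf and its
descendants. -/
theorem lt_old_of_lt (h : LocalSystem K s k w N V b) {i : ℕ} (hi : i < k) {y z o : α}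
    (hy : IsWindowLeaf N V i y) (hz : z ∈ V i) (hzy : z < y) (ho : o ∈ N (i + 1) y) : z < o := by
  by_contra! hle
  exact hzy.ne (hy.2 z hz ((h.tree (i + 1) hi).convex y (h.window_subset hi hy.1) o ho z
    (h.window_subset hi hz) (Or.inr ⟨hle, hzy.le⟩)))

theorem old_lt_of_lt (h : LocalSystem K s k w N V b) {i : ℕ} (hi : i < k) {y z o : α}
    (hy : IsWindowLeaf N V i y) (hz : z ∈ V i) (hyz : y < z) (ho : o ∈ N (i + 1) y) : o < z :=
  h.dual.lt_old_of_lt hi hy hz hyz ho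

/-- The larger leaf covers an old element, which by convexity exceeds the smaller leaf. So the
smaller leaf belonged to the supply, and it has left. -/
theorem card_supply_lt_of_two_leaves (h : LocalSystem K s k w N V b) {i : ℕ} (hi : i + 1 < k)
    (hg : RightGood s N V i) {y₁ y₂ : α} (h₁ : IsWindowLeaf N V i y₁) (h₂ : IsWindowLeaf N V i y₂)
    (hne : y₁ ≠ y₂) (h₁' : y₁ ∉ V (i + 1)) (h₂' : y₂ ∉ V (i + 1)) :
    (supply V (i + 1)).card < (supply V i).card := by
  wlog hlt : y₁ < y₂ generalizing y₁ y₂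
  · exact this h₂ h₁ hne.symm h₂' h₁' (lt_of_le_of_ne (not_lt.1 hlt) hne.symm)
  obtain ⟨o, ho, hos, hoV⟩ := h.exists_old_below hi hg h₂ h₂'
  have hm : y₁ ∈ supply V i :=
    mem_supply.2 ⟨h₁.1, o, hos, hoV, h.lt_old_of_lt (by omega) h₂ h₁.1 hlt ho⟩
  exact Finset.card_lt_card ⟨h.supply_subset hi hg, fun hsub =>
    h₁' (mem_supply.1 (hsub hm)).1⟩

/-- A window leaf that stays in the window is its next bottom. -/
theorem eq_bottom_of_windowLeaf (h : LocalSystem K s k w N V b) {i : ℕ} (hi : i + 1 < k) {y : α}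
    (hy : IsWindowLeaf N V i y) (hy' : y ∈ V (i + 1)) : b (i + 1) = y :=
  hy.2 _ (h.bottom_mem_prev hi) (h.bottom_mem_desc hi hy')

/-- The bottom of the window of step `i + m` has a proper descendant among the elements touched by
the `m` steps before. -/
def BottomsCovered (k : ℕ) (N : ℕ → α → Finset α) (V : ℕ → Finset α) (b : ℕ → α) (m : ℕ) : Prop :=
  ∀ i, i + m < k → ∃ j < m, ∃ y ∈ V (i + j), y ≠ b (i + m) ∧ y ∈ N (i + m) (b (i + m))

/-- The bottom of a window and its neighbours in the window do not end up at the lower end of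
a path formed by the whole window. -/
def BottomsRaised (k : ℕ) (N : ℕ → α → Finset α) (V : ℕ → Finset α) (b : ℕ → α) : Prop :=
  ∀ i, i + 1 < k → ∀ y ∈ V i, (∀ z ∈ V i, ¬ (y < z ∧ z < b i ∨ b i < z ∧ z < y)) →
    ∃ x ∈ V i, y ∉ N (i + 1) x

theorem BottomsRaised.dual (h : BottomsRaised k N V b) : BottomsRaised (α := αᵒᵈ) k N V b :=
  fun i hi y hy hyz => h i hi y hy fun z hz hb => hyz z hz (hb.symm.imp And.symm And.symm)

/-- A window leaf that stays would be the next bottom, which is covered by an element of the same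
window; so both leaves leave. -/
theorem card_supply_lt_of_not_path (h : LocalSystem K s k w N V b) (hc : BottomsCovered k N V b 1)
    {i : ℕ} (hi : i + 1 < k) (hg : RightGood s N V i) {y₁ y₂ : α} (h₁ : IsWindowLeaf N V i y₁)
    (h₂ : IsWindowLeaf N V i y₂) (hne : y₁ ≠ y₂) :
    (supply V (i + 1)).card < (supply V i).card := by
  have key : ∀ y, IsWindowLeaf N V i y → y ∉ V (i + 1) := by
    intro y hy hy'
    have hb := h.eq_bottom_of_windowLeaf hi hy hy'
    obtain ⟨j, hj, z, hz, hzb, hzN⟩ := hc i hi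
    obtain rfl : j = 0 := by omega
    rw [hb] at hzb hzN
    exact hzb (hy.2 z hz hzN)
  exact h.card_supply_lt_of_two_leaves hi hg h₁ h₂ hne (key _ h₁) (key _ h₂)

/-- The element covered by a bottom, if the supply has been constant since it left the window,
is larger than all elements of the supply. -/
theorem exists_covered (h : LocalSystem K s k w N V b) {m : ℕ} (hc : BottomsCovered k N V b m)
    {a i : ℕ} (hai : a + m ≤ i) (hi : i < k)
    (hconst : ∀ j, a ≤ j → j ≤ i → supply V j = supply V a) :
    ∃ y ∈ N i (b i), y ≠ b i ∧ Seen V i y ∧ y ∉ V i ∧ ∀ z ∈ supply V a, z < y := by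
  obtain ⟨i, rfl⟩ : ∃ i', i = i' + m := ⟨i - m, by omega⟩
  obtain ⟨j, hj, y, hy, hyb, hyN⟩ := hc i hi
  have hyV : y ∉ V (i + m) := fun hV => hyb (h.eq_bottom hi hV hyN)
  refine ⟨y, hyN, hyb, ⟨i + j, by omega, hy⟩, hyV, fun z hz => ?_⟩
  obtain ⟨l, h1, h2, h3, h4⟩ := exists_drop (by omega) hy hyV
  rw [← hconst l (by omega) (by omega)] at hz
  obtain ⟨_, o, hos, hoV, hzo⟩ := mem_supply.1 hz
  have hys : y ∉ supply V l := by
    rw [hconst l (by omega) (by omega), ← hconst (l + 1) (by omega) (by omega)]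
    exact fun hy => h4 (mem_supply.1 hy).1
  have : ¬ y < o := fun hlt => hys (mem_supply.2 ⟨h3, o, hos, hoV, hlt⟩)
  exact hzo.trans_le (not_lt.1 this)

/-- A dropped element has a dropped window leaf `y` below it, which covers an old `o`. Constancy of
the supply makes `y` larger than all old elements and, via `exists_covered`, a neighbour of the
bottom. By `hr` the window tree then has a second leaf. If that leaf is dropped too, the supply
shrinks; if it stays, it is the next bottom, and the element it covers has no possible position. -/
theorem window_subset_of_supply_const (h : LocalSystem K s k w N V b) {m : ℕ}
    (hc : BottomsCovered k N V b m) (hr : BottomsRaised k N V b) {a i : ℕ} (hai : a + m ≤ i)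
    (hi : i + 1 < k) (hg : RightGood s N V i)
    (hconst : ∀ j, a ≤ j → j ≤ i + 1 → supply V j = supply V a) : V i ⊆ V (i + 1) := by
  intro x hx
  by_contra hx'
  have hik : i < k := by omega
  obtain ⟨y, hyx, hyl⟩ := h.exists_windowLeaf hik hx
  have hyV : y ∉ V (i + 1) := fun hy =>
    h.dropped_disjoint i.lt_succ_self hi hx hx' hy hyx
  obtain ⟨o, ho, hos, hoV⟩ := h.exists_old_below hi hg hyl hyV
  have hsup : supply V i = supply V (i + 1) :=
    (hconst i (by omega) (by omega)).trans (hconst (i + 1) (by omega) le_rfl).symm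
  have hys : y ∉ supply V i := by
    rw [hsup]
    exact fun hy => hyV (mem_supply.1 hy).1
  have hold : ∀ o', Seen V i o' → o' ∉ V i → o' < y := fun o' h1 h2 => by
    by_contra! hle
    rcases hle.lt_or_eq with hlt | rfl
    · exact hys (mem_supply.2 ⟨hyl.1, o', h1, h2, hlt⟩)
    · exact h2 hyl.1
  have hin : ∀ z ∈ V i, z < o → z ∈ supply V a := fun z hz hzo => by
    rw [← hconst i (by omega) (by omega)]
    exact mem_supply.2 ⟨hz, o, hos, hoV, hzo⟩
  -- `y` is a neighbour of the bottom of the window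
  have hnb : ∀ z ∈ V i, ¬ (y < z ∧ z < b i ∨ b i < z ∧ z < y) := by
    obtain ⟨y', hy'N, hy'b, hy's, hy'V, hy'sup⟩ :=
      h.exists_covered hc hai hik fun j h1 h2 => hconst j h1 (by omega)
    have ti := h.tree i hik.le
    have hbK := h.window_subset hik (h.bottom_mem i hik)
    have hconv : ∀ z ∈ V i, (b i ≤ z ∧ z ≤ y' ∨ y' ≤ z ∧ z ≤ b i) → z = b i := fun z hz hb =>
      h.eq_bottom hik hz (ti.convex _ hbK y' hy'N z (h.window_subset hik hz) hb)
    have hy'y := hold y' hy's hy'V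
    rintro z hz (⟨h1, h2⟩ | ⟨h1, h2⟩)
    · exact h2.ne (hconv z hz (Or.inr ⟨(hy'y.trans h1).le, h2.le⟩))
    · have hy'z : y' < z := by
        by_contra! hle
        exact h1.ne' (hconv z hz (Or.inl ⟨h1.le, hle⟩))
      exact lt_asymm hy'z (hy'sup z (hin z hz (h.lt_old_of_lt hik hyl hz h2 ho)))
  obtain ⟨x', hx'V, hyx'⟩ := hr i hi y hyl.1 hnb
  obtain ⟨y₂, hy₂x', hy₂l⟩ := h.exists_windowLeaf hik hx'V
  have hne : y₂ ≠ y := fun he => hyx' (he ▸ hy₂x')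
  by_cases hy₂V : y₂ ∈ V (i + 1)
  · have hb := h.eq_bottom_of_windowLeaf hi hy₂l hy₂V
    obtain ⟨y', hy'N, hy'b, hy's, hy'V, hy'sup⟩ :=
      h.exists_covered hc (a := a) (i := i + 1) (by omega) hi hconst
    rw [hb] at hy'N hy'b
    have hy'i : y' ∉ V i := fun hV => hy'b (hy₂l.2 y' hV hy'N)
    have hy's' : Seen V i y' := by
      obtain ⟨j, hj, hjo⟩ := hy's
      rcases Nat.lt_succ_iff_lt_or_eq.1 hj with hj | rfl
      · exact ⟨j, hj, hjo⟩
      · exact absurd hjo hy'i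
    rcases lt_or_gt_of_ne hne with hlt | hlt
    -- The common ancestor `z` of the two leaves lies strictly between them. It is in the supply,
    -- since `z < o`, and hence smaller than `y'`; but `y'` lies below the smaller leaf, so `y' <
    -- z`.
    · obtain ⟨t, ht, htN⟩ := h.window_tree i hik
      obtain ⟨z, hz, hb, hz₂, hzy⟩ := ht.lca y₂ hy₂l.1 y hyl.1
      have hb' : y₂ ≤ z ∧ z ≤ y := by
        rcases hb with hb | hb
        · exact hb
        · exact absurd (hb.1.trans hb.2) hlt.not_ge
      have hz1 : z ≠ y₂ := fun he => by
        subst he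
        exact hne.symm (hy₂l.2 y hyl.1 ((htN _ hz y hyl.1).2 hzy))
      have hz2 : z ≠ y := fun he => by
        subst he
        exact hne (hyl.2 y₂ hy₂l.1 ((htN _ hz y₂ hy₂l.1).2 hz₂))
      have hyz : y' < z := h.old_lt_of_lt hik hy₂l hz (lt_of_le_of_ne hb'.1 hz1.symm) hy'N
      exact lt_asymm hyz (hy'sup z (hin z hz
        (h.lt_old_of_lt hik hyl hz (lt_of_le_of_ne hb'.2 hz2) ho)))
    · exact lt_asymm (hold y' hy's' hy'i) (h.lt_old_of_lt hik hy₂l hyl.1 hlt hy'N)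
  · have := h.card_supply_lt_of_two_leaves hi hg hy₂l hyl hne hy₂V hyV
    rw [hsup] at this
    exact lt_irrefl _ this

/-- If the supply were constant, no element would leave the window during the last `m` steps. But
the bottom of window `a + 2 * m` covers an element touched in these steps, and a proper descendant
of the bottom is outside the window. -/
theorem card_supply_lt_of_raised (h : LocalSystem K s k w N V b) {m : ℕ}
    (hc : BottomsCovered k N V b m) (hr : BottomsRaised k N V b) {a : ℕ} (ha : a + 2 * m < k)
    (hg : ∀ i, a ≤ i → i < a + 2 * m → RightGood s N V i) :
    (supply V (a + 2 * m)).card < (supply V a).card := by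
  have hmono : ∀ i j, a ≤ i → i ≤ j → j ≤ a + 2 * m → supply V j ⊆ supply V i := by
    intro i j hai hij
    induction j, hij using Nat.le_induction with
    | base => exact fun _ => subset_rfl
    | succ j hij ih =>
      intro hj
      exact (h.supply_subset (by omega) (hg j (by omega) (by omega))).trans (ih (by omega))
  by_contra! hle
  have heq := Finset.eq_of_subset_of_card_le (hmono a (a + 2 * m) le_rfl (by omega) le_rfl) hle
  have hconst : ∀ j, a ≤ j → j ≤ a + 2 * m → supply V j = supply V a := fun j h1 h2 =>
    (hmono a j le_rfl h1 h2).antisymm (heq ▸ hmono j (a + 2 * m) h1 h2 le_rfl)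
  have hsub : ∀ i, a + m ≤ i → i < a + 2 * m → V i ⊆ V (i + 1) := fun i h1 h2 =>
    h.window_subset_of_supply_const hc hr h1 (by omega) (hg i (by omega) h2)
      fun j h3 h4 => hconst j h3 (by omega)
  obtain ⟨j, hj, y, hy, hyb, hyN⟩ := hc (a + m) (by omega)
  have e : a + m + m = a + 2 * m := by omega
  have hyV : y ∉ V (a + m + m) := fun hV => hyb (h.eq_bottom (by omega) hV hyN)
  obtain ⟨l, h1, h2, h3, h4⟩ := exists_drop (by omega) hy hyV
  exact h4 (hsub l (by omega) (by omega) h3)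

end LocalSystem

/-! ### Counting the steps of a local decomposition -/

/-- If `e` decreases the potential `q ≤ w` over each stretch of `L` steps without a bad step, then
the total of `e` is bounded by the number of bad steps. -/
theorem sum_le_of_potential {n L w : ℕ} {e q : ℕ → ℕ} {bad : Finset ℕ}
    (hq : ∀ i < L, q i ≤ w)
    (h : ∀ i < n, e i + q (i + L) ≤ q i + (w + 1) * ∑ j ∈ Finset.range L,
      if i + j ∈ bad then 1 else 0) :
    ∑ i ∈ Finset.range n, e i ≤ L * w + (w + 1) * (L * bad.card) := by
  -- In the summed hypothesis the terms of `q` cancel except for the first `L`, and every bad step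
  -- is counted in at most `L` stretches.
  have h1 : ∑ i ∈ Finset.range n, e i + ∑ i ∈ Finset.range n, q (i + L) ≤
      ∑ i ∈ Finset.range n, q i + (w + 1) * ∑ i ∈ Finset.range n, ∑ j ∈ Finset.range L,
        if i + j ∈ bad then 1 else 0 := by
    rw [← Finset.sum_add_distrib, Finset.mul_sum, ← Finset.sum_add_distrib]
    exact Finset.sum_le_sum fun i hi => h i (Finset.mem_range.1 hi)
  have h2 : ∑ i ∈ Finset.range n, q i ≤ L * w + ∑ i ∈ Finset.range n, q (i + L) := by
    calc ∑ i ∈ Finset.range n, q i ≤ ∑ i ∈ Finset.range (L + n), q i :=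
          Finset.sum_le_sum_of_subset (Finset.range_subset_range.2 (by omega))
      _ = ∑ i ∈ Finset.range L, q i + ∑ i ∈ Finset.range n, q (i + L) := by
          rw [Finset.sum_range_add]
          simp only [add_comm]
      _ ≤ _ := by
          gcongr
          calc _ ≤ ∑ i ∈ Finset.range L, w :=
                Finset.sum_le_sum fun i hi => hq i (Finset.mem_range.1 hi)
            _ = L * w := by simp
  have h3 : ∑ i ∈ Finset.range n, ∑ j ∈ Finset.range L, (if i + j ∈ bad then 1 else 0) ≤
      L * bad.card := by
    rw [Finset.sum_comm]
    calc _ ≤ ∑ j ∈ Finset.range L, bad.card := by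
          refine Finset.sum_le_sum fun j _ => ?_
          rw [← Finset.card_filter]
          exact Finset.card_le_card_of_injOn (fun i => i + j)
            (fun i hi => (Finset.mem_filter.1 hi).2) (fun _ _ _ _ h => by simpa using h)
      _ = L * bad.card := by simp
  have := Nat.mul_le_mul_left (w + 1) h3
  omega

/-! ### Existence of zigzags where a path changes sides -/

section Zigzag

variable {α : Type*} [LinearOrder α] {K : Finset α} {s : α} {N : α → Finset α}

open Classical in
/-- The elements larger than `s` of a path ending in `s` whose child is smaller than `s`. -/
noncomputable def zigzags (K : Finset α) (s : α) (N : α → Finset α) : Finset α :=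
  K.filter fun u => s < u ∧ ∃ v ∈ K, v < s ∧ v ∈ N u ∧ ∀ y ∈ N u, y ≠ u → y ∈ N v

theorem mem_zigzags {u : α} : u ∈ zigzags K s N ↔
    u ∈ K ∧ s < u ∧ ∃ v ∈ K, v < s ∧ v ∈ N u ∧ ∀ y ∈ N u, y ≠ u → y ∈ N v := by
  simp [zigzags]

/-- Take `u` to be the lowest node larger than `s` that is still above `x`. Its child on the path
cannot be `s`, as it has `x` below it, nor larger than `s`, by the choice of `u`. -/
theorem exists_zigzag (hN : IsTreeOrder K N) (hs : s ∈ K) (hp : ∀ x ∈ K, s ∈ N x) {x y : α}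
    (hx : x < s) (hy : s < y) (hyK : y ∈ K) (hxy : x ∈ N y) :
    ∃ u ∈ zigzags K s N, u ∈ N y ∧ x ∈ N u := by
  classical
  have hne : (K.filter fun u => s < u ∧ x ∈ N u).Nonempty :=
    ⟨y, Finset.mem_filter.2 ⟨hyK, hy, hxy⟩⟩
  have hsub : ∀ a ∈ K, ∀ c ∈ N a, N c ⊆ N a := fun a ha c hc t ht => hN.trans a ha c hc t ht
  obtain ⟨u, hu, hmin⟩ := Finset.exists_min_image _ (fun u => (N u).card) hne
  obtain ⟨huK, hsu, hxu⟩ := Finset.mem_filter.1 hu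
  have huy : u ∈ N y := by
    rcases hN.chain y hyK u huK s (hp y hyK) (hp u huK) with h | h
    · exact h
    · have := Finset.eq_of_subset_of_card_le (hsub u huK y h)
        (hmin y (Finset.mem_filter.2 ⟨hyK, hy, hxy⟩))
      rw [this]
      exact hN.self_mem u huK
  have hxu' : x ≠ u := (hx.trans hsu).ne
  obtain ⟨v, hv, hmax⟩ := Finset.exists_max_image ((N u).erase u) (fun v => (N v).card)
    ⟨x, Finset.mem_erase.2 ⟨hxu', hxu⟩⟩
  obtain ⟨hvu, hvN⟩ := Finset.mem_erase.1 hv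
  have hvK := hN.subset u huK v hvN
  have hnext : ∀ t ∈ N u, t ≠ u → t ∈ N v := by
    intro t ht htu
    have htK := hN.subset u huK t ht
    rcases hN.chain v hvK t htK s (hp v hvK) (hp t htK) with h | h
    · exact h
    · have := Finset.eq_of_subset_of_card_le (hsub t htK v h)
        (hmax t (Finset.mem_erase.2 ⟨htu, ht⟩))
      rw [this]
      exact hN.self_mem t htK
  have hxv := hnext x hxu hxu'
  refine ⟨u, mem_zigzags.2 ⟨huK, hsu, v, hvK, ?_, hvN, hnext⟩, huy, hxu⟩
  rcases lt_trichotomy v s with h | rfl | h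
  · exact h
  · exact absurd (hN.antisymm v hvK x hxv (hp x (hN.subset v hvK x hxv))) hx.ne'
  · have h1 := Finset.eq_of_subset_of_card_le (hsub u huK v hvN)
      (hmin v (Finset.mem_filter.2 ⟨hvK, h, hxv⟩))
    exact absurd (hN.antisymm u huK v hvN (h1 ▸ hN.self_mem u huK)).symm hvu

end Zigzag

/-! ### Charging steps to leaves and zigzags -/

namespace LocalSystem

variable {α : Type*} [LinearOrder α] {K : Finset α} {s : α} {k w : ℕ}
    {N : ℕ → α → Finset α} {V : ℕ → Finset α} {b : ℕ → α}

/-- All elements entering the window after step `i` are larger than `s`. -/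
def EntersRight (s : α) (V : ℕ → Finset α) (i : ℕ) : Prop :=
  ∀ x ∈ V (i + 1), x ∉ V i → s < x

/-- All elements entering the window after step `i` are smaller than `s`. -/
def EntersLeft (s : α) (V : ℕ → Finset α) (i : ℕ) : Prop :=
  ∀ x ∈ V (i + 1), x ∉ V i → x < s

/-- A leaf of the final tree leaves the window after step `i`. -/
def DropsLeaf (N : ℕ → α → Finset α) (V : ℕ → Finset α) (i : ℕ) : Prop :=
  ∃ x ∈ V i, x ∉ V (i + 1) ∧ ∀ y ∈ N (i + 1) x, y = x

/-- The elements entering the window after steps `i` and `i + 1` lie on the same side of `s`. -/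
def SameSide (s : α) (V : ℕ → Finset α) (i : ℕ) : Prop :=
  EntersRight s V i ∧ EntersRight s V (i + 1) ∨ EntersLeft s V i ∧ EntersLeft s V (i + 1)

open Classical in
/-- The steps dropping a leaf of the final tree. -/
noncomputable def leafSteps (k : ℕ) (N : ℕ → α → Finset α) (V : ℕ → Finset α) : Finset ℕ :=
  (Finset.range k).filter fun i => i + 2 < k ∧ DropsLeaf N V i

open Classical in
/-- The steps after which elements of both sides enter. -/
noncomputable def turningSteps (s : α) (k : ℕ) (V : ℕ → Finset α) : Finset ℕ :=
  (Finset.range k).filter fun i => i + 2 < k ∧ ¬ SameSide s V i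

/-- A leaf dropped by the window is a leaf of the final tree, and it is dropped only once. -/
theorem card_leafSteps_le (h : LocalSystem K s k w N V b) {Z : Finset α}
    (hZ : ∀ x ∈ K, (∀ y ∈ N k x, y = x) → x ∈ Z) : (leafSteps k N V).card ≤ Z.card := by
  classical
  have hex : ∀ i, ∃ x, i ∈ leafSteps k N V → x ∈ V i ∧ x ∉ V (i + 1) ∧ x ∈ Z := by
    intro i
    by_cases hi : i ∈ leafSteps k N V
    · obtain ⟨hi, hik, x, h1, h2, h3⟩ := Finset.mem_filter.1 hi
      refine ⟨x, fun _ => ⟨h1, h2, hZ x (h.window_subset (by omega) h1) ?_⟩⟩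
      rwa [h.dropped_desc (by omega) le_rfl h1 h2]
    · exact ⟨s, fun h => absurd h hi⟩
  choose x hx using hex
  refine Finset.card_le_card_of_injOn x (fun i hi => (hx i hi).2.2) ?_
  have key : ∀ i ∈ leafSteps k N V, ∀ j ∈ leafSteps k N V, x i = x j → ¬ i < j := by
    intro i hi j hj hij hlt
    have hjk := Finset.mem_range.1 (Finset.mem_filter.1 hj).1
    exact h.dropped_notMem hlt hjk (hx i hi).1 (hx i hi).2.1 (hij ▸ (hx j hj).1)
  intro i hi j hj hij
  exact le_antisymm (not_lt.1 (key j hj i hi hij.symm)) (not_lt.1 (key i hi j hj hij))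

theorem not_seen_of_entering (h : LocalSystem K s k w N V b) {i : ℕ} (hi : i + 1 < k) {x : α}
    (hx : x ∈ V (i + 1)) (hx' : x ∉ V i) : ¬ Seen V (i + 1) x :=
  fun hs => hx' (h.mem_prev_of_seen hi hx hs)

/-- If elements of both sides enter after steps `i` and `i + 1`, the path has a zigzag between them,
and its upper element enters at one of these two moments. Hence a zigzag is charged at most twice.
-/
theorem card_turningSteps_le (h : LocalSystem K s k w N V b) {Z : Finset α}
    (hr : ∀ x ∈ zigzags K s (N 0), x ∈ Z) (hl : ∀ x ∈ zigzags (α := αᵒᵈ) K s (N 0), x ∈ Z) :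
    (turningSteps s k V).card ≤ 2 * Z.card := by
  classical
  have t0 := h.tree 0 (Nat.zero_le _)
  have hex : ∀ i, ∃ u, i ∈ turningSteps s k V → u ∈ Z ∧ Seen V (i + 3) u ∧
      ¬ Seen V (i + 1) u := by
    intro i
    by_cases hi : i ∈ turningSteps s k V
    · obtain ⟨_, hik, hside⟩ := Finset.mem_filter.1 hi
      have hsee : ∀ x, (x ∈ V (i + 1) ∧ x ∉ V i ∨ x ∈ V (i + 2) ∧ x ∉ V (i + 1)) →
          x ∈ K ∧ x ≠ s ∧ Seen V (i + 3) x ∧ ¬ Seen V (i + 1) x := by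
        intro x hx
        have hns : ¬ Seen V (i + 1) x := by
          rcases hx with ⟨h1, h2⟩ | ⟨h1, h2⟩
          · exact h.not_seen_of_entering (by omega) h1 h2
          · rintro ⟨j, hj, hxj⟩
            exact h.not_seen_of_entering hik h1 h2 ⟨j, by omega, hxj⟩
        refine ⟨?_, ?_, ?_, hns⟩
        · rcases hx with ⟨h1, _⟩ | ⟨h1, _⟩
          · exact h.window_subset (by omega) h1
          · exact h.window_subset hik h1
        · rintro rfl
          exact hns ⟨0, by omega, h.start (by omega)⟩
        · rcases hx with ⟨h1, _⟩ | ⟨h1, _⟩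
          · exact ⟨i + 1, by omega, h1⟩
          · exact ⟨i + 2, by omega, h1⟩
      have hx : ∃ x, (x ∈ V (i + 1) ∧ x ∉ V i ∨ x ∈ V (i + 2) ∧ x ∉ V (i + 1)) ∧ x < s := by
        by_contra! hno
        refine hside (Or.inl ⟨fun x h1 h2 => ?_, fun x h1 h2 => ?_⟩)
        · exact lt_of_le_of_ne (hno x (Or.inl ⟨h1, h2⟩)) (hsee x (Or.inl ⟨h1, h2⟩)).2.1.symm
        · exact lt_of_le_of_ne (hno x (Or.inr ⟨h1, h2⟩)) (hsee x (Or.inr ⟨h1, h2⟩)).2.1.symm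
      have hy : ∃ x, (x ∈ V (i + 1) ∧ x ∉ V i ∨ x ∈ V (i + 2) ∧ x ∉ V (i + 1)) ∧ s < x := by
        by_contra! hno
        refine hside (Or.inr ⟨fun x h1 h2 => ?_, fun x h1 h2 => ?_⟩)
        · exact lt_of_le_of_ne (hno x (Or.inl ⟨h1, h2⟩)) (hsee x (Or.inl ⟨h1, h2⟩)).2.1
        · exact lt_of_le_of_ne (hno x (Or.inr ⟨h1, h2⟩)) (hsee x (Or.inr ⟨h1, h2⟩)).2.1
      obtain ⟨x, hx, hxs⟩ := hx
      obtain ⟨y, hy, hsy⟩ := hy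
      obtain ⟨hxK, _, hx3, hx1⟩ := hsee x hx
      obtain ⟨hyK, _, hy3, hy1⟩ := hsee y hy
      have fin : ∀ u a c, a ∈ K → u ∈ K → Seen V (i + 3) a → ¬ Seen V (i + 1) c → u ∈ N 0 a →
          c ∈ N 0 u → Seen V (i + 3) u ∧ ¬ Seen V (i + 1) u := fun u a c ha hu h1 h2 h3 h4 =>
        ⟨h.seen_closed (by omega) a ha h1 u h3,
          fun hs => h2 (h.seen_closed (by omega) u hu hs c h4)⟩
      rcases t0.chain x hxK y hyK s (h.path x hxK) (h.path y hyK) with hc | hc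
      · obtain ⟨u, hu, h1, h2⟩ := exists_zigzag (α := αᵒᵈ) t0.dual h.mem h.path
          (x := y) (y := x) hsy hxs hxK hc
        exact ⟨u, fun _ => ⟨hl u hu, fin u x y hxK (mem_zigzags.1 hu).1 hx3 hy1 h1 h2⟩⟩
      · obtain ⟨u, hu, h1, h2⟩ := exists_zigzag t0 h.mem h.path hxs hsy hyK hc
        exact ⟨u, fun _ => ⟨hr u hu, fin u y x hyK (mem_zigzags.1 hu).1 hy3 hx1 h1 h2⟩⟩
    · exact ⟨s, fun h => absurd h hi⟩
  choose u hu using hex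
  refine Finset.card_le_mul_card_image_of_maps_to (f := u) (fun i hi => (hu i hi).1) 2
    fun z _ => ?_
  rcases (Finset.filter (fun i => u i = z) (turningSteps s k V)).eq_empty_or_nonempty with h0 | hne
  · rw [h0]; simp
  obtain ⟨i₀, hi₀, hmin⟩ := Finset.exists_min_image _ id hne
  -- `z` is seen before step `i₀ + 3` but, for each such `i`, not before step `i + 1`; hence `i ≤ i₀
  -- + 1`.
  have : Finset.filter (fun i => u i = z) (turningSteps s k V) ⊆ {i₀, i₀ + 1} := by
    intro i hi
    obtain ⟨h1, h2⟩ := Finset.mem_filter.1 hi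
    obtain ⟨h3, h4⟩ := Finset.mem_filter.1 hi₀
    have hle : i₀ ≤ i := hmin i hi
    obtain ⟨_, ⟨j, hj, hzj⟩, _⟩ := hu i₀ h3
    have hn := (hu i h1).2.2
    rw [h2] at hn
    rw [h4] at hzj
    have : ¬ j < i + 1 := fun hlt => hn ⟨j, hlt, hzj⟩
    simp only [Finset.mem_insert, Finset.mem_singleton]
    omega
  exact (Finset.card_le_card this).trans Finset.card_le_two

theorem card_supply_le (h : LocalSystem K s k w N V b) {i : ℕ} (hi : i < k) :
    (supply V i).card ≤ w :=
  (Finset.card_le_card fun _ hx => (mem_supply.1 hx).1).trans (h.window i hi)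

theorem not_entersLeft (h : LocalSystem K s k w N V b) {i : ℕ} (hi : i + 1 < k)
    (hr : EntersRight s V i) : ¬ EntersLeft s V i := by
  intro hl
  obtain ⟨x, hx, hx'⟩ := h.progress i hi
  exact lt_asymm (hr x hx hx') (hl x hx hx')

/-- Since some element enters at every step, consecutive pairs on a common side force the same side
throughout the run. -/
theorem rightGood_of_run (h : LocalSystem K s k w N V b) {i L : ℕ} (hi : i + L + 1 < k)
    (hr : EntersRight s V i) (hdrop : ∀ j < L, ¬ DropsLeaf N V (i + j))
    (hside : ∀ j < L, SameSide s V (i + j)) :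
    EntersRight s V (i + L) ∧ ∀ j, i ≤ j → j < i + L → RightGood s N V j := by
  have hall : ∀ j ≤ L, EntersRight s V (i + j) := by
    intro j
    induction j with
    | zero => exact fun _ => hr
    | succ j ih =>
      intro hj
      rcases hside j hj with h1 | h1
      · exact h1.2
      · exact absurd h1.1 (h.not_entersLeft (by omega) (ih (by omega)))
  refine ⟨hall L le_rfl, fun j h1 h2 => ?_⟩
  obtain ⟨j, rfl⟩ : ∃ j', j = i + j' := ⟨j - i, by omega⟩
  refine ⟨hall j (by omega), fun x hx hx' => ?_⟩
  by_contra! hno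
  exact hdrop j (by omega) ⟨x, hx, hx', hno⟩

/-- If the supply decreases by `e i` over each run of `L` good steps starting with step `i`, then
the total of `e` is bounded by the number of leaves and zigzags. -/
theorem sum_le_of_supply (h : LocalSystem K s k w N V b) {Z Z' : Finset α}
    (hZ : ∀ x ∈ K, (∀ y ∈ N k x, y = x) → x ∈ Z)
    (hr : ∀ x ∈ zigzags K s (N 0), x ∈ Z') (hl : ∀ x ∈ zigzags (α := αᵒᵈ) K s (N 0), x ∈ Z')
    {e : ℕ → ℕ} (he : ∀ i, e i ≤ 1) {L : ℕ} (hL : 0 < L)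
    (hright : ∀ i, i + L < k → (∀ j, i ≤ j → j < i + L → RightGood s N V j) →
      e i + (supply V (i + L)).card ≤ (supply V i).card)
    (hleft : ∀ i, i + L < k → (∀ j, i ≤ j → j < i + L → RightGood (α := αᵒᵈ) s N V j) →
      e i + (supply (α := αᵒᵈ) V (i + L)).card ≤ (supply (α := αᵒᵈ) V i).card) :
    ∑ i ∈ Finset.range (k - (L + 1)), e i ≤
      L * w + (w + 1) * (L * (Z.card + 2 * Z'.card)) := by
  classical
  by_cases hk : k ≤ L
  · rw [show k - (L + 1) = 0 by omega]
    simp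
  set bad := leafSteps k N V ∪ turningSteps s k V with hbad
  have hbc : bad.card ≤ Z.card + 2 * Z'.card :=
    (Finset.card_union_le _ _).trans
      (Nat.add_le_add (h.card_leafSteps_le hZ) (h.card_turningSteps_le hr hl))
  -- The supply is measured from the side on which elements currently enter, which is constant along
  -- a good run. At a bad step the increase of at most `w` and the term `e i ≤ 1` are absorbed by
  -- the factor `w + 1`.
  let q : ℕ → ℕ := fun i => if EntersRight s V i then (supply V i).card else
    (supply (α := αᵒᵈ) V i).card
  have hq : ∀ i < k, q i ≤ w := by
    intro i hi
    simp only [q]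
    split_ifs
    · exact h.card_supply_le hi
    · exact h.dual.card_supply_le hi
  refine (sum_le_of_potential (q := q) (bad := bad) (w := w) (L := L)
    (fun i hi => hq i (by omega)) ?_).trans ?_
  · intro i hi
    have hik : i + L + 1 < k := by omega
    by_cases hno : ∃ j < L, i + j ∈ bad
    · obtain ⟨j, hj, hjb⟩ := hno
      have h1 : 1 ≤ ∑ j ∈ Finset.range L, if i + j ∈ bad then 1 else 0 := by
        have := Finset.single_le_sum (s := Finset.range L)
          (f := fun j => if i + j ∈ bad then 1 else 0) (fun _ _ => Nat.zero_le _)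
          (Finset.mem_range.2 hj)
        simpa [hjb] using this
      have h2 := Nat.mul_le_mul_left (w + 1) h1
      have h3 := hq (i + L) (by omega)
      have h4 := he i
      omega
    · push Not at hno
      have hdrop : ∀ j < L, ¬ DropsLeaf N V (i + j) := fun j hj hd => hno j hj
        (Finset.mem_union_left _ (Finset.mem_filter.2
          ⟨Finset.mem_range.2 (by omega), by omega, hd⟩))
      have hside : ∀ j < L, SameSide s V (i + j) := fun j hj => by
        by_contra hd
        exact hno j hj (Finset.mem_union_right _ (Finset.mem_filter.2
          ⟨Finset.mem_range.2 (by omega), by omega, hd⟩))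
      refine le_trans ?_ (Nat.le_add_right _ _)
      simp only [q]
      by_cases hri : EntersRight s V i
      · obtain ⟨h1, h2⟩ := h.rightGood_of_run hik hri hdrop hside
        rw [if_pos hri, if_pos h1]
        exact hright i (by omega) h2
      · have hli : EntersLeft s V i := by
          rcases hside 0 hL with h1 | h1
          · exact absurd h1.1 hri
          · exact h1.1
        obtain ⟨h1, h2⟩ := h.dual.rightGood_of_run hik hli hdrop fun j hj => (hside j hj).symm
        have h3 : ¬ EntersRight s V (i + L) := fun hr' =>
          h.not_entersLeft (by omega) hr' h1
        rw [if_neg hri, if_neg h3]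
        exact hleft i (by omega) h2
  · gcongr

theorem card_le (h : LocalSystem K s k w N V b) : K.card ≤ w * k + 1 := by
  classical
  rcases Nat.eq_zero_or_pos k with rfl | hk
  · have : K ⊆ {s} := fun x hx => Finset.mem_singleton.2
      ((h.tree 0 le_rfl).antisymm x hx s (h.path x hx) (h.root x hx))
    simpa using Finset.card_le_card this
  · have : K ⊆ (Finset.range k).biUnion V := fun x hx => by
      obtain ⟨j, hj, hxj⟩ := h.seen_all hk hx
      exact Finset.mem_biUnion.2 ⟨j, Finset.mem_range.2 hj, hxj⟩
    have h1 := (Finset.card_le_card this).trans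
      (Finset.card_biUnion_le_card_mul _ _ w fun i hi => h.window i (Finset.mem_range.1 hi))
    rw [Finset.card_range, mul_comm] at h1
    omega

open Classical in
/-- Local algorithms with many windows that are not rearranged into paths. -/
theorem card_not_path_le (h : LocalSystem K s k w N V b) {Z Z' : Finset α}
    (hZ : ∀ x ∈ K, (∀ y ∈ N k x, y = x) → x ∈ Z)
    (hr : ∀ x ∈ zigzags K s (N 0), x ∈ Z') (hl : ∀ x ∈ zigzags (α := αᵒᵈ) K s (N 0), x ∈ Z')
    (hc : BottomsCovered k N V b 1) {F : Finset ℕ} (hF : ∀ i ∈ F, i < k)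
    (hF' : ∀ i ∈ F, ∃ y₁ y₂, y₁ ≠ y₂ ∧ IsWindowLeaf N V i y₁ ∧ IsWindowLeaf N V i y₂) :
    F.card ≤ w + (w + 1) * (Z.card + 2 * Z'.card) + 2 := by
  have key := h.sum_le_of_supply hZ hr hl (e := fun i => if i ∈ F then 1 else 0)
    (fun i => by split_ifs <;> simp) (L := 1) one_pos
    (fun i hi hg => by
      split_ifs with hiF
      · obtain ⟨y₁, y₂, hne, h1, h2⟩ := hF' i hiF
        have := h.card_supply_lt_of_not_path hc hi (hg i le_rfl (by omega)) h1 h2 hne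
        omega
      · rw [zero_add]
        exact Finset.card_le_card (h.supply_subset hi (hg i le_rfl (by omega))))
    (fun i hi hg => by
      split_ifs with hiF
      · obtain ⟨y₁, y₂, hne, h1, h2⟩ := hF' i hiF
        have := h.dual.card_supply_lt_of_not_path hc hi (hg i le_rfl (by omega)) h1 h2 hne
        omega
      · rw [zero_add]
        exact Finset.card_le_card (h.dual.supply_subset hi (hg i le_rfl (by omega))))
  -- `key` counts only steps before `k - 2`; the last two are added separately.
  have hsub : F ⊆ ((Finset.range (k - 2)).filter fun i => i ∈ F) ∪ {k - 2, k - 1} := by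
    intro i hi
    have := hF i hi
    simp only [Finset.mem_union, Finset.mem_filter, Finset.mem_range, Finset.mem_insert,
      Finset.mem_singleton]
    by_cases h1 : i < k - 2
    · exact Or.inl ⟨h1, hi⟩
    · right; omega
  have h1 := (Finset.card_le_card hsub).trans (Finset.card_union_le _ _)
  have h2 : ({k - 2, k - 1} : Finset ℕ).card ≤ 2 := Finset.card_le_two
  rw [Finset.card_filter] at h1
  rw [one_mul, one_mul] at key
  have h3 : k - (1 + 1) = k - 2 := rfl
  rw [h3] at key
  omega

/-- Every step counts here, since each stretch of `2 * m` good steps uses up an element of the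
supply. -/
theorem length_le_of_raised (h : LocalSystem K s k w N V b) {Z Z' : Finset α}
    (hZ : ∀ x ∈ K, (∀ y ∈ N k x, y = x) → x ∈ Z)
    (hr : ∀ x ∈ zigzags K s (N 0), x ∈ Z') (hl : ∀ x ∈ zigzags (α := αᵒᵈ) K s (N 0), x ∈ Z')
    {m : ℕ} (hm : 0 < m) (hc : BottomsCovered k N V b m) (hra : BottomsRaised k N V b) :
    k ≤ 2 * m * w + (w + 1) * (2 * m * (Z.card + 2 * Z'.card)) + (2 * m + 1) := by
  have key := h.sum_le_of_supply hZ hr hl (e := fun _ => 1) (fun _ => le_rfl) (L := 2 * m)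
    (by omega)
    (fun i hi hg => by
      have := h.card_supply_lt_of_raised hc hra hi hg
      omega)
    (fun i hi hg => by
      have := h.dual.card_supply_lt_of_raised hc hra.dual hi hg
      omega)
  rw [Finset.sum_const, Finset.card_range, smul_eq_mul, mul_one] at key
  omega

end LocalSystem

/-! ### Local algorithms -/

theorem exists_mem_desc_of_notMem_leaves {t : BinaryTree ℕ} (ht : IsBST t) {x : ℕ}
    (hx : x ∈ keys t) (hx' : x ∉ leaves t) : ∃ y ∈ desc t x, y ≠ x := by
  induction t with
  | nil => simp [keys] at hx
  | node v l r ihl ihr =>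
    have hl := ht.1
    have hr := ht.2.1
    have key : ∀ z, (z ∈ keys l ∨ z ∈ keys r) → ∃ y ∈ desc (node v l r) v, y ≠ v := by
      rintro z hz
      refine ⟨z, ?_, ?_⟩
      · rw [desc_root, mem_keys_node]; exact Or.inr hz
      · rintro rfl
        rcases hz with hz | hz
        · exact lt_irrefl _ (hl _ hz)
        · exact lt_irrefl _ (hr _ hz)
    by_cases hnil : l = nil ∧ r = nil
    · obtain ⟨rfl, rfl⟩ := hnil
      have hxv : x = v := by simpa [keys] using hx
      exact absurd (by simp [leaves, hxv]) hx'
    · have hlv : leaves (node v l r) = leaves l ∪ leaves r := by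
        cases l <;> cases r <;> simp_all [leaves]
      rw [hlv, Finset.mem_union, not_or] at hx'
      rcases mem_keys_node.1 hx with rfl | hx | hx
      · rcases l with _ | ⟨a, l₁, l₂⟩
        · rcases r with _ | ⟨a, r₁, r₂⟩
          · simp at hnil
          · exact key a (Or.inr (by simp [keys]))
        · exact key a (Or.inl (by simp [keys]))
      · rw [desc_left ht hx]; exact ihl ht.2.2.1 hx hx'.1
      · rw [desc_right ht hx]; exact ihr ht.2.2.2 hx hx'.2

theorem exists_two_leaves_of_not_isPath {t : BinaryTree ℕ} (ht : IsBST t) (hp : ¬ IsPath t) :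
    ∃ y₁ ∈ keys t, ∃ y₂ ∈ keys t, y₁ ≠ y₂ ∧ (∀ z ∈ desc t y₁, z = y₁) ∧
      ∀ z ∈ desc t y₂, z = y₂ := by
  induction t with
  | nil => exact absurd trivial hp
  | node v l r ihl ihr =>
    have hkl : ∀ y ∈ keys l, y ∈ keys (node v l r) := fun y hy => by simp [keys, hy]
    have hkr : ∀ y ∈ keys r, y ∈ keys (node v l r) := fun y hy => by simp [keys, hy]
    rw [IsPath, not_or, not_and, not_and] at hp
    by_cases hl : l = nil
    · obtain ⟨y₁, h1, y₂, h2, hne, h3, h4⟩ := ihr ht.2.2.2 (hp.1 hl)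
      exact ⟨y₁, hkr _ h1, y₂, hkr _ h2, hne, by rwa [desc_right ht h1], by rwa [desc_right ht h2]⟩
    by_cases hr : r = nil
    · obtain ⟨y₁, h1, y₂, h2, hne, h3, h4⟩ := ihl ht.2.2.1 (hp.2 hr)
      exact ⟨y₁, hkl _ h1, y₂, hkl _ h2, hne, by rwa [desc_left ht h1], by rwa [desc_left ht h2]⟩
    have hne : ∀ t : BinaryTree ℕ, IsBST t → t ≠ nil →
        ∃ y ∈ keys t, ∀ z ∈ desc t y, z = y := by
      intro t ht htn
      rcases t with _ | ⟨a, t₁, t₂⟩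
      · exact absurd rfl htn
      · obtain ⟨y, hy, h⟩ := (isTreeOrder_desc ht).exists_leaf (x := a) (by simp [keys])
        exact ⟨y, desc_subset hy, h⟩
    obtain ⟨y₁, h1, h3⟩ := hne l ht.2.2.1 hl
    obtain ⟨y₂, h2, h4⟩ := hne r ht.2.2.2 hr
    exact ⟨y₁, hkl _ h1, y₂, hkr _ h2, ((ht.1 _ h1).trans (ht.2.1 _ h2)).ne,
      by rwa [desc_left ht h1], by rwa [desc_right ht h2]⟩

/-! ### From decompositions of trees to local systems -/

section Decomposition

variable {T A T' : BinaryTree ℕ} {s w : ℕ} {D : Decomposition (pathTree T s) A}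

theorem Decomposition.isBST_keys (hT : IsBST T) (D : Decomposition (pathTree T s) A) {i : ℕ}
    (hi : i ≤ D.k) : IsBST (D.Q i) ∧ keys (D.Q i) = keys (pathTree T s) := by
  induction i with
  | zero => rw [D.first]; exact ⟨isBST_pathTree hT s, rfl⟩
  | succ i ih =>
    obtain ⟨h1, h2⟩ := ih (by omega)
    have := (D.step i hi).spec h1
    exact ⟨this.2.1, this.1.trans h2⟩

theorem Decomposition.localSystem (hT : IsBST T) (hs : s ∈ keys T) (hA : IsRearrangement T s A T')
    (hD : D.IsLocal s w) :
    LocalSystem (keys (pathTree T s)) s D.k w (fun i => desc (D.Q i)) (fun i => keys (D.path i))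
      D.bottom where
  tree i hi := (D.isBST_keys hT hi).2 ▸ isTreeOrder_desc (D.isBST_keys hT hi).1
  mem := mem_keys_pathTree.2 (mem_searchPath_self hT hs)
  path x hx := by
    rw [D.first]
    exact mem_desc_pathTree_of_mem hT hs hx
  root x hx := by
    rw [← hA.1.2] at hx
    obtain ⟨l, r, rfl⟩ := hA.2.1
    rwa [D.last, desc_root]
  unchanged i hi x hx hxV := by
    obtain ⟨h1, h2⟩ := D.isBST_keys hT hi.le
    exact ((D.step i hi).spec h1).2.2.1 x (h2 ▸ hx) hxV
  window_path i hi := by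
    obtain ⟨h1, h2⟩ := D.isBST_keys hT hi.le
    rw [← h2]
    exact ((D.step i hi).spec h1).2.2.2.2.1
  bottom_mem i hi := ((D.step i hi).spec (D.isBST_keys hT hi.le).1).2.2.2.2.2.2.2.1
  window_tree i hi := by
    obtain ⟨_, _, _, h1, _, h2, h3, _⟩ := (D.step i hi).spec (D.isBST_keys hT hi.le).1
    exact ⟨desc (D.tree i), h3 ▸ isTreeOrder_desc h2, h1⟩
  start := hD.start
  progress i hi := by
    obtain ⟨x, hx⟩ := hD.progress i hi
    rw [Finset.mem_sdiff] at hx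
    exact ⟨x, hx⟩
  overlap i hi := by
    obtain ⟨x, hx⟩ := hD.overlap i hi
    rw [Finset.mem_inter] at hx
    exact ⟨x, hx⟩
  noRevisit i j hij hj x hx hx' hxj :=
    Finset.disjoint_left.1 (hD.noRevisit i j hij hj) (Finset.mem_sdiff.2 ⟨hx, hx'⟩) hxj
  window i hi := by
    rw [card_keys ((D.step i hi).spec (D.isBST_keys hT hi.le).1).2.2.2.2.2.2.2.2]
    exact hD.window i hi

theorem Decomposition.IsGM.bottomsCovered (hT : IsBST T) (hs : s ∈ keys T)
    (hA : IsRearrangement T s A T') (hD : D.IsLocal s w) {δ C : ℝ} (hgm : D.IsGM δ C) :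
    LocalSystem.BottomsCovered D.k (fun i => desc (D.Q i)) (fun i => keys (D.path i))
      D.bottom 1 := by
  intro i hi
  have hsys := D.localSystem hT hs hA hD
  obtain ⟨_, _, _, h1, _, h2, h3, _⟩ := (D.step i (by omega)).spec (D.isBST_keys hT (by omega)).1
  have hb := hsys.bottom_mem_prev hi
  obtain ⟨y, hy, hne⟩ := exists_mem_desc_of_notMem_leaves h2 (h3 ▸ hb) (hgm.1 i hi)
  have hyV : y ∈ keys (D.path i) := h3 ▸ desc_subset hy
  exact ⟨0, one_pos, y, hyV, hne, (h1 _ hb y hyV).2 hy⟩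

theorem Decomposition.exists_windowLeaves (hT : IsBST T) (D : Decomposition (pathTree T s) A)
    {i : ℕ} (hi : i < D.k) (hp : ¬ IsPath (D.tree i)) :
    ∃ y₁ y₂, y₁ ≠ y₂ ∧
      LocalSystem.IsWindowLeaf (fun i => desc (D.Q i)) (fun i => keys (D.path i)) i y₁ ∧
      LocalSystem.IsWindowLeaf (fun i => desc (D.Q i)) (fun i => keys (D.path i)) i y₂ := by
  obtain ⟨_, _, _, h1, _, h2, h3, _⟩ := (D.step i hi).spec (D.isBST_keys hT hi.le).1
  obtain ⟨y₁, hy₁, y₂, hy₂, hne, h4, h5⟩ := exists_two_leaves_of_not_isPath h2 hp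
  rw [h3] at hy₁ hy₂
  exact ⟨y₁, y₂, hne, ⟨hy₁, fun z hz hzy => h4 z ((h1 _ hy₁ z hz).1 hzy)⟩,
    ⟨hy₂, fun z hz hzy => h5 z ((h1 _ hy₂ z hz).1 hzy)⟩⟩

theorem Decomposition.IsSubramanian.bottomsCovered (hT : IsBST T) (hs : s ∈ keys T)
    (hA : IsRearrangement T s A T') (hD : D.IsLocal s w) {m : ℕ} (hm : 0 < m)
    (hsub : D.IsSubramanian m) :
    LocalSystem.BottomsCovered D.k (fun i => desc (D.Q i)) (fun i => keys (D.path i))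
      D.bottom m := by
  intro i hi
  have hsys := D.localSystem hT hs hA hD
  have h1 := hsub.1 i hi
  obtain ⟨m, rfl⟩ : ∃ m', m = m' + 1 := ⟨m - 1, by omega⟩
  have hb : D.bottom (i + (m + 1)) ∈ D.touched i (m + 1) := by
    rw [Decomposition.touched, Finset.mem_biUnion]
    exact ⟨m, Finset.mem_range.2 m.lt_succ_self, hsys.bottom_mem_prev (i := i + m) hi⟩
  rw [Decomposition.composedLeaves, Finset.mem_filter, not_and] at h1
  have h2 := h1 hb
  push Not at h2
  obtain ⟨y, hy, hyb⟩ := h2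
  rw [Decomposition.touched, Finset.mem_biUnion] at hy
  obtain ⟨j, hj, hyj⟩ := hy
  rw [Finset.mem_range] at hj
  have hyK : y ∈ keys (D.Q (i + (m + 1))) := by
    rw [(D.isBST_keys hT hi.le).2]
    exact hsys.window_subset (i := i + j) (by omega) hyj
  rw [mem_ancestors hyK] at hyb
  exact ⟨j, hj, y, hyj, hyb.1.symm, hyb.2⟩

/-- If `y` were below every node of the window, its new depth would be the size of the window minus
one, and no depth in the path exceeds that. -/
theorem Decomposition.IsSubramanian.bottomsRaised (hT : IsBST T) {m : ℕ}
    (hsub : D.IsSubramanian m) :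
    LocalSystem.BottomsRaised D.k (fun i => desc (D.Q i)) (fun i => keys (D.path i))
      D.bottom := by
  intro i hi y hy hnb
  obtain ⟨_, _, _, h1, _, h2, h3, h4, h5⟩ :=
    (D.step i (by omega)).spec (D.isBST_keys hT (by omega)).1
  have hlt := hsub.2 i hi y hy (fun z hz hb => hnb z hz (by omega))
  by_contra! hall
  refine hlt.not_ge ?_
  have e1 : ancestors (D.tree i) y = (keys (D.path i)).erase y := by
    ext x
    rw [mem_ancestors (h3 ▸ hy), Finset.mem_erase]
    refine and_congr_right fun _ => ⟨fun h => ?_, fun h => (h1 x h y hy).1 (hall x h)⟩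
    rw [← h3]
    exact searchPath_subset_keys _ _ _ (mem_desc.1 h).2
  have e2 : ancestors (D.path i) (D.bottom i) ⊆ (keys (D.path i)).erase (D.bottom i) := by
    intro x hx
    rw [ancestors, Finset.mem_erase, List.mem_toFinset] at hx
    exact Finset.mem_erase.2 ⟨hx.1, searchPath_subset_keys _ _ _ hx.2⟩
  rw [depth, depth, e1]
  refine (Finset.card_le_card e2).trans ?_
  rw [Finset.card_erase_of_mem h4, Finset.card_erase_of_mem hy]

/-- `N₀` is meant to be the order of the bare path and `N` that of the whole tree; a zigzag only
involves their common restriction to `V`. -/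
theorem IsPathRearrangement.zigzags_bound {α : Type*} [LinearOrder α] {K V : Finset α} {s : α}
    {N N' N₀ : α → Finset α} {D : ℕ} {w : α → ℝ} (h : IsPathRearrangement K V s N N' D)
    (hw : ∀ a, 0 < w a) (h₀ : ∀ x ∈ V, ∀ y ∈ V, y ∈ N₀ x ↔ y ∈ N x) :
    2 * ((zigzags V s N₀).card : ℝ) ≤ ∑ a ∈ K, logWeight w (N a) - ∑ a ∈ K, logWeight w (N' a) +
      (1 + 2 * (D + 1) + 2 * (D + 1) ^ 2) * (logWeight w K - logWeight w {s}) := by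
  have hex : ∀ u, ∃ v, u ∈ zigzags V s N₀ → v ∈ V ∧ v < s ∧ v ∈ N₀ u ∧
      ∀ y ∈ N₀ u, y ≠ u → y ∈ N₀ v := by
    intro u
    by_cases hu : u ∈ zigzags V s N₀
    · obtain ⟨_, _, v, hv⟩ := mem_zigzags.1 hu
      exact ⟨v, fun _ => hv⟩
    · exact ⟨u, fun h => absurd h hu⟩
  choose v hv using hex
  refine h.zigzag_bound hw (v := v) ⟨fun u hu => (mem_zigzags.1 hu).1,
    fun u hu => (mem_zigzags.1 hu).2.1, fun u hu => (hv u hu).1, fun u hu => (hv u hu).2.1,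
    fun u hu => ?_, fun u hu y hy hyu hne => ?_⟩
  · exact (h₀ u (mem_zigzags.1 hu).1 _ (hv u hu).1).1 (hv u hu).2.2.1
  · exact (h₀ _ (hv u hu).1 y hy).1 ((hv u hu).2.2.2 y
      ((h₀ u (mem_zigzags.1 hu).1 y hy).2 hyu) hne)

end Decomposition

/-- A local algorithm for which the length of the search path is bounded by the number of leaves
of the after-tree and the number of zigzags of the path satisfies the access lemma. -/
theorem satisfiesAccessLemma_of_local {𝒜 : Algorithm} {w : ℕ} {a B : ℝ} (ha : 0 < a) (hB : 0 ≤ B)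
    (h𝒜 : ∀ (T : BinaryTree ℕ) (s : ℕ) (T' : BinaryTree ℕ), IsBST T → s ∈ keys T → 𝒜 T s T' →
      ∃ A, IsRearrangement T s A T' ∧ ∃ D : Decomposition (pathTree T s) A, D.IsLocal s w ∧
        ∀ Z Z' : Finset ℕ,
        (∀ x ∈ keys (pathTree T s), (∀ y ∈ desc (D.Q D.k) x, y = x) → x ∈ Z) →
        (∀ x ∈ zigzags (keys (pathTree T s)) s (desc (D.Q 0)), x ∈ Z') →
        (∀ x ∈ zigzags (α := ℕᵒᵈ) (keys (pathTree T s)) s (desc (D.Q 0)), x ∈ Z') →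
        ((searchPath T s).length : ℝ) ≤ a * (Z.card + 2 * Z'.card) + B) :
    SatisfiesAccessLemma (1 / (3 * a)) 𝒜 := by
  classical
  obtain ⟨M, hM, hMb⟩ := IsPathRearrangement.exists_leaves_bound.{0} w (c := 1) zero_le_one
  set M₁ : ℝ := 1 + 2 * (w + 1) + 2 * (w + 1) ^ 2 with hM₁
  refine ⟨(a * (M + 2 * M₁) + B) / (3 * a), fun T s T' wt hT hs hTT' hw => ?_⟩
  obtain ⟨A, hA, D, hD, hlen⟩ := h𝒜 T s T' hT hs hTT'
  have hsys := D.localSystem hT hs hA hD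
  have hP := isTreeOrder_desc_pathTree hT s
  have hQ0 : desc (D.Q 0) = desc (pathTree T s) := by rw [D.first]
  have hQk : desc (D.Q D.k) = desc A := by rw [D.last]
  have hsP : ∀ x ∈ keys (pathTree T s), s ∈ desc (pathTree T s) x := fun x hx =>
    mem_desc_pathTree_of_mem hT hs hx
  have hpr := hA.isPathRearrangement hT hs (D := w)
    (fun x hx hsx Y hY => hsys.card_gained_le hx fun y hy => by
      obtain ⟨h1, h2, h3, h4⟩ := hY y hy
      rw [hQ0, hQk]
      exact ⟨hP.convex x hx s (hsP x hx) y h1 (Or.inr ⟨h2.le, h3.le⟩), h3.ne, h4⟩)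
    (fun x hx hsx Y hY => hsys.card_gained_le hx fun y hy => by
      obtain ⟨h1, h2, h3, h4⟩ := hY y hy
      rw [hQ0, hQk]
      exact ⟨hP.convex x hx s (hsP x hx) y h1 (Or.inl ⟨h3.le, h2.le⟩), h3.ne', h4⟩)
  have hiff : ∀ x ∈ keys (pathTree T s), ∀ y ∈ keys (pathTree T s),
      y ∈ desc (D.Q 0) x ↔ y ∈ desc T x := fun x hx y hy => by
    rw [hQ0]; exact mem_desc_pathTree hT hx hy
  have hz1 := hpr.zigzags_bound hw hiff
  have hz2 := hpr.dual.zigzags_bound hw hiff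
  set Z₁ : Finset ℕ := zigzags (keys (pathTree T s)) s (desc (D.Q 0)) with hZ₁
  set Z₂ : Finset ℕ := zigzags (α := ℕᵒᵈ) (keys (pathTree T s)) s (desc (D.Q 0)) with hZ₂
  have hz2' : 2 * (Z₂.card : ℝ) ≤ ∑ a ∈ keys T, logWeight wt (desc T a) -
      ∑ a ∈ keys T, logWeight wt (desc T' a) +
      M₁ * (logWeight wt (keys T) - logWeight wt {s}) := hz2
  set Z := (keys (pathTree T s)).filter fun x => ∀ y ∈ desc A x, y = x with hZ
  have hZb := hMb hpr hw (Z := Z) (fun x hx => by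
    obtain ⟨h1, h2⟩ := Finset.mem_filter.1 hx
    exact ⟨h1, fun y hy hyx => h2 y ((hA.mem_desc_iff hT h1 hy).1 hyx)⟩)
  have hl := hlen Z (Z₁ ∪ Z₂) (fun x hx h => Finset.mem_filter.2 ⟨hx, hQk ▸ h⟩)
    (fun x hx => Finset.mem_union_left _ hx) (fun x hx => Finset.mem_union_right _ hx)
  have hcu : ((Z₁ ∪ Z₂).card : ℝ) ≤ Z₁.card + Z₂.card := by
    exact_mod_cast Finset.card_union_le _ _
  rw [← hA.potential_sub hT wt] at hz1 hz2' hZb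
  have hL := hpr.logWeight_singleton_le hw
  rw [weight, logb_div_eq hw hs]
  set L := logWeight wt (keys T) - logWeight wt {s} with hLd
  have hL0 : 0 ≤ L := by linarith
  set Δ := potential wt T - potential wt T' with hΔ
  -- Leaves, right zigzags and left zigzags each use the potential drop once; this is the origin of
  -- the 3 in the cost factor.
  have h1 : (Z.card : ℝ) + 2 * (Z₁ ∪ Z₂).card ≤ 3 * Δ + (M + 2 * M₁) * (1 + L) := by
    have : 0 ≤ M₁ := by positivity
    nlinarith
  have h2 : ((searchPath T s).length : ℝ) ≤ 3 * a * Δ + (a * (M + 2 * M₁) + B) * (1 + L) := by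
    have := mul_le_mul_of_nonneg_left h1 ha.le
    nlinarith [mul_nonneg hB hL0]
  have h3 : Δ + (a * (M + 2 * M₁) + B) / (3 * a) * (1 + L) =
      1 / (3 * a) * (3 * a * Δ + (a * (M + 2 * M₁) + B) * (1 + L)) := by
    field_simp
  rw [h3]
  exact mul_le_mul_of_nonneg_left h2 (by positivity)

theorem length_searchPath_eq_card {T : BinaryTree ℕ} (hT : IsBST T) (s : ℕ) :
    (searchPath T s).length = (keys (pathTree T s)).card := by
  rw [card_keys (isBST_pathTree hT s), length_searchPath]

theorem exists_satisfiesAccessLemma_of_isGMLocal {𝒜 : Algorithm} (h𝒜 : IsGMLocal 𝒜) :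
    ∃ c : ℝ, 0 < c ∧ SatisfiesAccessLemma c 𝒜 := by
  classical
  obtain ⟨w, δ, C, hδ, h⟩ := h𝒜
  -- The summand 1 keeps the constant positive even for `w = 0`.
  have ha : 0 < (w * (w + 1) + 1) / δ := by positivity
  refine ⟨_, by positivity, satisfiesAccessLemma_of_local (w := w) ha
    (B := w * (|C| + w + 2) / δ + 1) (by positivity) fun T s T' hT hs hTT' => ?_⟩
  obtain ⟨A, hA, D, hD, hgm⟩ := h T s T' hT hs hTT'
  refine ⟨A, hA, D, hD, fun Z Z' hZ hr hl => ?_⟩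
  have hsys := D.localSystem hT hs hA hD
  have h1 := hsys.card_not_path_le hZ hr hl (hgm.bottomsCovered hT hs hA hD)
    (F := (Finset.range D.k).filter fun i => ¬ IsPath (D.tree i))
    (fun i hi => Finset.mem_range.1 (Finset.mem_filter.1 hi).1)
    (fun i hi => D.exists_windowLeaves hT (Finset.mem_range.1 (Finset.mem_filter.1 hi).1)
      (Finset.mem_filter.1 hi).2)
  have h2 := hgm.2
  have h3 : (((Finset.range D.k).filter fun i => ¬ IsPath (D.tree i)).card : ℝ) ≤
      w + (w + 1) * (Z.card + 2 * Z'.card) + 2 := by exact_mod_cast h1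
  have h4 : ((searchPath T s).length : ℝ) ≤ w * D.k + 1 := by
    rw [length_searchPath_eq_card hT]
    exact_mod_cast hsys.card_le
  have hk : (D.k : ℝ) ≤ (|C| + w + 2 + (w + 1) * (Z.card + 2 * Z'.card)) / δ := by
    rw [le_div_iff₀ hδ]
    have := le_abs_self C
    have h2' : δ * D.k - C ≤ w + (w + 1) * (Z.card + 2 * Z'.card) + 2 := by
      refine le_trans (le_of_le_of_eq h2 ?_) h3
      congr
    linarith
  calc ((searchPath T s).length : ℝ) ≤ w * D.k + 1 := h4
    _ ≤ w * ((|C| + w + 2 + (w + 1) * (Z.card + 2 * Z'.card)) / δ) + 1 := by gcongr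
    _ = w * (w + 1) / δ * (Z.card + 2 * Z'.card) + (w * (|C| + w + 2) / δ + 1) := by ring
    _ ≤ (w * (w + 1) + 1) / δ * (Z.card + 2 * Z'.card) + (w * (|C| + w + 2) / δ + 1) := by
        gcongr
        linarith

theorem exists_satisfiesAccessLemma_of_isSubramanianLocal {𝒜 : Algorithm}
    (h𝒜 : IsSubramanianLocal 𝒜) : ∃ c : ℝ, 0 < c ∧ SatisfiesAccessLemma c 𝒜 := by
  obtain ⟨w, m, hm, h⟩ := h𝒜
  have ha : (0 : ℝ) < w * (w + 1) * (2 * m) + 1 := by positivity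
  refine ⟨_, by positivity, satisfiesAccessLemma_of_local (w := w) ha
    (B := w * (2 * m * w + (2 * m + 1)) + 1) (by positivity) fun T s T' hT hs hTT' => ?_⟩
  obtain ⟨A, hA, D, hD, hsub⟩ := h T s T' hT hs hTT'
  refine ⟨A, hA, D, hD, fun Z Z' hZ hr hl => ?_⟩
  have hsys := D.localSystem hT hs hA hD
  have h1 := hsys.length_le_of_raised hZ hr hl hm (hsub.bottomsCovered hT hs hA hD hm)
    (hsub.bottomsRaised hT)
  have h2 : (D.k : ℝ) ≤ 2 * m * w + (w + 1) * (2 * m * (Z.card + 2 * Z'.card)) + (2 * m + 1) := by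
    exact_mod_cast h1
  have h4 : ((searchPath T s).length : ℝ) ≤ w * D.k + 1 := by
    rw [length_searchPath_eq_card hT]
    exact_mod_cast hsys.card_le
  have h5 := mul_le_mul_of_nonneg_left h2 (show (0 : ℝ) ≤ w by positivity)
  have h6 : (0 : ℝ) ≤ Z.card + 2 * Z'.card := by positivity
  nlinarith

/-! ### Splaying: the global description -/

/-- The element of a frame. -/
def Frame.key : Frame → ℕ
  | .goLeft p _ => p
  | .goRight p _ => p

/-- The frame is compatible with the way to `s`. -/
def Frame.Valid (s : ℕ) : Frame → Prop
  | .goLeft p _ => s < p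
  | .goRight p _ => p < s

/-- The subtrees hanging off to the left of a way, from left to right. -/
def leftPendants : List Frame → List (BinaryTree ℕ)
  | [] => []
  | .goLeft _ _ :: way => leftPendants way
  | .goRight _ l :: way => leftPendants way ++ [l]

/-- The subtrees hanging off to the right of a way, from left to right. -/
def rightPendants : List Frame → List (BinaryTree ℕ)
  | [] => []
  | .goLeft _ r :: way => r :: rightPendants way
  | .goRight _ _ :: way => rightPendants way

theorem fill_node_append (x : ℕ) (l r : BinaryTree ℕ) {L₁ L₂ : List (BinaryTree ℕ)}
    (h : L₁.length = l.numNodes + 1) :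
    fill (node x l r) (L₁ ++ L₂) = node x (fill l L₁) (fill r L₂) := by
  rw [fill, ← h, List.take_left, List.drop_left]

theorem fill_nil_singleton (a : BinaryTree ℕ) : fill nil [a] = a := rfl

theorem fill_node_append_singleton (x : ℕ) (l : BinaryTree ℕ) {L : List (BinaryTree ℕ)}
    (h : L.length = l.numNodes + 1) (r : BinaryTree ℕ) :
    fill (node x l nil) (L ++ [r]) = node x (fill l L) r := by
  rw [fill_node_append x l nil h, fill_nil_singleton]

theorem fill_node_cons (x : ℕ) (l r : BinaryTree ℕ) (L : List (BinaryTree ℕ)) :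
    fill (node x nil r) (l :: L) = node x l (fill r L) := by
  rw [← List.singleton_append, fill_node_append x nil r rfl, fill_nil_singleton]

theorem fill_leaf (x : ℕ) (l r : BinaryTree ℕ) : fill (node x nil nil) [l, r] = node x l r := rfl

/-- Splaying agrees with the global description. -/
theorem splayUp_eq_fill (s : ℕ) (a b : BinaryTree ℕ) (way : List Frame)
    (AL AR : BinaryTree ℕ) (LL LR : List (BinaryTree ℕ)) (ha : a = fill AL LL)
    (hb : b = fill AR LR) (hLL : LL.length = AL.numNodes + 1) (hLR : LR.length = AR.numNodes + 1)
    (hv : ∀ f ∈ way, f.Valid s) :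
    splayUp s a b way =
      fill (node s (globalSides s (way.map Frame.key) (AL, AR)).1
        (globalSides s (way.map Frame.key) (AL, AR)).2)
        (leftPendants way ++ LL ++ (LR ++ rightPendants way)) := by
  -- `AL` and `AR` are the sides of the after-tree built so far, `LL` and `LR` the pendant subtrees
  -- already attached to them. A double rotation extends both in step with two elements of the
  -- global description.
  induction a, b, way using splayUp.induct generalizing AL AR LL LR with
  | case1 a b =>
    simp only [splayUp, List.map_nil, globalSides, leftPendants, rightPendants, List.nil_append,
      List.append_nil]
    rw [fill_node_append s AL AR hLL, ha, hb]
  | case2 a b p c =>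
    have hp : s < p := hv _ (List.mem_singleton_self _)
    simp only [splayUp, List.map_cons, List.map_nil, Frame.key, globalSides, leftPendants,
      rightPendants, List.nil_append, pushSide, if_neg hp.not_gt]
    rw [fill_node_append s _ _ hLL, fill_node_append_singleton p AR hLR, ha, hb]
  | case3 a b p c =>
    have hp : p < s := hv _ (List.mem_singleton_self _)
    simp only [splayUp, List.map_cons, List.map_nil, Frame.key, globalSides, leftPendants,
      rightPendants, List.nil_append, pushSide, if_pos hp, List.append_nil]
    rw [fill_node_append s _ _ (by simp [hLL]), List.singleton_append, fill_node_cons,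
      ha, hb]
  | case4 a b p c g d rest ih =>
    have hp : s < p := hv (.goLeft p c) (by simp)
    have hg : s < g := hv (.goLeft g d) (by simp)
    rw [splayUp, ih AL (node p AR (node g nil nil)) LL (LR ++ [c, d]) ha
      (by rw [fill_node_append p AR _ hLR, fill_leaf, hb]) hLL (by simp [hLR])
      (fun f hf => hv f (by simp [hf]))]
    simp only [List.map_cons, Frame.key, globalSides, if_neg fun h : p < s ∧ g < s => hp.not_gt h.1,
      if_pos (And.intro hp hg), leftPendants, rightPendants, List.append_assoc, List.cons_append,
      List.nil_append]
  | case5 a b p c g d rest ih =>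
    have hp : p < s := hv (.goRight p c) (by simp)
    have hg : g < s := hv (.goRight g d) (by simp)
    rw [splayUp, ih (node p (node g nil nil) AL) AR ([d, c] ++ LL) LR
      (by rw [fill_node_append p _ AL rfl, fill_leaf, ha]) hb (by simp [hLL]; omega) hLR
      (fun f hf => hv f (by simp [hf]))]
    simp only [List.map_cons, Frame.key, globalSides, if_pos (And.intro hp hg),
      leftPendants, rightPendants, List.append_assoc, List.cons_append, List.nil_append]
  | case6 a b p c g d rest ih =>
    have hp : s < p := hv (.goLeft p c) (by simp)
    have hg : g < s := hv (.goRight g d) (by simp)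
    rw [splayUp, ih (node g nil AL) (node p AR nil) (d :: LL) (LR ++ [c])
      (by rw [fill_node_cons, ha]) (by rw [fill_node_append_singleton p AR hLR, hb])
      (by simp [hLL]) (by simp [hLR]) (fun f hf => hv f (by simp [hf]))]
    simp only [List.map_cons, Frame.key, globalSides, if_neg fun h : p < s ∧ g < s => hp.not_gt h.1,
      if_neg fun h : s < p ∧ s < g => hg.not_gt h.2, pushSide, if_neg hp.not_gt, if_pos hg,
      leftPendants, rightPendants, List.append_assoc, List.cons_append, List.nil_append]
  | case7 a b p c g d rest ih =>
    have hp : p < s := hv (.goRight p c) (by simp)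
    have hg : s < g := hv (.goLeft g d) (by simp)
    rw [splayUp, ih (node p nil AL) (node g AR nil) (c :: LL) (LR ++ [d])
      (by rw [fill_node_cons, ha]) (by rw [fill_node_append_singleton g AR hLR, hb])
      (by simp [hLL]) (by simp [hLR]) (fun f hf => hv f (by simp [hf]))]
    simp only [List.map_cons, Frame.key, globalSides, if_neg fun h : p < s ∧ g < s => hg.not_gt h.2,
      if_neg fun h : s < p ∧ s < g => hp.not_gt h.1, pushSide, if_neg hg.not_gt, if_pos hp,
      leftPendants, rightPendants, List.append_assoc, List.cons_append, List.nil_append]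

/-- The tree in which the subtree `t` is reached by a way. -/
def plug : List Frame → BinaryTree ℕ → BinaryTree ℕ
  | [], t => t
  | .goLeft p r :: way, t => plug way (node p t r)
  | .goRight p l :: way, t => plug way (node p l t)

theorem searchPath_ne_nil {T : BinaryTree ℕ} (hT : IsBST T) {s : ℕ} (hs : s ∈ keys T) :
    searchPath T s ≠ [] := List.ne_nil_of_mem (mem_searchPath_self hT hs)

theorem tail_reverse_cons {l : List ℕ} (hl : l ≠ []) (x : ℕ) :
    (x :: l).reverse.tail = l.reverse.tail ++ [x] := by
  rw [List.reverse_cons, List.tail_append_of_ne_nil (by simpa using hl)]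

/-- Unfolds the descent: the recorded way is the reversed search path without `s`, and its side
trees together with the two subtrees of `s` are the pendants. -/
theorem splayFrom_eq {T : BinaryTree ℕ} {s : ℕ} (hT : IsBST T) (hs : s ∈ keys T)
    (way : List Frame) : ∃ a b way', splayFrom T s way = splayUp s a b way' ∧
      plug way' (node s a b) = plug way T ∧
      way'.map Frame.key = (searchPath T s).reverse.tail ++ way.map Frame.key ∧
      leftPendants way' ++ [a, b] ++ rightPendants way' =
        leftPendants way ++ pendants T s ++ rightPendants way ∧
      ((∀ f ∈ way, f.Valid s) → ∀ f ∈ way', f.Valid s) := by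
  induction T generalizing way with
  | nil => simp [keys] at hs
  | node x l r ihl ihr =>
    simp only [splayFrom, searchPath, pendants]
    split_ifs with h1 h2
    · have hsl : s ∈ keys l := by
        rcases mem_keys_node.1 hs with rfl | h | h
        · omega
        · exact h
        · have := hT.2.1 s h; omega
      obtain ⟨a, b, way', e1, e2, e3, e4, e5⟩ := ihl hT.2.2.1 hsl (.goLeft x r :: way)
      refine ⟨a, b, way', e1, e2, ?_, ?_, fun h => e5 fun f hf => ?_⟩
      · rw [e3, tail_reverse_cons (searchPath_ne_nil hT.2.2.1 hsl)]
        simp [Frame.key]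
      · rw [e4]; simp [leftPendants, rightPendants]
      · rcases List.mem_cons.1 hf with rfl | hf
        · exact h1
        · exact h f hf
    · have hsr : s ∈ keys r := by
        rcases mem_keys_node.1 hs with rfl | h | h
        · omega
        · have := hT.1 s h; omega
        · exact h
      obtain ⟨a, b, way', e1, e2, e3, e4, e5⟩ := ihr hT.2.2.2 hsr (.goRight x l :: way)
      refine ⟨a, b, way', e1, e2, ?_, ?_, fun h => e5 fun f hf => ?_⟩
      · rw [e3, tail_reverse_cons (searchPath_ne_nil hT.2.2.2 hsr)]
        simp [Frame.key]
      · rw [e4]; simp [leftPendants, rightPendants]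
      · rcases List.mem_cons.1 hf with rfl | hf
        · exact h2
        · exact h f hf
    · obtain rfl : s = x := by omega
      exact ⟨l, r, way, rfl, rfl, by simp, by simp, id⟩

theorem splay_eq_fill {T : BinaryTree ℕ} {s : ℕ} (hT : IsBST T) (hs : s ∈ keys T) :
    splay T s = fill (globalSplayTree T s) (pendants T s) := by
  obtain ⟨a, b, way, e1, _, e3, e4, e5⟩ := splayFrom_eq hT hs []
  rw [splay, e1, splayUp_eq_fill s a b way nil nil [a] [b] rfl rfl rfl rfl (e5 (by simp)), e3,
    globalSplayTree]
  simp only [leftPendants, rightPendants, List.nil_append, List.append_nil] at e4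
  rw [← e4]
  simp

/-- An element taken off its path is hung on the outer side of its new parent, so each side lists
its elements in the same inorder as if all had been put on the path. -/
theorem inorder_globalSides (s : ℕ) (us : List ℕ) (LR : BinaryTree ℕ × BinaryTree ℕ)
    (hus : ∀ u ∈ us, u ≠ s) :
    inorder (globalSides s us LR).1 = (us.filter (· < s)).reverse ++ inorder LR.1 ∧
      inorder (globalSides s us LR).2 = inorder LR.2 ++ us.filter (s < ·) := by
  induction us, LR using globalSides.induct s with
  | case1 LR => simp [globalSides]
  | case2 u LR =>
    have hu : u ≠ s := hus u (by simp)
    rcases lt_or_gt_of_ne hu with h | h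
    · simp [globalSides, pushSide, h, h.not_gt, inorder]
    · simp [globalSides, pushSide, h, h.not_gt, inorder]
  | case3 u v rest LR h ih =>
    obtain ⟨e1, e2⟩ := ih fun x hx => hus x (by simp [hx])
    rw [globalSides, if_pos h, e1, e2]
    simp [inorder, h.1, h.2, h.1.not_gt, h.2.not_gt]
  | case4 u v rest LR h h' ih =>
    obtain ⟨e1, e2⟩ := ih fun x hx => hus x (by simp [hx])
    rw [globalSides, if_neg h, if_pos h', e1, e2]
    simp [inorder, h'.1, h'.2, h'.1.not_gt, h'.2.not_gt]
  | case5 u v rest LR h h' ih =>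
    obtain ⟨e1, e2⟩ := ih fun x hx => hus x (by simp [hx])
    have hu : u ≠ s := hus u (by simp)
    have hv : v ≠ s := hus v (by simp)
    rw [globalSides, if_neg h, if_neg h', e1, e2]
    rcases lt_or_gt_of_ne hu with hu | hu
    · have hv : s < v := by omega
      simp [inorder, pushSide, hu, hv, hu.not_gt, hv.not_gt]
    · have hv : v < s := by omega
      simp [inorder, pushSide, hu, hv, hu.not_gt, hv.not_gt]

theorem inorder_pathTree {T : BinaryTree ℕ} {s : ℕ} (hT : IsBST T) (hs : s ∈ keys T) :
    (∀ u ∈ (searchPath T s).reverse.tail, u ≠ s) ∧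
    inorder (pathTree T s) = ((searchPath T s).reverse.tail.filter (· < s)).reverse ++
      s :: (searchPath T s).reverse.tail.filter (s < ·) := by
  induction T with
  | nil => simp [keys] at hs
  | node x l r ihl ihr =>
    simp only [searchPath, pathTree]
    split_ifs with h1 h2
    · have hsl : s ∈ keys l := by
        rcases mem_keys_node.1 hs with rfl | h | h
        · omega
        · exact h
        · have := hT.2.1 s h; omega
      obtain ⟨e1, e2⟩ := ihl hT.2.2.1 hsl
      rw [tail_reverse_cons (searchPath_ne_nil hT.2.2.1 hsl), inorder, e2]
      refine ⟨fun u hu => ?_, by simp [inorder, h1, h1.not_gt]⟩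
      rcases List.mem_append.1 hu with hu | hu
      · exact e1 u hu
      · rw [List.mem_singleton] at hu; omega
    · have hsr : s ∈ keys r := by
        rcases mem_keys_node.1 hs with rfl | h | h
        · omega
        · have := hT.1 s h; omega
        · exact h
      obtain ⟨e1, e2⟩ := ihr hT.2.2.2 hsr
      rw [tail_reverse_cons (searchPath_ne_nil hT.2.2.2 hsr), inorder, e2]
      refine ⟨fun u hu => ?_, by simp [inorder, h2, h1]⟩
      rcases List.mem_append.1 hu with hu | hu
      · exact e1 u hu
      · rw [List.mem_singleton] at hu; omega
    · obtain rfl : s = x := by omega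
      simp [inorder]

theorem isRearrangement_splay {T : BinaryTree ℕ} {s : ℕ} (hT : IsBST T) (hs : s ∈ keys T) :
    IsRearrangement T s (globalSplayTree T s) (splay T s) := by
  obtain ⟨h1, h2⟩ := inorder_pathTree hT hs
  obtain ⟨h3, h4⟩ := inorder_globalSides s _ (nil, nil) h1
  have e : inorder (globalSplayTree T s) = inorder (pathTree T s) := by
    rw [h2, globalSplayTree, inorder, h3, h4]
    simp [inorder]
  refine ⟨⟨?_, ?_⟩, ⟨_, _, rfl⟩, splay_eq_fill hT hs⟩
  · rw [isBST_iff, e, ← isBST_iff]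
    exact isBST_pathTree hT s
  · rw [keys_eq_toFinset_inorder, e, ← keys_eq_toFinset_inorder]

/-! ### Splaying: the access lemma -/

/-- The total weight of a tree, counting repeated elements. -/
def treeWeight (w : ℕ → ℝ) : BinaryTree ℕ → ℝ
  | nil => 0
  | node x l r => w x + treeWeight w l + treeWeight w r

/-- The sum-of-logs potential with respect to `treeWeight`. -/
noncomputable def treePotential (w : ℕ → ℝ) : BinaryTree ℕ → ℝ
  | nil => 0
  | node x l r => Real.logb 2 (treeWeight w (node x l r)) + treePotential w l + treePotential w r

theorem weight_eq_treeWeight (w : ℕ → ℝ) {T : BinaryTree ℕ} (hT : IsBST T) :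
    weight w T = treeWeight w T := by
  induction T with
  | nil => simp [weight, treeWeight, keys]
  | node x l r ihl ihr =>
    have hd : Disjoint (keys l) (keys r) := Finset.disjoint_left.2 fun y hy hy' =>
      lt_asymm (hT.1 y hy) (hT.2.1 y hy')
    have hn : x ∉ keys l ∪ keys r := by
      rw [Finset.mem_union]
      rintro (h | h)
      · exact lt_irrefl _ (hT.1 x h)
      · exact lt_irrefl _ (hT.2.1 x h)
    rw [weight, keys, Finset.sum_insert hn, Finset.sum_union hd, treeWeight, ← ihl hT.2.2.1,
      ← ihr hT.2.2.2, weight, weight]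
    ring

theorem potential_eq_treePotential (w : ℕ → ℝ) {T : BinaryTree ℕ} (hT : IsBST T) :
    potential w T = treePotential w T := by
  induction T with
  | nil => rfl
  | node x l r ihl ihr =>
    rw [potential, treePotential, ihl hT.2.2.1, ihr hT.2.2.2, weight_eq_treeWeight w hT]

section Splay

variable {w : ℕ → ℝ}

theorem treeWeight_nonneg (hw : ∀ a, 0 < w a) (t : BinaryTree ℕ) : 0 ≤ treeWeight w t := by
  induction t with
  | nil => exact le_rfl
  | node x l r ihl ihr => rw [treeWeight]; linarith [hw x]

theorem treeWeight_plug_congr {t t' : BinaryTree ℕ} (h : treeWeight w t = treeWeight w t')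
    (way : List Frame) : treeWeight w (plug way t) = treeWeight w (plug way t') := by
  induction way generalizing t t' with
  | nil => exact h
  | cons f way ih =>
    cases f <;> exact ih (by simp [treeWeight, h])

/-- Exchanging a subtree for one of equal weight leaves the contributions of all its ancestors
unchanged. -/
theorem treePotential_plug_congr {t t' : BinaryTree ℕ} (h : treeWeight w t = treeWeight w t')
    (way : List Frame) : treePotential w (plug way t) - treePotential w (plug way t') =
      treePotential w t - treePotential w t' := by
  induction way generalizing t t' with
  | nil => rfl
  | cons f way ih =>
    cases f
    · rw [plug, plug, ih (by simp [treeWeight, h])]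
      simp only [treePotential, treeWeight, h]
      ring
    · rw [plug, plug, ih (by simp [treeWeight, h])]
      simp only [treePotential, treeWeight, h]
      ring

/-- Induction step for a double rotation turning `t` into `t'`: the gain of 2 pays for two frames,
and the terms 3(log of the new weight - log of the old weight) telescope. -/
theorem splayUp_bound_of_step {R t t' : BinaryTree ℕ} {rest : List Frame} {u : ℝ}
    (hR : treePotential w R + rest.length ≤ treePotential w (plug rest t') +
      3 * (Real.logb 2 (treeWeight w (plug rest t')) - Real.logb 2 (treeWeight w t')) + 1)
    (h : treeWeight w t' = treeWeight w t)
    (hstep : treePotential w t' + 2 ≤ treePotential w t + 3 * (Real.logb 2 (treeWeight w t) - u)) :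
    treePotential w R + (rest.length + 1 + 1 : ℕ) ≤ treePotential w (plug rest t) +
      3 * (Real.logb 2 (treeWeight w (plug rest t)) - u) + 1 := by
  have h1 := treePotential_plug_congr h rest
  rw [treeWeight_plug_congr h rest, h] at hR
  push_cast
  linarith

/-- The analysis of Sleator and Tarjan. A final zig occurs at most once and accounts for the
additive 1. -/
theorem treePotential_splayUp (hw : ∀ a, 0 < w a) (x : ℕ) (a b : BinaryTree ℕ)
    (way : List Frame) :
    treePotential w (splayUp x a b way) + way.length ≤
      treePotential w (plug way (node x a b)) +
        3 * (Real.logb 2 (treeWeight w (plug way (node x a b))) -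
          Real.logb 2 (treeWeight w (node x a b))) + 1 := by
  have mono : ∀ {u v : ℝ}, 0 < u → u ≤ v → Real.logb 2 u ≤ Real.logb 2 v := fun hu huv =>
    Real.logb_le_logb_of_le (by norm_num) hu huv
  induction a, b, way using splayUp.induct with
  | case1 a b => simp [splayUp, plug]
  | case2 a b p c =>
    have := hw x; have := hw p
    have ha := treeWeight_nonneg hw a
    have hb := treeWeight_nonneg hw b
    have hc := treeWeight_nonneg hw c
    simp only [splayUp, plug, treePotential, treeWeight, List.length_singleton, Nat.cast_one]
    have h1 : w x + treeWeight w a + (w p + treeWeight w b + treeWeight w c) =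
      w p + (w x + treeWeight w a + treeWeight w b) + treeWeight w c := by ring
    rw [h1]
    have h2 := mono (u := w p + treeWeight w b + treeWeight w c)
      (v := w p + (w x + treeWeight w a + treeWeight w b) + treeWeight w c) (by linarith)
      (by linarith)
    have h3 := mono (u := w x + treeWeight w a + treeWeight w b)
      (v := w p + (w x + treeWeight w a + treeWeight w b) + treeWeight w c) (by linarith)
      (by linarith)
    linarith
  | case3 a b p c =>
    have := hw x; have := hw p
    have ha := treeWeight_nonneg hw a
    have hb := treeWeight_nonneg hw b
    have hc := treeWeight_nonneg hw c
    simp only [splayUp, plug, treePotential, treeWeight, List.length_singleton, Nat.cast_one]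
    have h1 : w x + (w p + treeWeight w c + treeWeight w a) + treeWeight w b =
      w p + treeWeight w c + (w x + treeWeight w a + treeWeight w b) := by ring
    rw [h1]
    have h2 := mono (u := w p + treeWeight w c + treeWeight w a)
      (v := w p + treeWeight w c + (w x + treeWeight w a + treeWeight w b)) (by linarith)
      (by linarith)
    have h3 := mono (u := w x + treeWeight w a + treeWeight w b)
      (v := w p + treeWeight w c + (w x + treeWeight w a + treeWeight w b)) (by linarith)
      (by linarith)
    linarith
  | case4 a b p c g d rest ih =>
    have := hw x; have := hw p; have := hw g
    have ha := treeWeight_nonneg hw a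
    have hb := treeWeight_nonneg hw b
    have hc := treeWeight_nonneg hw c
    have hd := treeWeight_nonneg hw d
    refine splayUp_bound_of_step (t' := node x a (node p b (node g c d))) ih (by simp only [treeWeight]; ring) ?_
    simp only [treePotential, treeWeight]
    set A := treeWeight w a
    set B := treeWeight w b
    set C := treeWeight w c
    set D := treeWeight w d
    have h0 : w x + A + (w p + B + (w g + C + D)) = w g + (w p + (w x + A + B) + C) + D := by ring
    rw [h0]
    have h1 := mono (u := w x + A + B) (v := w p + (w x + A + B) + C) (by linarith) (by linarith)
    have h2 := mono (u := w p + B + (w g + C + D)) (v := w g + (w p + (w x + A + B) + C) + D) (by linarith) (by linarith)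
    -- Zig-zig: the new subtree of `g` and the old subtree of `x` are disjoint parts of the whole.
    have h3 := logb_add_logb_add_two_le (a := w g + C + D) (b := w x + A + B)
      (S := w g + (w p + (w x + A + B) + C) + D) (by linarith) (by linarith) (by linarith)
    linarith
  | case5 a b p c g d rest ih =>
    have := hw x; have := hw p; have := hw g
    have ha := treeWeight_nonneg hw a
    have hb := treeWeight_nonneg hw b
    have hc := treeWeight_nonneg hw c
    have hd := treeWeight_nonneg hw d
    refine splayUp_bound_of_step (t' := node x (node p (node g d c) a) b) ih (by simp only [treeWeight]; ring) ?_
    simp only [treePotential, treeWeight]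
    set A := treeWeight w a
    set B := treeWeight w b
    set C := treeWeight w c
    set D := treeWeight w d
    have h0 : w x + (w p + (w g + D + C) + A) + B = w g + D + (w p + C + (w x + A + B)) := by ring
    rw [h0]
    have h1 := mono (u := w x + A + B) (v := w p + C + (w x + A + B)) (by linarith) (by linarith)
    have h2 := mono (u := w p + (w g + D + C) + A) (v := w g + D + (w p + C + (w x + A + B))) (by linarith) (by linarith)
    have h3 := logb_add_logb_add_two_le (a := w g + D + C) (b := w x + A + B)
      (S := w g + D + (w p + C + (w x + A + B))) (by linarith) (by linarith) (by linarith)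
    linarith
  | case6 a b p c g d rest ih =>
    have := hw x; have := hw p; have := hw g
    have ha := treeWeight_nonneg hw a
    have hb := treeWeight_nonneg hw b
    have hc := treeWeight_nonneg hw c
    have hd := treeWeight_nonneg hw d
    refine splayUp_bound_of_step (t' := node x (node g d a) (node p b c)) ih (by simp only [treeWeight]; ring) ?_
    simp only [treePotential, treeWeight]
    set A := treeWeight w a
    set B := treeWeight w b
    set C := treeWeight w c
    set D := treeWeight w d
    have h0 : w x + (w g + D + A) + (w p + B + C) = w g + D + (w p + (w x + A + B) + C) := by ring
    rw [h0]
    have h1 := mono (u := w x + A + B) (v := w p + (w x + A + B) + C) (by linarith) (by linarith)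
    have h2 := mono (u := w x + A + B) (v := w g + D + (w p + (w x + A + B) + C)) (by linarith) (by linarith)
    -- Zig-zag: the new subtrees of `p` and `g` are disjoint parts of the whole.
    have h3 := logb_add_logb_add_two_le (a := w p + B + C) (b := w g + D + A)
      (S := w g + D + (w p + (w x + A + B) + C)) (by linarith) (by linarith) (by linarith)
    linarith
  | case7 a b p c g d rest ih =>
    have := hw x; have := hw p; have := hw g
    have ha := treeWeight_nonneg hw a
    have hb := treeWeight_nonneg hw b
    have hc := treeWeight_nonneg hw c
    have hd := treeWeight_nonneg hw d
    refine splayUp_bound_of_step (t' := node x (node p c a) (node g b d)) ih (by simp only [treeWeight]; ring) ?_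
    simp only [treePotential, treeWeight]
    set A := treeWeight w a
    set B := treeWeight w b
    set C := treeWeight w c
    set D := treeWeight w d
    have h0 : w x + (w p + C + A) + (w g + B + D) = w g + (w p + C + (w x + A + B)) + D := by ring
    rw [h0]
    have h1 := mono (u := w x + A + B) (v := w p + C + (w x + A + B)) (by linarith) (by linarith)
    have h2 := mono (u := w x + A + B) (v := w g + (w p + C + (w x + A + B)) + D) (by linarith) (by linarith)
    have h3 := logb_add_logb_add_two_le (a := w p + C + A) (b := w g + B + D)
      (S := w g + (w p + C + (w x + A + B)) + D) (by linarith) (by linarith) (by linarith)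
    linarith

end Splay

theorem satisfiesAccessLemma_splay : SatisfiesAccessLemma 1 splayAlgorithm := by
  refine ⟨3, ?_⟩
  rintro T s _ w hT hs rfl hw
  have hr := isRearrangement_splay hT hs
  obtain ⟨a, b, way, e1, e2, e3, _, _⟩ := splayFrom_eq hT hs []
  have h := treePotential_splayUp hw s a b way
  rw [plug] at e2
  have hlen : (way.length : ℝ) + 1 = (searchPath T s).length := by
    have h1 := congrArg List.length e3
    have h2 := List.length_pos_iff.2 (searchPath_ne_nil hT hs)
    simp only [List.length_map, List.length_append, List.length_tail, List.length_reverse,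
      List.length_nil, add_zero] at h1
    have h3 : way.length + 1 = (searchPath T s).length := by omega
    exact_mod_cast h3
  rw [← e1, e2] at h
  have hW : 0 < weight w T := sum_weight_pos hw ⟨s, hs⟩
  have hle : Real.logb 2 (w s) ≤ Real.logb 2 (treeWeight w (node s a b)) := by
    refine Real.logb_le_logb_of_le (by norm_num) (hw s) ?_
    rw [treeWeight]
    linarith [treeWeight_nonneg hw a, treeWeight_nonneg hw b]
  rw [Real.logb_div hW.ne' (hw s).ne', potential_eq_treePotential w hT,
    potential_eq_treePotential w (hr.isBST hT), weight_eq_treeWeight w hT, ← hlen]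
  change treePotential w (splay T s) + _ ≤ _ at h
  linarith

end AccessLemma

open AccessLemma in
theorem corollary1 :
    -- splay trees; the global description of splaying agrees with that of Sleator and Tarjan
    ((∀ (T : BinaryTree ℕ) (s : ℕ), IsBST T → s ∈ keys T →
        IsRearrangement T s (globalSplayTree T s) (splay T s)) ∧
      SatisfiesAccessLemma 1 splayAlgorithm) ∧
    -- local algorithms
    (∀ 𝒜 : Algorithm, IsGMLocal 𝒜 → ∃ c : ℝ, 0 < c ∧ SatisfiesAccessLemma c 𝒜) ∧
    (∀ 𝒜 : Algorithm, IsSubramanianLocal 𝒜 → ∃ c : ℝ, 0 < c ∧ SatisfiesAccessLemma c 𝒜) ∧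
    -- Greedy BST
    SatisfiesGeometricAccessLemma 1 greedyBST ∧
    -- strict depth-halving
    (∀ (ε c d : ℝ), 0 < ε → 0 < c → 0 < d → ∀ 𝒜 : Algorithm,
      IsStrictDepthHalving ε c d 𝒜 → SatisfiesAccessLemma 1 𝒜) := by
  exact ⟨⟨fun _ _ hT hs => isRearrangement_splay hT hs, satisfiesAccessLemma_splay⟩,
    fun _ h => exists_satisfiesAccessLemma_of_isGMLocal h,
    fun _ h => exists_satisfiesAccessLemma_of_isSubramanianLocal h,
    satisfiesGeometricAccessLemma_greedyBST,
    fun _ _ _ hε hc _ _ h => satisfiesAccessLemma_of_isStrictDepthHalving hε hc h⟩
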